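/- Let $d\ge 2$ be an integer. For $m\in\mathbb{Z}$ put $\square_m=(-\tfrac12 3^m,\tfrac12 3^m)^d\subset\mathbb{R}^d$. For a bounded open set $U$ write $(f)_U$ for the mean $\frac{1}{|U|}\int_U f$, and $\|f\|_{\underline{L}^p(U)}=\big(\frac{1}{|U|}\int_U|f|^p\big)^{1/p}$ for the volume-normalized $L^p$ norm. Fix $n\in\mathbb{Z}$ and let $\mathbf{a}$ be a measurable field of matrices on $\square_n$ which is symmetric, positive semidefinite and invertible at almost every point, with $\mathbf{a},\mathbf{a}^{-1}\in L^1(\square_n;\mathbb{R}^{d\times d})$. For a cube $U\subseteq\square_n$ let $H^1_{\mathbf{a}}(U)$ be the completion of the functions that are smooth up to the boundary of $U$ under the norm $\big(\|u\|_{L^2(U)}^2+\int_U\nabla u\cdot\mathbf{a}\nabla u\big)^{1/2}$, and let $\mathcal{A}(U)$ be the set of $u\in H^1_{\mathbf{a}}(U)$ with $\int_U\nabla\psi\cdot\mathbf{a}\nabla u=0$ for all $\psi\in C^\infty_c(U)$. Let $\mathbf{a}_*^{-1}(U)$ be the symmetric matrix determined by $$q\cdot\mathbf{a}_*^{-1}(U)q=\sup_{u\in\mathcal{A}(U)}\frac{1}{|U|}\int_U\big(-\nabla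 u\cdot\mathbf{a}\nabla u+2q\cdot\nabla u\big),\qquad q\in\mathbb{R}^d,$$ let $|\mathbf{a}_*^{-1}(U)|=\sup_{|q|=1}q\cdot\mathbf{a}_*^{-1}(U)q$ be its spectral norm, and for $s\in(0,1]$ define the coarse-grained lower ellipticity constant by $$\lambda_s(\square_n)=\Big((1-3^{-s})\sum_{k=-\infty}^{n}3^{-s(n-k)}\max_{z\in 3^k\mathbb{Z}^d\cap\square_n}|\mathbf{a}_*^{-1}(z+\square_k)|^{1/2}\Big)^{-2}\in[0,\infty).$$ Then there exists a constant $C=C(d)<\infty$, depending only on $d$, such that for every $s\in(0,1]$, every $n\in\mathbb{Z}$, every such field $\mathbf{a}$ on $\square_n$ and every $u\in H^1_{\mathbf{a}}(\square_n)$, $$3^{-n}\,\|u-(u)_{\square_n}\|_{\underline{L}^{2^*_s}(\square_n)}\le C\,s^{-1}\,\lambda_s^{-1/2}(\square_n)\,\|\mathbf{a}^{1/2}\nabla u\|_{\underline{L}^2(\square_n)},\qquad 2^*_s=\frac{2d}{d-2(1-s)}.$$ Both sides are read in $[0,\infty]$: if $\lambda_s(\square_n)=0$ then $\lambda_s^{-1/2}(\square_n)=\infty$,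 with the convention $\infty\cdot 0=0$. -/

import Mathlib

open MeasureTheory Filter Topology
open scoped ENNReal ContDiff

noncomputable section

namespace CoarseGrained

/-- The open triadic cube `z + □_m`, where `□_m = (-3^m/2, 3^m/2)^d`. -/
def cube {d : ℕ} (z : EuclideanSpace ℝ (Fin d)) (m : ℤ) : Set (EuclideanSpace ℝ (Fin d)) :=
  {x | ∀ i, |x i - z i| < (3 : ℝ) ^ m / 2}

/-- The point `3^k j` of the lattice `3^k ℤ^d`. -/
def latticePoint {d : ℕ} (k : ℤ) (j : Fin d → ℤ) : EuclideanSpace ℝ (Fin d) :=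
  WithLp.toLp 2 fun i => (3 : ℝ) ^ k * (j i : ℝ)

/-- The bilinear form `p · A q`. -/
def form {d : ℕ} (A : Matrix (Fin d) (Fin d) ℝ) (p q : EuclideanSpace ℝ (Fin d)) : ℝ :=
  dotProduct p.ofLp (A.mulVec q.ofLp)

/-- A coefficient field on `U`: almost everywhere symmetric, positive semidefinite and invertible,
with the entries of `a` and of `a⁻¹` in `L¹(U)`. -/
structure IsCoefficientField {d : ℕ}
    (a : EuclideanSpace ℝ (Fin d) → Matrix (Fin d) (Fin d) ℝ)
    (U : Set (EuclideanSpace ℝ (Fin d))) : Prop where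
  posSemidef : ∀ᵐ x ∂(volume.restrict U), (a x).PosSemidef
  invertible : ∀ᵐ x ∂(volume.restrict U), IsUnit (a x)
  integrable : ∀ i j, IntegrableOn (fun x => a x i j) U
  integrable_inv : ∀ i j, IntegrableOn (fun x => (a x)⁻¹ i j) U

/-- The energy `∫_U g · a g = ‖a^{1/2} g‖²_{L²(U)}` of a vector field `g`. -/
def energy {d : ℕ} (a : EuclideanSpace ℝ (Fin d) → Matrix (Fin d) (Fin d) ℝ)
    (U : Set (EuclideanSpace ℝ (Fin d)))
    (g : EuclideanSpace ℝ (Fin d) → EuclideanSpace ℝ (Fin d)) : ℝ≥0∞ :=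
  ∫⁻ x in U, ENNReal.ofReal (form (a x) (g x) (g x))

/-- `u ∈ H¹_a(U)` with gradient `∇u = g`. The space is the completion of the functions that are
smooth up to the boundary under the norm `(‖u‖²_{L²(U)} + ∫_U ∇u · a∇u)^{1/2}`, realized as a space
of functions together with their gradients. -/
structure MemH1 {d : ℕ} (a : EuclideanSpace ℝ (Fin d) → Matrix (Fin d) (Fin d) ℝ)
    (U : Set (EuclideanSpace ℝ (Fin d))) (u : EuclideanSpace ℝ (Fin d) → ℝ)
    (g : EuclideanSpace ℝ (Fin d) → EuclideanSpace ℝ (Fin d)) : Prop where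
  memLp : MemLp u 2 (volume.restrict U)
  aestronglyMeasurable_grad : AEStronglyMeasurable g (volume.restrict U)
  exists_approx : ∃ φ : ℕ → EuclideanSpace ℝ (Fin d) → ℝ,
    (∀ j, ContDiff ℝ ∞ (φ j)) ∧
    Tendsto (fun j => eLpNorm (fun x => φ j x - u x) 2 (volume.restrict U)) atTop (𝓝 0) ∧
    Tendsto (fun j => energy a U (fun x => gradient (φ j) x - g x)) atTop (𝓝 0)

/-- `u ∈ H¹_a(U)`, with gradient `g`, is a weak solution of `∇ · a∇u = 0` in `U`. -/
def IsSolution {d : ℕ} (a : EuclideanSpace ℝ (Fin d) → Matrix (Fin d) (Fin d) ℝ)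
    (U : Set (EuclideanSpace ℝ (Fin d))) (u : EuclideanSpace ℝ (Fin d) → ℝ)
    (g : EuclideanSpace ℝ (Fin d) → EuclideanSpace ℝ (Fin d)) : Prop :=
  MemH1 a U u g ∧
    ∀ ψ : EuclideanSpace ℝ (Fin d) → ℝ, ContDiff ℝ ∞ ψ → HasCompactSupport ψ → tsupport ψ ⊆ U →
      ∫ x in U, form (a x) (gradient ψ x) (g x) = 0

/-- `q · a_*⁻¹(U) q`, that is, the supremum over the weak solutions `u` in `U` of
`⨍_U (-∇u · a∇u + 2 q · ∇u)`. The supremum is nonnegative (take `u = 0`), so that truncating each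
term at zero does not change it. -/
def dualQuadraticForm {d : ℕ} (a : EuclideanSpace ℝ (Fin d) → Matrix (Fin d) (Fin d) ℝ)
    (U : Set (EuclideanSpace ℝ (Fin d))) (q : EuclideanSpace ℝ (Fin d)) : ℝ≥0∞ :=
  ⨆ (u : EuclideanSpace ℝ (Fin d) → ℝ) (g : EuclideanSpace ℝ (Fin d) → EuclideanSpace ℝ (Fin d))
    (_ : IsSolution a U u g),
    ENNReal.ofReal (⨍ x in U, (-form (a x) (g x) (g x) + 2 * inner ℝ q (g x)))

/-- The spectral norm `|a_*⁻¹(U)|` of the symmetric nonnegative matrix `a_*⁻¹(U)`. -/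
def dualNorm {d : ℕ} (a : EuclideanSpace ℝ (Fin d) → Matrix (Fin d) (Fin d) ℝ)
    (U : Set (EuclideanSpace ℝ (Fin d))) : ℝ≥0∞ :=
  ⨆ (q : EuclideanSpace ℝ (Fin d)) (_ : ‖q‖ = 1), dualQuadraticForm a U q

/-- The coarse-grained lower ellipticity constant `λ_s(□_m) ∈ [0, ∞]`; the scales `k ≤ m` are
written as `k = m - i` with `i ∈ ℕ`. -/
def lowerEllipticity {d : ℕ} (a : EuclideanSpace ℝ (Fin d) → Matrix (Fin d) (Fin d) ℝ)
    (s : ℝ) (m : ℤ) : ℝ≥0∞ :=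
  (ENNReal.ofReal (1 - (3 : ℝ) ^ (-s)) *
    ∑' i : ℕ, ENNReal.ofReal ((3 : ℝ) ^ (-s * (i : ℝ))) *
      ⨆ (j : Fin d → ℤ) (_ : latticePoint (m - (i : ℤ)) j ∈ cube (0 : EuclideanSpace ℝ (Fin d)) m),
        dualNorm a (cube (latticePoint (m - (i : ℤ)) j) (m - (i : ℤ))) ^ (1 / 2 : ℝ)) ^ (-2 : ℝ)

/-- The volume-normalized norm `‖f‖_{L^p(U)} = (⨍_U |f|^p)^{1/p}`, for `0 < p < ∞`. -/
def avgLpNorm {d : ℕ} (p : ℝ) (U : Set (EuclideanSpace ℝ (Fin d)))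
    (f : EuclideanSpace ℝ (Fin d) → ℝ) : ℝ≥0∞ :=
  ((volume U)⁻¹ * ∫⁻ x in U, ‖f x‖ₑ ^ p) ^ (1 / p)

/-- The volume-normalized norm `‖a^{1/2} g‖_{L²(U)} = (⨍_U g · a g)^{1/2}`. -/
def avgEnergyNorm {d : ℕ} (a : EuclideanSpace ℝ (Fin d) → Matrix (Fin d) (Fin d) ℝ)
    (U : Set (EuclideanSpace ℝ (Fin d)))
    (g : EuclideanSpace ℝ (Fin d) → EuclideanSpace ℝ (Fin d)) : ℝ≥0∞ :=
  ((volume U)⁻¹ * energy a U g) ^ (1 / 2 : ℝ)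

/-- The Sobolev exponent `2*_s = 2d / (d - 2(1 - s))`. -/
def sobolevExponent (d : ℕ) (s : ℝ) : ℝ := 2 * (d : ℝ) / ((d : ℝ) - 2 * (1 - s))

end CoarseGrained

end

/-! For smooth `φ`, the averages over the triadic subcubes of `□_n`, indexed by a tree of addresses,
form a martingale. The core is a Sobolev inequality of Besov type, `avgLpNorm_sub_average_le_tsum`:
the norm of `φ - (φ)` in `L^p`, `p = 2*_s`, is bounded by the sum over depths `i` of `3^(-si)` times
the root mean square of the averages of `∇φ` over the cubes of depth `i`. Such averages are exactly
what the dual matrix controls.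

Discrete part. Integration by parts on two adjacent cubes expresses the difference of the averages
of `φ` through the averages and centred first moments of `∂_k φ` (`setAverage_cube_sub_adjacent`). A
first moment splits into first moments and averages over the children; iterating leaves only
averages of `∇φ` on finer cubes and a remainder that vanishes for smooth `φ`. Sort the terms by the
depth `j` of the gradient averages. The contribution of depth `j` to `φ - (φ)` is a sum of
martingale differences built from conditional expectations, so orthogonality bounds its `L²` norm by
`C 3^(n-j)` times the root mean square of the gradient averages, without losing a factor `j`. It is
constant on cubes of depth `j`, so passing from `L²` to `L^p` costs `3^(dj(1/2-1/p)) = 3^((1-s)j)`.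
With the prefactor `3^(-n)` the weight is `3^(-sj)`, and the triangle inequality in `j` suffices
because `λ_s` is itself defined by an `ℓ¹` sum over scales (`IsMultiscale.treeLp_sub_le`).

Energy part. On one cube `|⨍∇φ|² ≤ |a_*⁻¹| ⨍∇φ·a∇φ` (`ofReal_norm_average_gradient_sq_le`):
replacing a multiple of `φ` by the weak solution with the same boundary values keeps the mean
gradient and does not raise the energy (`exists_isSolution`), and this solution is tested in the
variational definition. Averaging over the cubes of depth `i` and summing over `i` gives `λ_s^(-1/2)
/ (1 - 3^(-s))`, and `1 - 3^(-s) ≥ s/2` yields the factor `s⁻¹`.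

Since `a` and `a⁻¹` are only integrable, the energy controls gradients only in `L¹`. Completeness
therefore goes through `L¹` limits and Fatou's lemma, and minimizing sequences are truncated to
recover `L²` convergence. Fatou's lemma also extends the inequality to `H¹_a`; when `λ_s = 0` what
remains is that zero energy forces `u` to be constant. -/

open scoped BigOperators

noncomputable section

namespace CoarseGrained

/-! ### Averages over the nodes of a homogeneous tree -/

section Tree

variable {E : Type*} [Fintype E]

/-- The average of `F` over the descendants at depth `i` of a node. Nodes are lists, the most recent
child being the head. -/
def treeAvg : ℕ → (List E → ℝ) → List E → ℝ
  | 0, F, l => F l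
  | i + 1, F, l => 𝔼 e, treeAvg i F (e :: l)

@[simp] lemma treeAvg_zero (F : List E → ℝ) (l : List E) : treeAvg 0 F l = F l := rfl

lemma treeAvg_succ (i : ℕ) (F : List E → ℝ) (l : List E) :
    treeAvg (i + 1) F l = 𝔼 e, treeAvg i F (e :: l) := rfl

/-- `treeAvg_succ` branches at the top of the tree; here the last generation is averaged first,
which is the form in which martingale identities apply. -/
lemma treeAvg_succ' (i : ℕ) (F : List E → ℝ) (l : List E) :
    treeAvg (i + 1) F l = treeAvg i (fun l => 𝔼 e, F (e :: l)) l := by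
  induction i generalizing l with
  | zero => rfl
  | succ i ih =>
    rw [treeAvg_succ, treeAvg_succ]
    exact Finset.expect_congr rfl fun e _ => ih _

lemma treeAvg_mono {i : ℕ} {F G : List E → ℝ} {l : List E}
    (h : ∀ l' : List E, l'.length = l.length + i → F l' ≤ G l') : treeAvg i F l ≤ treeAvg i G l := by
  induction i generalizing l with
  | zero => exact h l (by simp)
  | succ i ih =>
    rw [treeAvg_succ, treeAvg_succ]
    refine Finset.expect_le_expect fun e _ => ih fun l' hl' => h l' ?_
    simp only [List.length_cons] at hl'
    omega

lemma treeAvg_congr {i : ℕ} {F G : List E → ℝ} {l : List E}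
    (h : ∀ l' : List E, l'.length = l.length + i → F l' = G l') : treeAvg i F l = treeAvg i G l :=
  le_antisymm (treeAvg_mono fun l' hl' => (h l' hl').le) (treeAvg_mono fun l' hl' => (h l' hl').ge)

lemma treeAvg_add (i : ℕ) (F G : List E → ℝ) (l : List E) :
    treeAvg i (fun l => F l + G l) l = treeAvg i F l + treeAvg i G l := by
  induction i generalizing l with
  | zero => rfl
  | succ i ih =>
    simp only [treeAvg_succ, ← Finset.expect_add_distrib]
    exact Finset.expect_congr rfl fun e _ => ih _

lemma treeAvg_const_mul (i : ℕ) (c : ℝ) (F : List E → ℝ) (l : List E) :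
    treeAvg i (fun l => c * F l) l = c * treeAvg i F l := by
  induction i generalizing l with
  | zero => rfl
  | succ i ih =>
    simp only [treeAvg_succ, Finset.mul_expect]
    exact Finset.expect_congr rfl fun e _ => ih _

lemma treeAvg_const [Nonempty E] (i : ℕ) (c : ℝ) (l : List E) : treeAvg i (fun _ => c) l = c := by
  induction i generalizing l with
  | zero => rfl
  | succ i ih => simp only [treeAvg_succ, ih, Fintype.expect_const]

lemma treeAvg_sum {ι : Type*} (s : Finset ι) (i : ℕ) (F : ι → List E → ℝ) (l : List E) :
    treeAvg i (fun l => ∑ k ∈ s, F k l) l = ∑ k ∈ s, treeAvg i (F k) l := by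
  induction i generalizing l with
  | zero => rfl
  | succ i ih =>
    simp only [treeAvg_succ, ← Finset.expect_sum_comm]
    exact Finset.expect_congr rfl fun e _ => ih _

lemma treeAvg_treeAvg (i j : ℕ) (F : List E → ℝ) (l : List E) :
    treeAvg i (treeAvg j F) l = treeAvg (j + i) F l := by
  induction i generalizing l with
  | zero => rfl
  | succ i ih =>
    rw [treeAvg_succ, ← add_assoc, treeAvg_succ]
    exact Finset.expect_congr rfl fun e _ => ih _

lemma treeAvg_nonneg {i : ℕ} {F : List E → ℝ} {l : List E} (h : ∀ l, 0 ≤ F l) :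
    0 ≤ treeAvg i F l := by
  induction i generalizing l with
  | zero => exact h l
  | succ i ih => exact Finset.expect_nonneg fun e _ => ih

lemma expect_sub_sq [Nonempty E] (f : E → ℝ) (m : ℝ) :
    𝔼 e, (f e - m) ^ 2 = 𝔼 e, f e ^ 2 - 2 * m * 𝔼 e, f e + m ^ 2 := by
  have : ∀ e, (f e - m) ^ 2 = f e ^ 2 - 2 * m * f e + m ^ 2 := fun e => by ring
  simp only [this, Finset.expect_add_distrib, Finset.expect_sub_distrib, Finset.mul_expect,
    Fintype.expect_const]

lemma sq_expect_le [Nonempty E] (f : E → ℝ) : (𝔼 e, f e) ^ 2 ≤ 𝔼 e, f e ^ 2 := by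
  have h := expect_sub_sq f (𝔼 e, f e)
  have h' : 0 ≤ 𝔼 e, (f e - 𝔼 e, f e) ^ 2 := Finset.expect_nonneg fun e _ => sq_nonneg _
  nlinarith

lemma sq_treeAvg_le [Nonempty E] (i : ℕ) (F : List E → ℝ) (l : List E) :
    (treeAvg i F l) ^ 2 ≤ treeAvg i (fun l => F l ^ 2) l := by
  induction i generalizing l with
  | zero => exact le_rfl
  | succ i ih =>
    rw [treeAvg_succ, treeAvg_succ]
    exact (sq_expect_le _).trans (Finset.expect_le_expect fun e _ => ih _)

/-- A nonnegative function is bounded at a node by the number of nodes times its average. -/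
lemma le_card_pow_mul_treeAvg [Nonempty E] {F : List E → ℝ} (hF : ∀ l, 0 ≤ F l) (i : ℕ)
    (l' l : List E) (hl' : l'.length = i) :
    F (l' ++ l) ≤ (Fintype.card E : ℝ) ^ i * treeAvg i F l := by
  have key : ∀ (f : E → ℝ) (_ : ∀ e, 0 ≤ f e) (e : E), f e ≤ Fintype.card E * 𝔼 e, f e := by
    intro f hf e
    rw [Fintype.expect_eq_sum_div_card, mul_div_cancel₀ _ (by positivity)]
    exact Finset.single_le_sum (fun e _ => hf e) (Finset.mem_univ e)
  induction i generalizing l' F with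
  | zero =>
    have : l' = [] := List.length_eq_zero_iff.mp hl'
    simp [this]
  | succ i ih =>
    obtain ⟨e, t, rfl⟩ : ∃ e t, l' = e :: t := by
      cases l' with
      | nil => simp at hl'
      | cons e t => exact ⟨e, t, rfl⟩
    have ht : t.length = i := by simpa using hl'
    have h1 := key (fun e => F (e :: (t ++ l))) (fun e => hF _) e
    have h2 := ih (F := fun l => 𝔼 e, F (e :: l)) (fun l => Finset.expect_nonneg fun e _ => hF _) t ht
    rw [treeAvg_succ', pow_succ']
    calc F (e :: t ++ l) ≤ Fintype.card E * 𝔼 e, F (e :: (t ++ l)) := h1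
      _ ≤ Fintype.card E * ((Fintype.card E : ℝ) ^ i * treeAvg i (fun l => 𝔼 e, F (e :: l)) l) :=
          mul_le_mul_of_nonneg_left h2 (by positivity)
      _ = _ := by ring

/-- The sum of `D` over the nonempty suffixes of a node, that is, over its ancestors. -/
def accumulate (D : List E → ℝ) : List E → ℝ
  | [] => 0
  | e :: l => accumulate D l + D (e :: l)

lemma accumulate_finset_sum {β ι : Type*} (s : Finset ι) (D : ι → List β → ℝ) (l : List β) :
    accumulate (fun l => ∑ k ∈ s, D k l) l = ∑ k ∈ s, accumulate (D k) l := by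
  induction l with
  | nil => simp [accumulate]
  | cons e l ih => simp [accumulate, ih, Finset.sum_add_distrib]

lemma accumulate_add {β : Type*} (D D' : List β → ℝ) (l : List β) :
    accumulate (fun l => D l + D' l) l = accumulate D l + accumulate D' l := by
  induction l with
  | nil => simp [accumulate]
  | cons e l ih => simp only [accumulate, ih]; ring

lemma accumulate_congr {β : Type*} {D D' : List β → ℝ} {l : List β}
    (h : ∀ l' : List β, l'.length ≤ l.length → D l' = D' l') : accumulate D l = accumulate D' l := by
  induction l with
  | nil => rfl
  | cons e l ih =>
    simp only [accumulate, h (e :: l) le_rfl]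
    rw [ih fun l' hl' => h l' (hl'.trans (by simp))]

/-- Orthogonality of martingale differences. -/
lemma treeAvg_accumulate_sq [Nonempty E] {D : List E → ℝ} (hD : ∀ l, 𝔼 e, D (e :: l) = 0) (N : ℕ) :
    treeAvg N (fun l => accumulate D l ^ 2) [] =
      ∑ i ∈ Finset.range N, treeAvg i (fun l => 𝔼 e, D (e :: l) ^ 2) [] := by
  induction N with
  | zero => simp [accumulate]
  | succ N ih =>
    rw [treeAvg_succ', Finset.sum_range_succ, ← ih, ← treeAvg_add]
    refine treeAvg_congr fun l _ => ?_
    -- Among the children of `l` the value `accumulate D l` is a constant, so the cross term carries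
    -- the factor `𝔼 e, D (e :: l) = 0`.
    have := expect_sub_sq (fun e => D (e :: l)) (-accumulate D l)
    simp only [hD, sub_neg_eq_add] at this
    simp only [accumulate, add_comm (accumulate D l)]
    rw [this]
    ring

/-- The differences of a martingale are bounded in square average by its final value. -/
lemma sum_treeAvg_sub_sq_le [Nonempty E] {X : List E → ℝ} {m : ℕ}
    (hX : ∀ l : List E, l.length < m → X l = 𝔼 e, X (e :: l)) :
    ∑ i ∈ Finset.range m, treeAvg i (fun l => 𝔼 e, (X (e :: l) - X l) ^ 2) [] ≤
      treeAvg m (fun l => X l ^ 2) [] := by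
  induction m with
  | zero => simpa using sq_nonneg _
  | succ m ih =>
    rw [treeAvg_succ', Finset.sum_range_succ]
    refine (add_le_add_left (ih fun l hl => hX l (by omega)) _).trans_eq ?_
    rw [← treeAvg_add]
    refine treeAvg_congr fun l hl => ?_
    -- Pythagoras at a node: the mean square over the children is the square of the parent plus the
    -- variance.
    rw [expect_sub_sq, ← hX l (by simp at hl; omega)]
    ring

/-- The normalized `ℓ^p` norm over the descendants at depth `i` of a node. -/
def treeLp (p : ℝ) (i : ℕ) (F : List E → ℝ) (l : List E) : ℝ :=
  (treeAvg i (fun l => |F l| ^ p) l) ^ (1 / p)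

lemma treeLp_nonneg (p : ℝ) (i : ℕ) (F : List E → ℝ) (l : List E) : 0 ≤ treeLp p i F l :=
  Real.rpow_nonneg (treeAvg_nonneg fun _ => by positivity) _

lemma treeLp_rpow {p : ℝ} (hp : 0 < p) (i : ℕ) (F : List E → ℝ) (l : List E) :
    treeLp p i F l ^ p = treeAvg i (fun l => |F l| ^ p) l := by
  rw [treeLp, ← Real.rpow_mul (treeAvg_nonneg fun _ => by positivity), one_div,
    inv_mul_cancel₀ hp.ne', Real.rpow_one]

/-- Minkowski by induction on the depth: the norm at depth `i + 1` is, up to normalization, the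
finite `ℓ^p` norm over the children of their norms at depth `i`. -/
lemma treeLp_add_le [Nonempty E] {p : ℝ} (hp : 1 ≤ p) (i : ℕ) (F G : List E → ℝ) (l : List E) :
    treeLp p i (fun l => F l + G l) l ≤ treeLp p i F l + treeLp p i G l := by
  have hp0 : 0 < p := by linarith
  induction i generalizing l with
  | zero =>
    have h : ∀ x : ℝ, (|x| ^ p) ^ (1 / p) = |x| := fun x => by
      rw [← Real.rpow_mul (abs_nonneg _), mul_one_div_cancel hp0.ne', Real.rpow_one]
    simp only [treeLp, treeAvg_zero, h]
    exact abs_add_le _ _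
  | succ i ih =>
    have hs : ∀ H : List E → ℝ, treeLp p (i + 1) H l =
        ((Fintype.card E : ℝ)⁻¹) ^ (1 / p) * (∑ e, treeLp p i H (e :: l) ^ p) ^ (1 / p) := by
      intro H
      rw [← Real.mul_rpow (by positivity)
        (Finset.sum_nonneg fun e _ => Real.rpow_nonneg (treeLp_nonneg _ _ _ _) _)]
      simp only [treeLp_rpow hp0]
      rw [treeLp, treeAvg_succ, Fintype.expect_eq_sum_div_card, div_eq_inv_mul]
    rw [hs, hs, hs, ← mul_add]
    refine mul_le_mul_of_nonneg_left ?_ (by positivity)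
    refine le_trans ?_ (Real.Lp_add_le_of_nonneg Finset.univ hp (fun e _ => treeLp_nonneg _ _ _ _)
      (fun e _ => treeLp_nonneg _ _ _ _))
    refine Real.rpow_le_rpow (Finset.sum_nonneg fun e _ => Real.rpow_nonneg (treeLp_nonneg _ _ _ _) _)
      (Finset.sum_le_sum fun e _ => ?_) (by positivity)
    exact Real.rpow_le_rpow (treeLp_nonneg _ _ _ _) (ih _) hp0.le

lemma treeLp_zero_fun [Nonempty E] {p : ℝ} (hp : 0 < p) (i : ℕ) (l : List E) :
    treeLp p i (fun _ => 0) l = 0 := by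
  simp [treeLp, treeAvg_const, Real.zero_rpow hp.ne', hp.ne']

lemma treeLp_sum_le [Nonempty E] {ι : Type*} {p : ℝ} (hp : 1 ≤ p) (s : Finset ι) (i : ℕ)
    (F : ι → List E → ℝ) (l : List E) :
    treeLp p i (fun l => ∑ k ∈ s, F k l) l ≤ ∑ k ∈ s, treeLp p i (F k) l := by
  classical
  induction s using Finset.induction_on with
  | empty => simp [treeLp_zero_fun (by linarith : 0 < p)]
  | insert a s ha ih =>
    simp only [Finset.sum_insert ha]
    exact (treeLp_add_le hp i _ _ l).trans (by gcongr)

/-- Inverse inequality between normalized `ℓ^p` and `ℓ²` norms at a given level. -/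
lemma treeLp_le_treeAvg_sq [Nonempty E] {p : ℝ} (hp : 2 ≤ p) (i : ℕ) (F : List E → ℝ) :
    treeLp p i F [] ≤ ((Fintype.card E : ℝ) ^ i) ^ (1 / 2 - 1 / p) *
      (treeAvg i (fun l => F l ^ 2) []) ^ (1 / 2 : ℝ) := by
  have hp0 : 0 < p := by linarith
  set S := treeAvg i (fun l => F l ^ 2) [] with hS
  set K := (Fintype.card E : ℝ) ^ i with hK
  have hS0 : 0 ≤ S := treeAvg_nonneg fun l => sq_nonneg _
  have hK0 : 0 ≤ K := by positivity
  -- Write `|F|^p = |F|^(p-2) F²`. A node has weight `1/K` in the average, so `F² ≤ K S` there, and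
  -- this bounds the first factor.
  have hpt : ∀ l : List E, l.length = ([] : List E).length + i →
      |F l| ^ p ≤ (K * S) ^ ((p - 2) / 2) * F l ^ 2 := by
    intro l hl
    have h1 : F l ^ 2 ≤ K * S := by
      have := le_card_pow_mul_treeAvg (F := fun l => F l ^ 2) (fun l => sq_nonneg _) i l []
        (by simpa using hl)
      simpa using this
    have h2 : |F l| ^ p = (F l ^ 2) ^ ((p - 2) / 2) * F l ^ 2 := by
      rcases eq_or_ne (F l) 0 with h0 | h0
      · simp [h0, Real.zero_rpow hp0.ne']
      · have : 0 < |F l| := abs_pos.mpr h0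
        rw [← sq_abs, ← Real.rpow_natCast, ← Real.rpow_mul this.le, ← Real.rpow_add this]
        congr 1
        push_cast
        ring
    rw [h2]
    refine mul_le_mul_of_nonneg_right ?_ (sq_nonneg _)
    exact Real.rpow_le_rpow (sq_nonneg _) h1 (by linarith)
  have h3 := treeAvg_mono hpt
  rw [treeAvg_const_mul, ← hS] at h3
  have h4 : (K * S) ^ ((p - 2) / 2) * S ≤ (K ^ (1 / 2 - 1 / p) * S ^ (1 / 2 : ℝ)) ^ p := by
    rw [Real.mul_rpow hK0 hS0, Real.mul_rpow (by positivity) (by positivity), ← Real.rpow_mul hK0,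
      ← Real.rpow_mul hS0]
    have e1 : (1 / 2 - 1 / p) * p = (p - 2) / 2 := by field_simp
    rw [e1, mul_assoc]
    refine mul_le_mul_of_nonneg_left ?_ (by positivity)
    rcases hS0.eq_or_lt with h0 | h0
    · rw [← h0, mul_zero]; positivity
    · rw [← Real.rpow_add_one h0.ne']
      apply le_of_eq; congr 1; ring
  have h5 : treeLp p i F [] ≤ ((K ^ (1 / 2 - 1 / p) * S ^ (1 / 2 : ℝ)) ^ p) ^ (1 / p) :=
    Real.rpow_le_rpow (treeAvg_nonneg fun _ => by positivity) (h3.trans h4) (by positivity)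
  rwa [← Real.rpow_mul (by positivity), mul_one_div_cancel hp0.ne', Real.rpow_one] at h5

/-- A function that is constant beyond level `j` has the same averages at all finer levels. -/
lemma treeAvg_eq_of_const [Nonempty E] {F : List E → ℝ} {j N : ℕ} (hjN : j ≤ N)
    (hF : ∀ (e : E) (l : List E), j ≤ l.length → F (e :: l) = F l) :
    treeAvg N F [] = treeAvg j F [] := by
  induction N, hjN using Nat.le_induction with
  | base => rfl
  | succ N hN ih =>
    rw [treeAvg_succ', ← ih]
    refine treeAvg_congr fun l hl => ?_
    simp only [List.length_nil, zero_add] at hl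
    simp only [hF _ l (by omega), Fintype.expect_const]

end Tree

/-! ### Splitting one coordinate at a time -/

section Split

variable {d : ℕ}

/-- Replace the first `k` coordinates of `e` by those of `e'`. -/
def mix (k : ℕ) (e e' : Fin d → Fin 3) : Fin d → Fin 3 := fun i => if (i : ℕ) < k then e' i else e i

/-- Exchanging the first `k` coordinates of `e` and `e'` is an involution of the pairs, so a mixture
of two independent uniform addresses is again uniform. -/
lemma expect_expect_mix (k : ℕ) (h : (Fin d → Fin 3) → ℝ) :
    𝔼 e, 𝔼 e', h (mix k e e') = 𝔼 e, h e := by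
  have hinv : Function.Involutive
      (fun x : (Fin d → Fin 3) × (Fin d → Fin 3) => (mix k x.1 x.2, mix k x.2 x.1)) := by
    rintro ⟨e, e'⟩
    ext i <;> simp only [mix] <;> split_ifs <;> rfl
  have h1 := Fintype.expect_equiv (hinv.toPerm) (fun x => h (mix k x.1 x.2)) (fun x => h x.1)
    (fun x => rfl)
  rw [← Finset.univ_product_univ, Finset.expect_product, Finset.expect_product] at h1
  simpa [Fintype.expect_const] using h1

/-- The sum over the coordinates `k` of the increments of `X k` due to averaging out the coordinate
`k` of the head, the coordinates before `k` having been averaged out. -/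
def coordIncrement (X : Fin d → List (Fin d → Fin 3) → ℝ) : List (Fin d → Fin 3) → ℝ
  | [] => 0
  | e :: l => ∑ k, 𝔼 e', (X k (mix k e e' :: l) - X k (mix (k + 1) e e' :: l))

/-- When `X k` does not depend on `k` the sum telescopes from `mix 0 e e' = e` to `mix d e e' = e'`.
-/
lemma coordIncrement_same (φ : List (Fin d → Fin 3) → ℝ) (e : Fin d → Fin 3)
    (l : List (Fin d → Fin 3)) :
    coordIncrement (fun _ => φ) (e :: l) = φ (e :: l) - 𝔼 e', φ (e' :: l) := by
  have h0 : ∀ e', mix 0 e e' = e := fun e' => by ext i; simp [mix]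
  have h1 : ∀ e', mix d e e' = e' := fun e' => by ext i; simp [mix]
  simp only [coordIncrement]
  rw [← Finset.expect_sum_comm]
  have : ∀ e', ∑ k : Fin d, (φ (mix k e e' :: l) - φ (mix (k + 1) e e' :: l)) =
      φ (e :: l) - φ (e' :: l) := by
    intro e'
    rw [Fin.sum_univ_eq_sum_range (fun k => φ (mix k e e' :: l) - φ (mix (k + 1) e e' :: l)) d,
      Finset.sum_range_sub', h0, h1]
  simp only [this, Finset.expect_sub_distrib, Fintype.expect_const]

lemma coordIncrement_congr {X Y : Fin d → List (Fin d → Fin 3) → ℝ} {l : List (Fin d → Fin 3)}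
    (h : ∀ k (l' : List (Fin d → Fin 3)), l'.length = l.length → X k l' = Y k l') :
    coordIncrement X l = coordIncrement Y l := by
  cases l with
  | nil => rfl
  | cons e l =>
    refine Finset.sum_congr rfl fun k _ => Finset.expect_congr rfl fun e' _ => ?_
    rw [h k _ (by simp), h k _ (by simp)]

lemma coordIncrement_sum {ι : Type*} (s : Finset ι) (X : ι → Fin d → List (Fin d → Fin 3) → ℝ)
    (l : List (Fin d → Fin 3)) :
    coordIncrement (fun k l => ∑ j ∈ s, X j k l) l = ∑ j ∈ s, coordIncrement (X j) l := by
  cases l with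
  | nil => simp [coordIncrement]
  | cons e l =>
    simp only [coordIncrement]
    rw [Finset.sum_comm]
    refine Finset.sum_congr rfl fun k _ => ?_
    rw [← Finset.expect_sum_comm]
    simp only [Finset.sum_sub_distrib]

lemma coordIncrement_add (X Y : Fin d → List (Fin d → Fin 3) → ℝ) (l : List (Fin d → Fin 3)) :
    coordIncrement (fun k l => X k l + Y k l) l = coordIncrement X l + coordIncrement Y l := by
  cases l with
  | nil => simp [coordIncrement]
  | cons e l =>
    simp only [coordIncrement]
    rw [← Finset.sum_add_distrib]
    refine Finset.sum_congr rfl fun k _ => ?_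
    rw [← Finset.expect_add_distrib]
    exact Finset.expect_congr rfl fun _ _ => by ring

/-- Both mixtures are uniformly distributed, so the terms cancel in pairs: these are martingale
differences even if no `X k` is a martingale. -/
lemma expect_coordIncrement (X : Fin d → List (Fin d → Fin 3) → ℝ) (l : List (Fin d → Fin 3)) :
    𝔼 e, coordIncrement X (e :: l) = 0 := by
  simp only [coordIncrement]
  rw [Finset.expect_sum_comm]
  refine Finset.sum_eq_zero fun k _ => ?_
  simp only [Finset.expect_sub_distrib]
  rw [expect_expect_mix k fun e => X k (e :: l), expect_expect_mix (k + 1) fun e => X k (e :: l),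
    sub_self]

/-- Cauchy–Schwarz over the coordinates gives `d`; the square of a difference is at most twice each
of two squares with the same mean, which gives `4`. The free constants `c k` allow centring at the
value of the parent. -/
lemma expect_coordIncrement_sq_le (X : Fin d → List (Fin d → Fin 3) → ℝ)
    (l : List (Fin d → Fin 3)) (c : Fin d → ℝ) :
    𝔼 e, coordIncrement X (e :: l) ^ 2 ≤ 4 * d * ∑ k, 𝔼 e, (X k (e :: l) - c k) ^ 2 := by
  have h1 : ∀ e, coordIncrement X (e :: l) ^ 2 ≤ d * ∑ k : Fin d,
      𝔼 e', (2 * (X k (mix k e e' :: l) - c k) ^ 2 + 2 * (X k (mix (k + 1) e e' :: l) - c k) ^ 2) := by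
    intro e
    simp only [coordIncrement]
    refine (sq_sum_le_card_mul_sum_sq).trans ?_
    rw [Finset.card_univ, Fintype.card_fin]
    refine mul_le_mul_of_nonneg_left (Finset.sum_le_sum fun k _ => ?_) (by positivity)
    refine (sq_expect_le _).trans (Finset.expect_le_expect fun e' _ => ?_)
    nlinarith [sq_nonneg ((X k (mix k e e' :: l) - c k) + (X k (mix (k + 1) e e' :: l) - c k))]
  refine (Finset.expect_le_expect fun e _ => h1 e).trans_eq ?_
  rw [← Finset.mul_expect, Finset.expect_sum_comm, mul_comm 4 (d : ℝ), mul_assoc,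
    Finset.mul_sum _ _ (4 : ℝ)]
  congr 1
  refine Finset.sum_congr rfl fun k _ => ?_
  simp only [Finset.expect_add_distrib, ← Finset.mul_expect]
  rw [expect_expect_mix k fun e => (X k (e :: l) - c k) ^ 2,
    expect_expect_mix (k + 1) fun e => (X k (e :: l) - c k) ^ 2]
  ring

/-- If `φ - ξ k` does not depend on the coordinate `k` of the head, the increments of `φ` are those
of `ξ`. -/
lemma coordIncrement_eq_of_sub_update {φ : List (Fin d → Fin 3) → ℝ}
    {ξ : Fin d → List (Fin d → Fin 3) → ℝ} {l : List (Fin d → Fin 3)}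
    (h : ∀ k e (c : Fin 3), φ (Function.update e k c :: l) - ξ k (Function.update e k c :: l) =
      φ (e :: l) - ξ k (e :: l)) (e : Fin d → Fin 3) :
    φ (e :: l) - 𝔼 e', φ (e' :: l) = coordIncrement ξ (e :: l) := by
  rw [← coordIncrement_same]
  simp only [coordIncrement]
  refine Finset.sum_congr rfl fun k _ => Finset.expect_congr rfl fun e' _ => ?_
  -- The two mixtures differ only in the coordinate `k`, under whose change `φ - ξ k` is invariant.
  have hm : mix (k + 1) e e' = Function.update (mix k e e') k (e' k) := by
    ext i
    by_cases hi : i = k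
    · subst hi; simp [mix]
    · have : (i : ℕ) ≠ k := fun h => hi (Fin.ext h)
      simp only [mix, Function.update_of_ne hi]
      congr 2
      simp only [eq_iff_iff]
      omega
  have := h k (mix k e e') (e' k)
  rw [← hm] at this
  linarith

lemma expect_sum_update (h : (Fin d → Fin 3) → ℝ) (k : Fin d) :
    𝔼 e, ∑ c, h (Function.update e k c) = 3 * 𝔼 e, h e := by
  have hinv : Function.Involutive
      (fun x : (Fin d → Fin 3) × Fin 3 => (Function.update x.1 k x.2, x.1 k)) := by
    rintro ⟨e, c⟩
    simp
  have h1 := Fintype.expect_equiv (hinv.toPerm) (fun x => h (Function.update x.1 k x.2))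
    (fun x => h x.1) (fun x => rfl)
  rw [← Finset.univ_product_univ, Finset.expect_product, Finset.expect_product] at h1
  simp only [Fintype.expect_const] at h1
  rw [← h1, Finset.mul_expect]
  refine Finset.expect_congr rfl fun e _ => ?_
  rw [Fintype.expect_eq_sum_div_card, Fintype.card_fin]
  push_cast
  ring

end Split

/-! ### The multiscale inequality on the tree -/

section Multiscale

variable {d : ℕ}

/-- The function `V` up to level `q`, followed by `γ` on level `q + 1`. -/
def levelSplice (q : ℕ) (V γ : Fin d → List (Fin d → Fin 3) → ℝ) (k : Fin d)
    (l : List (Fin d → Fin 3)) : ℝ :=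
  if l.length ≤ q then V k l else if l.length = q + 1 then γ k l else 0

/-- A square function estimate. Up to level `q` the increments are centred at the parent, and the
squared differences of the martingale `V k` sum to at most its final mean square, so no factor `q`
appears. The last level is bounded directly by `γ`. -/
lemma treeAvg_accumulate_levelSplice_sq_le {q : ℕ} {V : Fin d → List (Fin d → Fin 3) → ℝ}
    (γ : Fin d → List (Fin d → Fin 3) → ℝ)
    (hV : ∀ k (l : List (Fin d → Fin 3)), l.length < q → V k l = 𝔼 e, V k (e :: l)) :
    treeAvg (q + 1) (fun l => accumulate (coordIncrement (levelSplice q V γ)) l ^ 2) [] ≤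
      4 * d * ∑ k, (treeAvg q (fun l => V k l ^ 2) [] + treeAvg (q + 1) (fun l => γ k l ^ 2) []) := by
  rw [treeAvg_accumulate_sq (expect_coordIncrement _), Finset.sum_range_succ,
    Finset.sum_add_distrib, mul_add]
  refine add_le_add ?_ ?_
  · have h1 : ∀ i ∈ Finset.range q,
        treeAvg i (fun l => 𝔼 e, coordIncrement (levelSplice q V γ) (e :: l) ^ 2) [] ≤
          4 * d * ∑ k, treeAvg i (fun l => 𝔼 e, (V k (e :: l) - V k l) ^ 2) [] := by
      intro i hi
      rw [← treeAvg_sum, ← treeAvg_const_mul]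
      refine treeAvg_mono fun l hl => ?_
      refine (expect_coordIncrement_sq_le _ _ fun k => V k l).trans_eq ?_
      have : ∀ e k, levelSplice q V γ k (e :: l) = V k (e :: l) := fun e k => by
        rw [levelSplice, if_pos]
        simp only [List.length_cons, hl, List.length_nil, Finset.mem_range] at hi ⊢
        omega
      simp only [this]
    refine (Finset.sum_le_sum h1).trans ?_
    rw [← Finset.mul_sum, Finset.sum_comm]
    refine mul_le_mul_of_nonneg_left (Finset.sum_le_sum fun k _ => ?_) (by positivity)
    exact sum_treeAvg_sub_sq_le (hV k)
  · rw [← treeAvg_sum, ← treeAvg_const_mul, treeAvg_succ']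
    refine treeAvg_mono fun l hl => ?_
    refine (expect_coordIncrement_sq_le _ _ fun k => 0).trans_eq ?_
    have : ∀ e k, levelSplice q V γ k (e :: l) = γ k (e :: l) := fun e k => by
      simp only [List.length_nil, zero_add] at hl
      rw [levelSplice, if_neg (by simp [hl]), if_pos (by simp [hl])]
    simp only [this, sub_zero]
    rw [← Finset.mul_expect, Finset.expect_sum_comm]

lemma accumulate_levelSplice_cons (q : ℕ) (V γ : Fin d → List (Fin d → Fin 3) → ℝ)
    (e : Fin d → Fin 3) (l : List (Fin d → Fin 3)) (hl : q + 1 ≤ l.length) :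
    accumulate (coordIncrement (levelSplice q V γ)) (e :: l) =
      accumulate (coordIncrement (levelSplice q V γ)) l := by
  have : ∀ k e', levelSplice q V γ k (e' :: l) = 0 := fun k e' => by
    rw [levelSplice, if_neg (by simp only [List.length_cons]; omega),
      if_neg (by simp only [List.length_cons]; omega)]
  simp [accumulate, coordIncrement, this]

/-- The accumulated sum does not change beyond level `q + 1`, so the inverse inequality is applied
at that level and its cost does not depend on `J`. -/
lemma treeLp_accumulate_levelSplice_le {p : ℝ} (hp : 2 ≤ p) {q J : ℕ} (hq : q + 1 ≤ J)
    {V : Fin d → List (Fin d → Fin 3) → ℝ} (γ : Fin d → List (Fin d → Fin 3) → ℝ)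
    (hV : ∀ k (l : List (Fin d → Fin 3)), l.length < q → V k l = 𝔼 e, V k (e :: l)) :
    treeLp p J (accumulate (coordIncrement (levelSplice q V γ))) [] ≤
      (((3 : ℝ) ^ d) ^ (q + 1)) ^ (1 / 2 - 1 / p) *
        √(4 * d * ∑ k, (treeAvg q (fun l => V k l ^ 2) [] + treeAvg (q + 1) (fun l => γ k l ^ 2) [])) := by
  have h1 : treeLp p J (accumulate (coordIncrement (levelSplice q V γ))) [] =
      treeLp p (q + 1) (accumulate (coordIncrement (levelSplice q V γ))) [] := by
    unfold treeLp
    congr 1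
    refine treeAvg_eq_of_const hq fun e l hl => ?_
    simp only [accumulate_levelSplice_cons q V γ e l hl]
  rw [h1]
  refine (treeLp_le_treeAvg_sq hp _ _).trans ?_
  rw [Real.sqrt_eq_rpow]
  simp only [Fintype.card_pi, Fintype.card_fin, Finset.prod_const, Finset.card_univ, Nat.cast_pow,
    Nat.cast_ofNat]
  refine mul_le_mul_of_nonneg_left ?_ (by positivity)
  exact Real.rpow_le_rpow (treeAvg_nonneg fun _ => sq_nonneg _)
    (treeAvg_accumulate_levelSplice_sq_le γ hV) (by norm_num)

/-- Twice the integral from the first node of the trapezoidal interpolation of three values. -/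
def trapezoid (f : Fin 3 → ℝ) : Fin 3 → ℝ := ![0, f 0 + f 1, f 0 + 2 * f 1 + f 2]

lemma trapezoid_sq_le (f : Fin 3 → ℝ) (c : Fin 3) : trapezoid f c ^ 2 ≤ 12 * ∑ c, f c ^ 2 := by
  rw [Fin.sum_univ_three]
  fin_cases c
  · simp [trapezoid]; positivity
  · simp [trapezoid]
    nlinarith [sq_nonneg (f 0 - f 1), sq_nonneg (f 2), sq_nonneg (f 0), sq_nonneg (f 1)]
  · simp [trapezoid]
    nlinarith [sq_nonneg (f 0 - f 1), sq_nonneg (f 1 - f 2), sq_nonneg (f 0 - f 2),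
      sq_nonneg (f 2), sq_nonneg (f 0), sq_nonneg (f 1)]

/-- The averages `φ` of a function over triadic cubes, the averages `g k` of its partial derivatives,
and their first moments `η k`, where `r i` is the side length of the cubes of level `i`. -/
structure IsMultiscale (r : ℕ → ℝ) (φ : List (Fin d → Fin 3) → ℝ)
    (g η : Fin d → List (Fin d → Fin 3) → ℝ) : Prop where
  avg : ∀ l, φ l = 𝔼 e, φ (e :: l)
  moment : ∀ k l, η k l = 𝔼 e, (η k (e :: l) + r (l.length + 1) * (((e k : ℕ) : ℝ) - 1) * g k (e :: l))
  adjacent : ∀ k e l (c c' : Fin 3), (c' : ℕ) = c + 1 →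
    φ (Function.update e k c' :: l) - φ (Function.update e k c :: l) =
      -(η k (Function.update e k c' :: l) - η k (Function.update e k c :: l)) +
        r (l.length + 1) / 2 *
          (g k (Function.update e k c' :: l) + g k (Function.update e k c :: l))

/-- The contribution of the cubes of the same level to the increments of `φ`. -/
def localPart (r : ℕ → ℝ) (g : Fin d → List (Fin d → Fin 3) → ℝ) (k : Fin d) :
    List (Fin d → Fin 3) → ℝ
  | [] => 0
  | e :: l => r (l.length + 1) / 2 * trapezoid (fun c => g k (Function.update e k c :: l)) (e k)

/-- The contribution of the cubes of a level to the moments at the previous level. -/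
def momentPart (r : ℕ → ℝ) (g : Fin d → List (Fin d → Fin 3) → ℝ) (k : Fin d) :
    List (Fin d → Fin 3) → ℝ
  | [] => 0
  | e :: l => r (l.length + 1) * (((e k : ℕ) : ℝ) - 1) * g k (e :: l)

/-- `9 = (12/4) · 3`: the constant of `trapezoid_sq_le` with the factor `(r/2)²`, then
`expect_sum_update` for the sum over the three values of one coordinate. -/
lemma treeAvg_localPart_sq_le (r : ℕ → ℝ) (g : Fin d → List (Fin d → Fin 3) → ℝ) (k : Fin d)
    (q : ℕ) : treeAvg (q + 1) (fun l => localPart r g k l ^ 2) [] ≤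
      9 * r (q + 1) ^ 2 * treeAvg (q + 1) (fun l => g k l ^ 2) [] := by
  rw [treeAvg_succ', treeAvg_succ', ← treeAvg_const_mul]
  refine treeAvg_mono fun l hl => ?_
  have hl' : l.length = q := by simpa using hl
  have h1 : ∀ e, localPart r g k (e :: l) ^ 2 ≤
      3 * r (q + 1) ^ 2 * ∑ c, g k (Function.update e k c :: l) ^ 2 := by
    intro e
    rw [localPart, hl', mul_pow]
    nlinarith [trapezoid_sq_le (fun c => g k (Function.update e k c :: l)) (e k),
      sq_nonneg (r (q + 1))]
  refine (Finset.expect_le_expect fun e _ => h1 e).trans_eq ?_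
  rw [← Finset.mul_expect, expect_sum_update (fun e => g k (e :: l) ^ 2)]
  ring

lemma treeAvg_momentPart_sq_le (r : ℕ → ℝ) (g : Fin d → List (Fin d → Fin 3) → ℝ) (k : Fin d)
    (q : ℕ) : treeAvg (q + 1) (fun l => momentPart r g k l ^ 2) [] ≤
      r (q + 1) ^ 2 * treeAvg (q + 1) (fun l => g k l ^ 2) [] := by
  rw [← treeAvg_const_mul]
  refine treeAvg_mono fun l hl => ?_
  cases l with
  | nil => simp at hl
  | cons e l =>
    have hl' : l.length = q := by simpa using hl
    have h1 : (((e k : ℕ) : ℝ) - 1) ^ 2 ≤ 1 := by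
      have : e k = 0 ∨ e k = 1 ∨ e k = 2 := by
        generalize e k = c
        fin_cases c <;> simp
      rcases this with h | h | h <;> rw [h] <;> norm_num
    rw [momentPart, hl', mul_pow, mul_pow]
    refine mul_le_mul_of_nonneg_right ?_ (sq_nonneg _)
    nlinarith [sq_nonneg (r (q + 1))]

lemma treeAvg_sub_length_eq {J : ℕ} (F : List (Fin d → Fin 3) → ℝ) {l : List (Fin d → Fin 3)}
    (hl : l.length < J) :
    treeAvg (J - l.length) F l = 𝔼 e, treeAvg (J - (e :: l).length) F (e :: l) := by
  obtain ⟨m, hm⟩ : ∃ m, J - l.length = m + 1 := ⟨J - l.length - 1, by omega⟩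
  rw [hm, treeAvg_succ]
  refine Finset.expect_congr rfl fun e _ => ?_
  rw [List.length_cons, show J - (l.length + 1) = m by omega]

lemma treeAvg_sq_treeAvg_sub_length_le {m J : ℕ} (h : m ≤ J) (F : List (Fin d → Fin 3) → ℝ) :
    treeAvg m (fun l => treeAvg (J - l.length) F l ^ 2) [] ≤ treeAvg J (fun l => F l ^ 2) [] := by
  calc treeAvg m (fun l => treeAvg (J - l.length) F l ^ 2) []
      ≤ treeAvg m (treeAvg (J - m) (fun l => F l ^ 2)) [] := by
        refine treeAvg_mono fun l hl => ?_
        simp only [List.length_nil, zero_add] at hl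
        rw [hl]
        exact sq_treeAvg_le _ _ _
    _ = _ := by rw [treeAvg_treeAvg, Nat.sub_add_cancel h]

namespace IsMultiscale

variable {r : ℕ → ℝ} {φ : List (Fin d → Fin 3) → ℝ} {g η : Fin d → List (Fin d → Fin 3) → ℝ}

/-- By `adjacent`, a step in the coordinate `k` changes `φ + η k` exactly as it changes `localPart r
g k`. Hence `φ - (-η k + localPart r g k)` does not depend on that coordinate of the head, and
`coordIncrement_eq_of_sub_update` applies. -/
lemma sub_eq_accumulate (h : IsMultiscale r φ g η) (l : List (Fin d → Fin 3)) :
    φ l - φ [] = accumulate (coordIncrement fun k l => -η k l + localPart r g k l) l := by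
  induction l with
  | nil => simp [accumulate]
  | cons e l ih =>
    rw [accumulate, ← ih, ← coordIncrement_eq_of_sub_update (φ := φ), ← h.avg]
    · ring
    intro k e c
    have h01 := h.adjacent k e l 0 1 rfl
    have h12 := h.adjacent k e l 1 2 rfl
    set Φ : Fin 3 → ℝ := fun c => φ (Function.update e k c :: l) -
      (-η k (Function.update e k c :: l) + localPart r g k (Function.update e k c :: l)) with hΦ
    have hconst : ∀ c, Φ c = Φ 0 := by
      intro c
      simp only [hΦ, localPart, Function.update_idem, Function.update_self]
      fin_cases c
      · rfl
      · simp [trapezoid]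
        linarith
      · simp [trapezoid]
        linarith
    have he : φ (e :: l) - (-η k (e :: l) + localPart r g k (e :: l)) = Φ (e k) := by
      simp only [hΦ, Function.update_eq_self]
    rw [he, hconst (e k), ← hconst c]

/-- Iterating `moment` trades the moment of a cube for averages of `g k` on finer cubes, up to an
averaged moment `n` generations below. -/
lemma moment_eq_sum (h : IsMultiscale r φ g η) (k : Fin d) (l : List (Fin d → Fin 3)) (n : ℕ) :
    η k l = ∑ i ∈ Finset.range n, treeAvg (i + 1) (momentPart r g k) l + treeAvg n (η k) l := by
  induction n with
  | zero => simp
  | succ n ih =>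
    rw [ih, Finset.sum_range_succ, add_assoc, treeAvg_succ' n (momentPart r g k),
      treeAvg_succ' n (η k), ← treeAvg_add]
    congr 1
    refine treeAvg_congr fun l' _ => ?_
    rw [h.moment k l', Finset.expect_add_distrib, add_comm]
    rfl

/-- Sorts the terms by the level `q + 1` of the averages of `g`. At a node of length `m + 1`, the
indices `q < m` contribute nothing, `q = m` gives the local part, and `q > m` the conditional
expectation of the moment part of level `q + 1`. -/
lemma expand (h : IsMultiscale r φ g η) (J : ℕ) (k : Fin d) (l : List (Fin d → Fin 3))
    (hl0 : 0 < l.length) (hl : l.length ≤ J) :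
    -η k l + localPart r g k l =
      ∑ q ∈ Finset.range J, levelSplice q
        (fun k l => -treeAvg (q + 1 - l.length) (momentPart r g k) l) (localPart r g) k l +
      -treeAvg (J - l.length) (η k) l := by
  rw [h.moment_eq_sum k l (J - l.length)]
  obtain ⟨m, hm⟩ : ∃ m, l.length = m + 1 := ⟨l.length - 1, by omega⟩
  have hsum : ∑ q ∈ Finset.range J, levelSplice q
        (fun k l => -treeAvg (q + 1 - l.length) (momentPart r g k) l) (localPart r g) k l =
      localPart r g k l - ∑ i ∈ Finset.range (J - l.length), treeAvg (i + 1) (momentPart r g k) l := by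
    rw [← Finset.sum_range_add_sum_Ico _ (show m + 1 ≤ J by omega), Finset.sum_range_succ,
      Finset.sum_eq_zero, Finset.sum_Ico_eq_sum_range]
    · simp only [levelSplice, hm]
      rw [if_neg (by omega), if_pos trivial, zero_add, sub_eq_add_neg, ← Finset.sum_neg_distrib]
      congr 1
      refine Finset.sum_congr rfl fun i _ => ?_
      rw [if_pos (by omega), show m + 1 + i + 1 - (m + 1) = i + 1 by omega]
    · intro q hq
      rw [Finset.mem_range] at hq
      rw [levelSplice, if_neg (by omega), if_neg (by omega)]
  rw [hsum]
  ring

/-- The multiscale Sobolev inequality on the tree. -/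
theorem treeLp_sub_le (h : IsMultiscale r φ g η) (hr : ∀ i, 0 ≤ r i) {p : ℝ} (hp : 2 ≤ p) (Q : ℕ) :
    treeLp p (Q + 1) (fun l => φ l - φ []) [] ≤
      ∑ q ∈ Finset.range (Q + 1), (((3 : ℝ) ^ d) ^ (q + 1)) ^ (1 / 2 - 1 / p) *
        (√(40 * d) * r (q + 1) * √(∑ k, treeAvg (q + 1) (fun l => g k l ^ 2) [])) +
      (((3 : ℝ) ^ d) ^ (Q + 1)) ^ (1 / 2 - 1 / p) *
        (√(40 * d) * √(∑ k, treeAvg (Q + 1) (fun l => η k l ^ 2) [])) := by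
  set Z : ℕ → Fin d → List (Fin d → Fin 3) → ℝ := fun q => levelSplice q
    (fun k l => -treeAvg (q + 1 - l.length) (momentPart r g k) l) (localPart r g) with hZ
  set Y : Fin d → List (Fin d → Fin 3) → ℝ := fun k l => -treeAvg (Q + 1 - l.length) (η k) l with hY
  have hexp : treeLp p (Q + 1) (fun l => φ l - φ []) [] = treeLp p (Q + 1)
      (fun l => ∑ q ∈ Finset.range (Q + 1), accumulate (coordIncrement (Z q)) l +
        accumulate (coordIncrement (levelSplice Q Y Y)) l) [] := by
    unfold treeLp
    congr 1
    refine treeAvg_congr fun l hl => ?_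
    simp only [List.length_nil, zero_add] at hl
    simp only
    rw [h.sub_eq_accumulate, ← accumulate_finset_sum, ← accumulate_add]
    congr 2
    refine accumulate_congr fun l' hl' => ?_
    rw [← coordIncrement_sum, ← coordIncrement_add]
    cases l' with
    | nil => rfl
    | cons e l' =>
      refine coordIncrement_congr fun k l'' hl'' => ?_
      simp only [List.length_cons] at hl' hl''
      rw [h.expand (Q + 1) k l'' (by omega) (by omega)]
      congr 1
      rw [levelSplice]
      split_ifs with h1 h2
      · rfl
      · rfl
      · omega
  rw [hexp]
  refine (treeLp_add_le (by linarith) _ _ _ _).trans (add_le_add ?_ ?_)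
  · refine (treeLp_sum_le (by linarith) _ _ _ _).trans (Finset.sum_le_sum fun q hq => ?_)
    rw [Finset.mem_range] at hq
    refine (treeLp_accumulate_levelSplice_le hp (by omega) _ ?_).trans ?_
    · intro k l hl
      rw [treeAvg_sub_length_eq _ (by omega), ← Finset.expect_neg_distrib]
    · refine mul_le_mul_of_nonneg_left ?_ (by positivity)
      have hG : 0 ≤ ∑ k, treeAvg (q + 1) (fun l => g k l ^ 2) [] :=
        Finset.sum_nonneg fun k _ => treeAvg_nonneg fun _ => sq_nonneg _
      rw [← Real.sqrt_sq (hr (q + 1)), ← Real.sqrt_mul (by positivity),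
        ← Real.sqrt_mul (by positivity)]
      refine Real.sqrt_le_sqrt ?_
      -- `40 = 4 · (1 + 9)`, with `1` from the moment part and `9` from the local part.
      have : 40 * (d : ℝ) * r (q + 1) ^ 2 * ∑ k, treeAvg (q + 1) (fun l => g k l ^ 2) [] =
          4 * d * ∑ k, (r (q + 1) ^ 2 * treeAvg (q + 1) (fun l => g k l ^ 2) [] +
            9 * r (q + 1) ^ 2 * treeAvg (q + 1) (fun l => g k l ^ 2) []) := by
        rw [Finset.sum_add_distrib, ← Finset.mul_sum, ← Finset.mul_sum]
        ring
      rw [this]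
      refine mul_le_mul_of_nonneg_left (Finset.sum_le_sum fun k _ => add_le_add ?_ ?_) (by positivity)
      · simp only [neg_sq]
        exact (treeAvg_sq_treeAvg_sub_length_le (by omega) _).trans (treeAvg_momentPart_sq_le r g k q)
      · exact treeAvg_localPart_sq_le r g k q
  · refine (treeLp_accumulate_levelSplice_le hp le_rfl _ ?_).trans ?_
    · intro k l hl
      simp only [hY]
      rw [treeAvg_sub_length_eq _ (by omega), ← Finset.expect_neg_distrib]
    · refine mul_le_mul_of_nonneg_left ?_ (by positivity)
      rw [← Real.sqrt_mul (by positivity)]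
      refine Real.sqrt_le_sqrt ?_
      have hG : 0 ≤ ∑ k, treeAvg (Q + 1) (fun l => η k l ^ 2) [] :=
        Finset.sum_nonneg fun k _ => treeAvg_nonneg fun _ => sq_nonneg _
      calc _ ≤ 4 * d * ∑ k, (treeAvg (Q + 1) (fun l => η k l ^ 2) [] +
            treeAvg (Q + 1) (fun l => η k l ^ 2) []) := by
            refine mul_le_mul_of_nonneg_left (Finset.sum_le_sum fun k _ => add_le_add ?_ ?_)
              (by positivity)
            · simp only [hY, neg_sq]
              exact treeAvg_sq_treeAvg_sub_length_le (by omega) _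
            · simp only [hY, neg_sq]
              exact treeAvg_sq_treeAvg_sub_length_le le_rfl _
        -- Here `8 d` would do; `40 d` keeps one constant for both sums.
        _ ≤ _ := by
            rw [Finset.sum_add_distrib]
            have : (0 : ℝ) ≤ d := by positivity
            nlinarith [mul_nonneg this hG]

end IsMultiscale

end Multiscale

/-! ### Triadic cubes -/

section Cubes

variable {d : ℕ}

local notation "𝔾" => EuclideanSpace ℝ (Fin d)

lemma cube_eq_preimage (z : 𝔾) (m : ℤ) :
    cube z m = (MeasurableEquiv.toLp 2 (Fin d → ℝ)).symm ⁻¹'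
      (Set.univ.pi fun i => Set.Ioo (z i - (3 : ℝ) ^ m / 2) (z i + (3 : ℝ) ^ m / 2)) := by
  ext x
  simp only [cube, Set.mem_ofPred_eq, Set.mem_preimage, Set.mem_pi, Set.mem_univ, forall_const,
    Set.mem_Ioo, abs_lt]
  refine forall_congr' fun i => ?_
  have : (MeasurableEquiv.toLp 2 (Fin d → ℝ)).symm x i = x i := rfl
  rw [this]
  constructor
  · rintro ⟨h1, h2⟩; constructor <;> linarith
  · rintro ⟨h1, h2⟩; constructor <;> linarith

lemma isOpen_cube (z : 𝔾) (m : ℤ) : IsOpen (cube z m) := by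
  have : cube z m = ⋂ i, {x : 𝔾 | |x i - z i| < (3 : ℝ) ^ m / 2} := by
    ext x; simp [cube]
  rw [this]
  refine isOpen_iInter_of_finite fun i => ?_
  exact isOpen_lt (by fun_prop) continuous_const

lemma measurableSet_cube (z : 𝔾) (m : ℤ) : MeasurableSet (cube z m) := (isOpen_cube z m).measurableSet

lemma mem_cube_self (z : 𝔾) (m : ℤ) : z ∈ cube z m := fun i => by
  rw [sub_self, abs_zero]; positivity

lemma volume_cube (z : 𝔾) (m : ℤ) : volume (cube z m) = ENNReal.ofReal (((3 : ℝ) ^ m) ^ d) := by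
  rw [cube_eq_preimage, (EuclideanSpace.volume_preserving_symm_measurableEquiv_toLp
    (Fin d)).measure_preimage_equiv, Real.volume_pi_Ioo]
  have : ∀ i, z i + (3 : ℝ) ^ m / 2 - (z i - (3 : ℝ) ^ m / 2) = (3 : ℝ) ^ m := fun i => by ring
  simp only [this, Finset.prod_const, Finset.card_univ, Fintype.card_fin]
  rw [ENNReal.ofReal_pow (by positivity)]

lemma volume_cube_ne_zero (z : 𝔾) (m : ℤ) : volume (cube z m) ≠ 0 := by
  rw [volume_cube]
  exact (ENNReal.ofReal_pos.mpr (by positivity)).ne'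

lemma volume_cube_ne_top (z : 𝔾) (m : ℤ) : volume (cube z m) ≠ ⊤ := by
  rw [volume_cube]
  exact ENNReal.ofReal_ne_top

lemma measureReal_cube (z : 𝔾) (m : ℤ) : volume.real (cube z m) = ((3 : ℝ) ^ m) ^ d := by
  rw [Measure.real, volume_cube, ENNReal.toReal_ofReal (by positivity)]

lemma isBounded_cube (z : 𝔾) (m : ℤ) : Bornology.IsBounded (cube z m) := by
  have h := (Metric.isBounded_Icc (fun i => z i - (3 : ℝ) ^ m / 2) (fun i => z i + (3 : ℝ) ^ m / 2))
  have h2 := (PiLp.continuousLinearEquiv 2 ℝ (fun _ : Fin d => ℝ)).symm.lipschitz.isBounded_image h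
  refine h2.subset fun x hx => ⟨x.ofLp, ?_, rfl⟩
  constructor <;> intro i <;> have := abs_lt.mp (hx i) <;> simp only <;> linarith

lemma isCompact_closure_cube (z : 𝔾) (m : ℤ) : IsCompact (closure (cube z m)) :=
  (isBounded_cube z m).isCompact_closure

lemma integrableOn_cube {F : Type*} [NormedAddCommGroup F] {f : 𝔾 → F} (hf : Continuous f) (z : 𝔾)
    (m : ℤ) : IntegrableOn f (cube z m) :=
  ((hf.continuousOn).integrableOn_compact (isCompact_closure_cube z m)).mono_set subset_closure

/-- The displacement from the center of a cube of scale `m` to that of the subcube `e`. -/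
def childShift (m : ℤ) (e : Fin d → Fin 3) : 𝔾 :=
  WithLp.toLp 2 fun i => (3 : ℝ) ^ (m - 1) * (((e i : ℕ) : ℝ) - 1)

lemma childShift_apply (m : ℤ) (e : Fin d → Fin 3) (i : Fin d) :
    childShift m e i = (3 : ℝ) ^ (m - 1) * (((e i : ℕ) : ℝ) - 1) := rfl

lemma three_zpow_eq (m : ℤ) : (3 : ℝ) ^ m = 3 * (3 : ℝ) ^ (m - 1) := by
  rw [zpow_sub_one₀ (by norm_num)]; ring

lemma cube_child_subset (z : 𝔾) (m : ℤ) (e : Fin d → Fin 3) :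
    cube (z + childShift m e) (m - 1) ⊆ cube z m := by
  intro x hx i
  have h := abs_lt.mp (hx i)
  rw [PiLp.add_apply, childShift_apply] at h
  have hp : (0 : ℝ) < 3 ^ (m - 1) := by positivity
  have h3 := three_zpow_eq m
  have hc : ((e i : ℕ) : ℝ) = 0 ∨ ((e i : ℕ) : ℝ) = 1 ∨ ((e i : ℕ) : ℝ) = 2 := by
    generalize e i = c
    fin_cases c <;> simp
  rw [abs_lt, h3]
  rcases hc with hc | hc | hc <;> rw [hc] at h <;> constructor <;> nlinarith

lemma pairwise_disjoint_child (z : 𝔾) (m : ℤ) : Pairwise (Function.onFun Disjoint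
    fun e : Fin d → Fin 3 => cube (z + childShift m e) (m - 1)) := by
  intro e e' hne
  rw [Function.onFun, Set.disjoint_left]
  intro x hx hx'
  apply hne
  ext i
  have h := abs_lt.mp (hx i)
  have h' := abs_lt.mp (hx' i)
  rw [PiLp.add_apply, childShift_apply] at h h'
  have hp : (0 : ℝ) < 3 ^ (m - 1) := by positivity
  have h1 : ((e i : ℕ) : ℝ) < (e' i : ℕ) + 1 := by
    by_contra hc
    push Not at hc
    nlinarith
  have h2 : ((e' i : ℕ) : ℝ) < (e i : ℕ) + 1 := by
    by_contra hc
    push Not at hc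
    nlinarith
  norm_cast at h1 h2
  omega

/-- The open subcubes are disjoint and their volumes add up to that of the cube, so they miss only a
null set. -/
lemma restrict_cube_eq_sum (z : 𝔾) (m : ℤ) : volume.restrict (cube z m) =
    Measure.sum fun e : Fin d → Fin 3 => volume.restrict (cube (z + childShift m e) (m - 1)) := by
  rw [← Measure.restrict_iUnion (pairwise_disjoint_child z m) fun e => measurableSet_cube _ _]
  refine Measure.restrict_congr_set (ae_eq_of_subset_of_measure_ge
    (Set.iUnion_subset fun e => cube_child_subset z m e) ?_
    (MeasurableSet.iUnion fun e => measurableSet_cube _ _).nullMeasurableSet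
    (volume_cube_ne_top z m)).symm
  rw [measure_iUnion (pairwise_disjoint_child z m) fun e => measurableSet_cube _ _]
  simp only [volume_cube, tsum_fintype, Finset.sum_const, Finset.card_univ, Fintype.card_pi,
    Fintype.card_fin, Finset.prod_const, nsmul_eq_mul]
  rw [three_zpow_eq m, mul_pow, ENNReal.ofReal_mul (by positivity)]
  gcongr
  rw [ENNReal.ofReal_pow (by norm_num)]
  simp

lemma setAverage_cube_eq_expect {f : 𝔾 → ℝ} (z : 𝔾) (m : ℤ) (hf : IntegrableOn f (cube z m)) :
    ⨍ x in cube z m, f x = 𝔼 e, ⨍ x in cube (z + childShift m e) (m - 1), f x := by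
  simp only [setAverage_eq, measureReal_cube, smul_eq_mul]
  have h1 : ∫ x in cube z m, f x = ∑ e, ∫ x in cube (z + childShift m e) (m - 1), f x := by
    rw [restrict_cube_eq_sum, integral_sum_measure, tsum_fintype]
    rw [← restrict_cube_eq_sum]
    exact hf
  rw [h1, ← Finset.mul_expect, Fintype.expect_eq_sum_div_card, three_zpow_eq m, mul_pow]
  simp only [Fintype.card_pi, Fintype.card_fin, Finset.prod_const, Finset.card_univ, Nat.cast_pow,
    Nat.cast_ofNat]
  rw [mul_inv]
  ring

/-- The partial derivative `∂_k φ`. -/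
def partialDeriv (φ : 𝔾 → ℝ) (k : Fin d) (x : 𝔾) : ℝ := fderiv ℝ φ x (EuclideanSpace.single k 1)

lemma gradient_apply (φ : 𝔾 → ℝ) (k : Fin d) (x : 𝔾) : gradient φ x k = partialDeriv φ k x := by
  rw [partialDeriv, ← inner_gradient_left, EuclideanSpace.inner_single_right]
  simp

lemma continuous_partialDeriv {φ : 𝔾 → ℝ} (hφ : ContDiff ℝ ∞ φ) (k : Fin d) :
    Continuous (partialDeriv φ k) :=
  (hφ.continuous_fderiv (by simp)).clm_apply continuous_const

/-- The integral of `φ` over a face, orthogonal to the direction `k`, of a box in `ℝ^(N+1)`. -/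
def faceIntegral {N : ℕ} (φ : EuclideanSpace ℝ (Fin (N + 1)) → ℝ) (k : Fin (N + 1))
    (a b : Fin (N + 1) → ℝ) (t : ℝ) : ℝ :=
  ∫ y in Set.Icc (a ∘ k.succAbove) (b ∘ k.succAbove), φ (WithLp.toLp 2 (k.insertNth t y))

/-- The divergence theorem for the field `φ(x) (x_k - τ)` in the direction `k`, which has flux only
through the two faces orthogonal to `k`. Placing `τ` on one face removes its flux. -/
lemma setIntegral_cube_partialDeriv {N : ℕ} {φ : EuclideanSpace ℝ (Fin (N + 1)) → ℝ}
    (hφ : ContDiff ℝ ∞ φ) (k : Fin (N + 1)) (z : EuclideanSpace ℝ (Fin (N + 1))) (m : ℤ) (τ : ℝ) :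
    ∫ x in cube z m, (partialDeriv φ k x * (x k - τ) + φ x) =
      (z k + (3 : ℝ) ^ m / 2 - τ) * faceIntegral φ k (fun i => z i - (3 : ℝ) ^ m / 2)
          (fun i => z i + (3 : ℝ) ^ m / 2) (z k + (3 : ℝ) ^ m / 2) -
        (z k - (3 : ℝ) ^ m / 2 - τ) * faceIntegral φ k (fun i => z i - (3 : ℝ) ^ m / 2)
          (fun i => z i + (3 : ℝ) ^ m / 2) (z k - (3 : ℝ) ^ m / 2) := by
  set a : Fin (N + 1) → ℝ := fun i => z i - (3 : ℝ) ^ m / 2 with ha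
  set b : Fin (N + 1) → ℝ := fun i => z i + (3 : ℝ) ^ m / 2 with hb
  have hpos : (0 : ℝ) < 3 ^ m := by positivity
  have hab : a ≤ b := fun i => by simp only [ha, hb]; linarith
  let L : (Fin (N + 1) → ℝ) ≃L[ℝ] EuclideanSpace ℝ (Fin (N + 1)) :=
    (PiLp.continuousLinearEquiv 2 ℝ (fun _ : Fin (N + 1) => ℝ)).symm
  let f : Fin (N + 1) → (Fin (N + 1) → ℝ) → ℝ := fun i y => if i = k then φ (L y) * (y k - τ) else 0
  let f' : Fin (N + 1) → (Fin (N + 1) → ℝ) → (Fin (N + 1) → ℝ) →L[ℝ] ℝ := fun i y =>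
    if i = k then φ (L y) • ContinuousLinearMap.proj k +
      (y k - τ) • (fderiv ℝ φ (L y)).comp (L : (Fin (N + 1) → ℝ) →L[ℝ] _) else 0
  have hcφ : Continuous φ := hφ.continuous
  have hLc : Continuous L := L.continuous
  have hsum : ∀ y, ∑ i, f' i y (Pi.single i 1) =
      partialDeriv φ k (L y) * ((L y) k - τ) + φ (L y) := by
    intro y
    rw [Finset.sum_eq_single k]
    · have hL1 : L (Pi.single k 1) = EuclideanSpace.single k 1 := rfl
      have hL2 : (L y) k = y k := rfl
      simp [f', partialDeriv, hL1, hL2]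
      ring
    · intro i _ hi; simp [f', hi]
    · simp
  have hcont : Continuous fun y => partialDeriv φ k (L y) * ((L y) k - τ) + φ (L y) := by
    have := (continuous_partialDeriv hφ k).comp hLc
    have h2 : Continuous fun y => (L y) k := by
      have hL2 : ∀ y, (L y) k = y k := fun _ => rfl
      simp only [hL2]; fun_prop
    exact (this.mul (h2.sub continuous_const)).add (hcφ.comp hLc)
  have hdiv := integral_divergence_of_hasFDerivAt_off_countable' a b hab f f' ∅ Set.countable_empty
    (by
      intro i
      by_cases hi : i = k
      · simp only [f, hi, if_true]
        exact ((hcφ.comp hLc).mul (by fun_prop)).continuousOn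
      · simp only [f, hi, if_false]
        exact continuousOn_const)
    (by
      intro y _ i
      by_cases hi : i = k
      · simp only [f, f', hi, if_true]
        have h1 : HasFDerivAt (fun y => φ (L y))
            ((fderiv ℝ φ (L y)).comp (L : (Fin (N + 1) → ℝ) →L[ℝ] _)) y :=
          ((hφ.differentiable (by simp)) (L y)).hasFDerivAt.comp y L.hasFDerivAt
        have h2 : HasFDerivAt (fun y : Fin (N + 1) → ℝ => y k - τ)
            (ContinuousLinearMap.proj k : (Fin (N + 1) → ℝ) →L[ℝ] ℝ) y :=
          (hasFDerivAt_apply k y).sub_const τ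
        exact h1.mul h2
      · simp only [f, f', hi, if_false]
        exact hasFDerivAt_const _ _)
    (by
      simp only [hsum]
      exact hcont.continuousOn.integrableOn_compact isCompact_Icc)
  simp only [hsum] at hdiv
  rw [Finset.sum_eq_single k (fun i _ hi => by simp [f, hi]) (by simp)] at hdiv
  have hlhs : ∫ x in cube z m, (partialDeriv φ k x * (x k - τ) + φ x) =
      ∫ y in Set.Icc a b, (partialDeriv φ k (L y) * ((L y) k - τ) + φ (L y)) := by
    have hIcc : (Set.univ.pi fun i => Set.Ioo (a i) (b i)) =ᵐ[volume] Set.Icc a b :=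
      Measure.univ_pi_Ioo_ae_eq_Icc
    rw [cube_eq_preimage, ← setIntegral_congr_set hIcc]
    rw [← (EuclideanSpace.volume_preserving_symm_measurableEquiv_toLp
      (Fin (N + 1))).setIntegral_preimage_emb (MeasurableEquiv.measurableEmbedding _)]
    rfl
  rw [hlhs, hdiv]
  simp only [f, if_true, Fin.insertNth_apply_same]
  rw [integral_mul_const, integral_mul_const, mul_comm, mul_comm (∫ _ in _, _)]
  rfl

/-- With `τ` on the outer face of each cube, both instances of the divergence theorem keep only the
common face, with the same factor `3^m`. Subtracting them eliminates the trace of `φ`. -/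
lemma setAverage_cube_sub_adjacent {φ : 𝔾 → ℝ} (hφ : ContDiff ℝ ∞ φ) (k : Fin d) (z : 𝔾) (m : ℤ) :
    (⨍ x in cube (z + EuclideanSpace.single k ((3 : ℝ) ^ m)) m, φ x) - ⨍ x in cube z m, φ x =
      -((⨍ x in cube (z + EuclideanSpace.single k ((3 : ℝ) ^ m)) m, partialDeriv φ k x *
            (x k - (z + EuclideanSpace.single k ((3 : ℝ) ^ m)) k)) -
          ⨍ x in cube z m, partialDeriv φ k x * (x k - z k)) +
        (3 : ℝ) ^ m / 2 *
          ((⨍ x in cube (z + EuclideanSpace.single k ((3 : ℝ) ^ m)) m, partialDeriv φ k x) +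
            ⨍ x in cube z m, partialDeriv φ k x) := by
  obtain _ | N := d
  · exact k.elim0
  set z' := z + EuclideanSpace.single k ((3 : ℝ) ^ m) with hz'
  have hz'k : z' k = z k + (3 : ℝ) ^ m := by simp [hz']
  have hz'i : ∀ i : Fin N, z' (k.succAbove i) = z (k.succAbove i) := fun i => by
    simp [hz', Fin.succAbove_ne]
  have e1 := setIntegral_cube_partialDeriv hφ k z m (z k - (3 : ℝ) ^ m / 2)
  have e2 := setIntegral_cube_partialDeriv hφ k z' m (z' k + (3 : ℝ) ^ m / 2)
  have hface : faceIntegral φ k (fun i => z' i - (3 : ℝ) ^ m / 2) (fun i => z' i + (3 : ℝ) ^ m / 2)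
      (z' k - (3 : ℝ) ^ m / 2) = faceIntegral φ k (fun i => z i - (3 : ℝ) ^ m / 2)
      (fun i => z i + (3 : ℝ) ^ m / 2) (z k + (3 : ℝ) ^ m / 2) := by
    unfold faceIntegral
    have h1 : ((fun i => z' i - (3 : ℝ) ^ m / 2) ∘ k.succAbove) =
      ((fun i => z i - (3 : ℝ) ^ m / 2) ∘ k.succAbove) := by
      ext i; simp [hz'i]
    have h2 : ((fun i => z' i + (3 : ℝ) ^ m / 2) ∘ k.succAbove) =
      ((fun i => z i + (3 : ℝ) ^ m / 2) ∘ k.succAbove) := by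
      ext i; simp [hz'i]
    rw [h1, h2, hz'k, show z k + (3 : ℝ) ^ m - (3 : ℝ) ^ m / 2 = z k + (3 : ℝ) ^ m / 2 by ring]
  rw [hface] at e2
  have hc := continuous_partialDeriv hφ k
  have split : ∀ (w : EuclideanSpace ℝ (Fin (N + 1))) (c : ℝ),
      ∫ x in cube w m, (partialDeriv φ k x * (x k - (w k + c)) + φ x) =
        (∫ x in cube w m, partialDeriv φ k x * (x k - w k)) - c * (∫ x in cube w m, partialDeriv φ k x)
          + ∫ x in cube w m, φ x := by
    intro w c
    have i1 : IntegrableOn (fun x => partialDeriv φ k x * (x k - w k)) (cube w m) :=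
      integrableOn_cube (hc.mul (by fun_prop)) w m
    have i2 : IntegrableOn (fun x => c * partialDeriv φ k x) (cube w m) :=
      integrableOn_cube (continuous_const.mul hc) w m
    have i3 : IntegrableOn φ (cube w m) := integrableOn_cube hφ.continuous w m
    have i12 : IntegrableOn (fun x => partialDeriv φ k x * (x k - w k) - c * partialDeriv φ k x)
      (cube w m) := i1.sub i2
    rw [← integral_const_mul, ← integral_sub i1 i2, ← integral_add i12 i3]
    congr 1
    ext x
    ring
  rw [show z k - (3 : ℝ) ^ m / 2 = z k + -((3 : ℝ) ^ m / 2) by ring, split z] at e1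
  rw [split z'] at e2
  simp only [setAverage_eq, measureReal_cube, smul_eq_mul]
  have hV : (((3 : ℝ) ^ m) ^ (N + 1))⁻¹ ≠ 0 := by positivity
  have key := e2
  have : (∫ x in cube z' m, φ x) - ∫ x in cube z m, φ x =
      -((∫ x in cube z' m, partialDeriv φ k x * (x k - z' k)) -
          ∫ x in cube z m, partialDeriv φ k x * (x k - z k)) +
        (3 : ℝ) ^ m / 2 *
          ((∫ x in cube z' m, partialDeriv φ k x) + ∫ x in cube z m, partialDeriv φ k x) := by
    linear_combination e2 - e1
  linear_combination (((3 : ℝ) ^ m) ^ (N + 1))⁻¹ * this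

/-! ### The tree of triadic subcubes -/

/-- The center of the triadic subcube of `□_n` with address `l`. -/
def nodeCenter (n : ℤ) : List (Fin d → Fin 3) → 𝔾
  | [] => 0
  | e :: l => nodeCenter n l + childShift (n - l.length) e

/-- The triadic subcube of `□_n` with address `l`. -/
def nodeCube (n : ℤ) (l : List (Fin d → Fin 3)) : Set 𝔾 := cube (nodeCenter n l) (n - l.length)

lemma nodeCube_nil (n : ℤ) : nodeCube n [] = cube (0 : 𝔾) n := by simp [nodeCube, nodeCenter]

lemma nodeCube_cons (n : ℤ) (e : Fin d → Fin 3) (l : List (Fin d → Fin 3)) :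
    nodeCube n (e :: l) = cube (nodeCenter n l + childShift (n - l.length) e) (n - l.length - 1) := by
  rw [nodeCube, nodeCenter, List.length_cons]
  congr 1
  push_cast
  ring

lemma nodeCube_cons_subset (n : ℤ) (e : Fin d → Fin 3) (l : List (Fin d → Fin 3)) :
    nodeCube n (e :: l) ⊆ nodeCube n l := by
  rw [nodeCube_cons]
  exact cube_child_subset _ _ _

lemma nodeCube_subset (n : ℤ) (l : List (Fin d → Fin 3)) : nodeCube n l ⊆ cube (0 : 𝔾) n := by
  induction l with
  | nil => rw [nodeCube_nil]
  | cons e l ih => exact (nodeCube_cons_subset n e l).trans ih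

lemma setAverage_nodeCube_eq_expect {f : 𝔾 → ℝ} (n : ℤ) (l : List (Fin d → Fin 3))
    (hf : IntegrableOn f (cube 0 n)) :
    ⨍ x in nodeCube n l, f x = 𝔼 e, ⨍ x in nodeCube n (e :: l), f x := by
  simp only [nodeCube_cons]
  exact setAverage_cube_eq_expect _ _ (hf.mono_set (nodeCube_subset n l))

lemma treeAvg_setAverage {f : 𝔾 → ℝ} (n : ℤ) (hf : IntegrableOn f (cube 0 n)) (i : ℕ) :
    treeAvg i (fun l => ⨍ x in nodeCube n l, f x) [] = ⨍ x in cube 0 n, f x := by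
  induction i with
  | zero => rw [treeAvg_zero, nodeCube_nil]
  | succ i ih =>
    rw [treeAvg_succ', ← ih]
    exact treeAvg_congr fun l _ => (setAverage_nodeCube_eq_expect n l hf).symm

/-- `3^m j + 3^(m-1) (e - 1) = 3^(m-1) (3 j + e - 1)`. Thus the cubes of the tree are among those
over which `λ_s` takes its maxima. -/
lemma nodeCenter_eq_latticePoint (n : ℤ) (l : List (Fin d → Fin 3)) :
    ∃ j : Fin d → ℤ, nodeCenter n l = latticePoint (n - l.length) j := by
  induction l with
  | nil => exact ⟨0, by ext i; simp [nodeCenter, latticePoint]⟩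
  | cons e l ih =>
    obtain ⟨j, hj⟩ := ih
    refine ⟨fun i => 3 * j i + ((e i : ℕ) - 1), ?_⟩
    ext i
    have h3 := three_zpow_eq (n - l.length)
    rw [nodeCenter, hj, PiLp.add_apply, childShift_apply]
    simp only [latticePoint, List.length_cons]
    rw [show n - ((l.length + 1 : ℕ) : ℤ) = n - l.length - 1 by push_cast; ring, h3]
    push_cast
    ring

lemma isMultiscale_node {φ : 𝔾 → ℝ} (hφ : ContDiff ℝ ∞ φ) (n : ℤ) :
    IsMultiscale (d := d) (fun i => (3 : ℝ) ^ (n - (i : ℤ))) (fun l => ⨍ x in nodeCube n l, φ x)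
      (fun k l => ⨍ x in nodeCube n l, partialDeriv φ k x)
      (fun k l => ⨍ x in nodeCube n l, partialDeriv φ k x * (x k - nodeCenter n l k)) where
  avg l := setAverage_nodeCube_eq_expect n l (integrableOn_cube hφ.continuous _ _)
  moment k l := by
    have hc := continuous_partialDeriv hφ k
    rw [setAverage_nodeCube_eq_expect (f := fun x => partialDeriv φ k x * (x k - nodeCenter n l k)) n l
      (integrableOn_cube (hc.mul (by fun_prop)) _ _)]
    refine Finset.expect_congr rfl fun e _ => ?_
    have hpt : ∀ x : 𝔾, partialDeriv φ k x * (x k - nodeCenter n l k) =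
        partialDeriv φ k x * (x k - nodeCenter n (e :: l) k) +
          (3 : ℝ) ^ (n - l.length - 1) * (((e k : ℕ) : ℝ) - 1) * partialDeriv φ k x := by
      intro x
      rw [nodeCenter, PiLp.add_apply, childShift_apply]
      ring
    simp only [hpt, setAverage_eq, smul_eq_mul]
    rw [integral_add, integral_const_mul]
    · rw [show n - ((l.length + 1 : ℕ) : ℤ) = n - l.length - 1 by push_cast; ring]
      ring
    · exact integrableOn_cube (hc.mul (by fun_prop)) _ _
    · exact integrableOn_cube (continuous_const.mul hc) _ _
  adjacent k e l c c' hc := by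
    have hcen : nodeCenter n (Function.update e k c' :: l) =
        nodeCenter n (Function.update e k c :: l) +
          EuclideanSpace.single k ((3 : ℝ) ^ (n - l.length - 1)) := by
      ext i
      simp only [nodeCenter, PiLp.add_apply, childShift_apply]
      by_cases hi : i = k
      · subst hi
        simp [hc]
        ring
      · simp [hi]
    have h := setAverage_cube_sub_adjacent hφ k (nodeCenter n (Function.update e k c :: l))
      (n - l.length - 1)
    rw [← hcen] at h
    have hcube : ∀ c, nodeCube n (Function.update e k c :: l) =
        cube (nodeCenter n (Function.update e k c :: l)) (n - l.length - 1) := fun c => by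
      rw [nodeCube_cons, nodeCenter]
    simp only [hcube]
    rw [show n - ((l.length + 1 : ℕ) : ℤ) = n - l.length - 1 by push_cast; ring]
    exact h

end Cubes

/-! ### The multiscale Sobolev inequality for smooth functions -/

section Smooth

variable {d : ℕ}

local notation "𝔾" => EuclideanSpace ℝ (Fin d)

lemma convex_cube (z : 𝔾) (m : ℤ) : Convex ℝ (cube z m) := by
  rw [cube_eq_preimage]
  exact (convex_pi fun i _ => convex_Ioo _ _).linear_preimage
    (PiLp.continuousLinearEquiv 2 ℝ (fun _ : Fin d => ℝ)).toLinearMap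

lemma norm_sub_le_of_mem_cube {z x y : 𝔾} {m : ℤ} (hx : x ∈ cube z m) (hy : y ∈ cube z m) :
    ‖x - y‖ ≤ √d * (3 : ℝ) ^ m := by
  have hp : (0 : ℝ) < 3 ^ m := by positivity
  rw [EuclideanSpace.norm_eq, ← Real.sqrt_sq hp.le, ← Real.sqrt_mul (by positivity)]
  refine Real.sqrt_le_sqrt ?_
  have : ∀ i ∈ Finset.univ, ‖(x - y) i‖ ^ 2 ≤ ((3 : ℝ) ^ m) ^ 2 := by
    intro i _
    have h1 := abs_lt.mp (hx i)
    have h2 := abs_lt.mp (hy i)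
    rw [PiLp.sub_apply, Real.norm_eq_abs]
    refine pow_le_pow_left₀ (abs_nonneg _) (abs_le.mpr ⟨by linarith, by linarith⟩) 2
  refine (Finset.sum_le_sum this).trans_eq ?_
  simp

lemma exists_norm_fderiv_le_cube {φ : 𝔾 → ℝ} (hφ : ContDiff ℝ ∞ φ) (z : 𝔾) (m : ℤ) :
    ∃ K : ℝ, 0 ≤ K ∧ ∀ x ∈ cube z m, ‖fderiv ℝ φ x‖ ≤ K := by
  obtain ⟨K, hK⟩ := (isCompact_closure_cube z m).exists_bound_of_continuousOn
    (hφ.continuous_fderiv (by simp)).continuousOn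
  exact ⟨K, (norm_nonneg _).trans (hK z (subset_closure (mem_cube_self z m))),
    fun x hx => hK x (subset_closure hx)⟩

lemma abs_partialDeriv_le (φ : 𝔾 → ℝ) (k : Fin d) (x : 𝔾) : |partialDeriv φ k x| ≤ ‖fderiv ℝ φ x‖ := by
  rw [← Real.norm_eq_abs, partialDeriv]
  refine (ContinuousLinearMap.le_opNorm _ _).trans_eq ?_
  simp

lemma setAverage_mem_Icc {f : 𝔾 → ℝ} (z : 𝔾) (m : ℤ) {a b : ℝ} (hf : IntegrableOn f (cube z m))
    (h : ∀ x ∈ cube z m, f x ∈ Set.Icc a b) : ⨍ x in cube z m, f x ∈ Set.Icc a b :=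
  (convex_Icc a b).set_average_mem isClosed_Icc (volume_cube_ne_zero z m) (volume_cube_ne_top z m)
    ((ae_restrict_iff' (measurableSet_cube z m)).mpr (ae_of_all _ h)) hf

/-- The weight `x_k - z_k` is at most the side of the cube, so for smooth `φ` the moments left over
in the multiscale inequality vanish as the depth grows. -/
lemma treeAvg_moment_sq_le {φ : 𝔾 → ℝ} (hφ : ContDiff ℝ ∞ φ) (n : ℤ) {K : ℝ} (hK0 : 0 ≤ K)
    (hK : ∀ x ∈ cube (0 : 𝔾) n, ‖fderiv ℝ φ x‖ ≤ K) (k : Fin d) (J : ℕ) :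
    treeAvg J (fun l => (⨍ x in nodeCube n l, partialDeriv φ k x * (x k - nodeCenter n l k)) ^ 2) [] ≤
      (K * (3 : ℝ) ^ (n - (J : ℤ))) ^ 2 := by
  rw [← treeAvg_const (E := Fin d → Fin 3) J ((K * (3 : ℝ) ^ (n - (J : ℤ))) ^ 2) []]
  refine treeAvg_mono fun l hl => ?_
  simp only [List.length_nil, zero_add] at hl
  have hpos : (0 : ℝ) < 3 ^ (n - (J : ℤ)) := by positivity
  have h := setAverage_mem_Icc (f := fun x => partialDeriv φ k x * (x k - nodeCenter n l k))
    (nodeCenter n l) (n - l.length) (a := -(K * (3 : ℝ) ^ (n - (J : ℤ))))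
    (b := K * (3 : ℝ) ^ (n - (J : ℤ)))
    (integrableOn_cube ((continuous_partialDeriv hφ k).mul (by fun_prop)) _ _) (by
      intro x hx
      rw [Set.mem_Icc, ← abs_le, abs_mul]
      have hx' := hx k
      rw [hl] at hx'
      refine mul_le_mul ((abs_partialDeriv_le φ k x).trans (hK x (nodeCube_subset n l hx))) ?_
        (abs_nonneg _) hK0
      linarith)
  exact sq_le_sq' h.1 h.2

/-- Replacing `φ` by its averages at depth `J` costs at most its oscillation on a cube, the
Lipschitz bound times the diameter. -/
lemma setAverage_rpow_le_treeLp {φ : 𝔾 → ℝ} (hφ : ContDiff ℝ ∞ φ) (n : ℤ) {K : ℝ} (hK0 : 0 ≤ K)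
    (hK : ∀ x ∈ cube (0 : 𝔾) n, ‖fderiv ℝ φ x‖ ≤ K) {p : ℝ} (hp : 1 ≤ p) (c : ℝ) (J : ℕ) :
    (⨍ x in cube (0 : 𝔾) n, |φ x - c| ^ p) ^ (1 / p) ≤
      treeLp p J (fun l => (⨍ x in nodeCube n l, φ x) - c) [] +
        K * (√d * (3 : ℝ) ^ (n - (J : ℤ))) := by
  have hp0 : 0 < p := by linarith
  have hcont : Continuous fun x : 𝔾 => |φ x - c| ^ p :=
    ((hφ.continuous.sub continuous_const).abs).rpow_const fun _ => Or.inr hp0.le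
  set ε := K * (√d * (3 : ℝ) ^ (n - (J : ℤ))) with hε
  have hε0 : 0 ≤ ε := by positivity
  have hpt : ∀ l : List (Fin d → Fin 3), l.length = ([] : List (Fin d → Fin 3)).length + J →
      ⨍ x in nodeCube n l, |φ x - c| ^ p ≤ |(|(⨍ x in nodeCube n l, φ x) - c| + ε)| ^ p := by
    intro l hl
    simp only [List.length_nil, zero_add] at hl
    have hosc : ∀ x ∈ nodeCube n l, |φ x - ⨍ x in nodeCube n l, φ x| ≤ ε := by
      intro x hx
      have h := setAverage_mem_Icc (f := φ) (nodeCenter n l) (n - l.length) (a := φ x - ε)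
        (b := φ x + ε) (integrableOn_cube hφ.continuous _ _) (by
          intro y hy
          have h1 := (convex_cube (nodeCenter n l) (n - l.length)).norm_image_sub_le_of_norm_fderiv_le
            (f := φ) (𝕜 := ℝ) (C := K) (fun w _ => hφ.differentiable (by simp) w)
            (fun w hw => hK w (nodeCube_subset n l hw)) hx hy
          have h2 := norm_sub_le_of_mem_cube hy hx
          rw [hl] at h2
          have h3 : |φ y - φ x| ≤ ε := h1.trans (mul_le_mul_of_nonneg_left h2 hK0)
          rw [abs_le] at h3
          constructor <;> linarith)
      have h' := h
      simp only [Set.mem_Icc] at h'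
      rw [abs_le]
      constructor
      · have := h'.2; simp only [nodeCube]; linarith
      · have := h'.1; simp only [nodeCube]; linarith
    have hb := setAverage_mem_Icc (f := fun x => |φ x - c| ^ p) (nodeCenter n l) (n - l.length)
      (a := 0) (b := |(|(⨍ x in nodeCube n l, φ x) - c| + ε)| ^ p) (integrableOn_cube hcont _ _) (by
        intro x hx
        refine ⟨by positivity, Real.rpow_le_rpow (abs_nonneg _) ?_ hp0.le⟩
        rw [abs_of_nonneg (a := |_| + ε) (add_nonneg (abs_nonneg _) hε0)]
        have := abs_add_le (φ x - ⨍ x in nodeCube n l, φ x) ((⨍ x in nodeCube n l, φ x) - c)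
        rw [sub_add_sub_cancel] at this
        linarith [hosc x hx])
    exact hb.2
  have h1 := treeAvg_mono hpt
  rw [treeAvg_setAverage n (integrableOn_cube hcont _ _)] at h1
  have h2 : (⨍ x in cube (0 : 𝔾) n, |φ x - c| ^ p) ^ (1 / p) ≤
      treeLp p J (fun l => |(⨍ x in nodeCube n l, φ x) - c| + ε) [] := by
    refine Real.rpow_le_rpow ?_ h1 (by positivity)
    rw [setAverage_eq, smul_eq_mul]
    exact mul_nonneg (by positivity) (integral_nonneg fun x => by positivity)
  refine h2.trans ((treeLp_add_le hp _ _ _ _).trans_eq ?_)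
  congr 1
  · simp only [treeLp, abs_abs]
  · rw [treeLp, treeAvg_const, abs_of_nonneg hε0, ← Real.rpow_mul hε0, mul_one_div_cancel hp0.ne',
      Real.rpow_one]

lemma two_le_sobolevExponent (hd : 2 ≤ d) {s : ℝ} (hs : 0 < s) (hs1 : s ≤ 1) :
    2 ≤ sobolevExponent d s := by
  have hd' : (2 : ℝ) ≤ d := by exact_mod_cast hd
  rw [sobolevExponent, le_div_iff₀ (by nlinarith)]
  nlinarith

lemma dim_mul_half_sub_inv_sobolevExponent (hd : 2 ≤ d) {s : ℝ} (hs : 0 < s) :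
    d * (1 / 2 - 1 / sobolevExponent d s) = 1 - s := by
  have hd' : (2 : ℝ) ≤ d := by exact_mod_cast hd
  have : (d : ℝ) - 2 * (1 - s) ≠ 0 := by nlinarith
  rw [sobolevExponent]
  field_simp
  ring

lemma avgLpNorm_cube_eq {f : 𝔾 → ℝ} (hf : Continuous f) (z : 𝔾) (m : ℤ) {p : ℝ} (hp : 0 < p) :
    avgLpNorm p (cube z m) f = ENNReal.ofReal ((⨍ x in cube z m, |f x| ^ p) ^ (1 / p)) := by
  have hcont : Continuous fun x : 𝔾 => |f x| ^ p := hf.abs.rpow_const fun _ => Or.inr hp.le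
  have h0 : 0 ≤ ∫ x in cube z m, |f x| ^ p := integral_nonneg fun x => by positivity
  rw [setAverage_eq, smul_eq_mul, ← ENNReal.ofReal_rpow_of_nonneg (by positivity) (by positivity),
    ENNReal.ofReal_mul (by positivity), ofReal_integral_eq_lintegral_ofReal
      (integrableOn_cube hcont z m) (ae_of_all _ fun x => by positivity), avgLpNorm]
  congr 2
  · rw [measureReal_cube, volume_cube, ENNReal.ofReal_inv_of_pos (by positivity)]
  · refine lintegral_congr fun x => ?_
    rw [← ofReal_norm, Real.norm_eq_abs, ENNReal.ofReal_rpow_of_nonneg (abs_nonneg _) hp.le]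

/-- The square average over the triadic subcubes of `□_n` of level `i` of the averages of `∇φ`. -/
def gradientAvgSq (n : ℤ) (φ : 𝔾 → ℝ) (i : ℕ) : ℝ :=
  ∑ k, treeAvg i (fun l => (⨍ x in nodeCube n l, partialDeriv φ k x) ^ 2) []

/-- At depth `j` the inverse inequality costs `3^((1-s)j)` and the side contributes `3^(n-j)`; with
`3^(-n)` this leaves `3^(-sj)`. The bound `K` on the derivative enters only the decaying remainder.
-/
lemma setAverage_rpow_le_sum (hd : 2 ≤ d) {s : ℝ} (hs : 0 < s) (hs1 : s ≤ 1) {φ : 𝔾 → ℝ}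
    (hφ : ContDiff ℝ ∞ φ) (n : ℤ) {K : ℝ} (hK0 : 0 ≤ K)
    (hK : ∀ x ∈ cube (0 : 𝔾) n, ‖fderiv ℝ φ x‖ ≤ K) (Q : ℕ) :
    (3 : ℝ) ^ (-n) * (⨍ x in cube (0 : 𝔾) n, |φ x - ⨍ y in cube (0 : 𝔾) n, φ y| ^
        sobolevExponent d s) ^ (1 / sobolevExponent d s) ≤
      √(40 * d) * ∑ q ∈ Finset.range (Q + 1),
        (3 : ℝ) ^ (-s * ((q + 1 : ℕ) : ℝ)) * √(gradientAvgSq n φ (q + 1)) +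
      (√(40 * d) * √d * K + K * √d) * (3 : ℝ) ^ (-s * ((Q + 1 : ℕ) : ℝ)) := by
  set p := sobolevExponent d s with hp
  have hp2 : 2 ≤ p := two_le_sobolevExponent hd hs hs1
  have hn : (0 : ℝ) < 3 ^ (-n) := by positivity
  have hpow : ∀ j : ℕ, (((3 : ℝ) ^ d) ^ j) ^ (1 / 2 - 1 / p) = (3 : ℝ) ^ ((1 - s) * (j : ℝ)) := by
    intro j
    rw [← dim_mul_half_sub_inv_sobolevExponent hd hs, ← pow_mul, ← Real.rpow_natCast,
      ← Real.rpow_mul (by norm_num)]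
    congr 1
    push_cast
    ring
  have hscale : ∀ j : ℕ, (3 : ℝ) ^ (-n) * ((3 : ℝ) ^ ((1 - s) * (j : ℝ)) * (3 : ℝ) ^ (n - (j : ℤ))) =
      (3 : ℝ) ^ (-s * (j : ℝ)) := by
    intro j
    rw [← Real.rpow_intCast, ← Real.rpow_intCast, ← Real.rpow_add (by norm_num),
      ← Real.rpow_add (by norm_num)]
    congr 1
    push_cast
    ring
  have h1 := setAverage_rpow_le_treeLp hφ n hK0 hK (p := p) (by linarith)
    (⨍ y in cube (0 : 𝔾) n, φ y) (Q + 1)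
  have h2 := (isMultiscale_node hφ n).treeLp_sub_le (fun i => by positivity) hp2 Q
  simp only [nodeCube_nil] at h2
  have h3 : √(∑ k, treeAvg (Q + 1) (fun l => (⨍ x in nodeCube n l, partialDeriv φ k x *
      (x k - nodeCenter n l k)) ^ 2) []) ≤ √d * (K * (3 : ℝ) ^ (n - ((Q + 1 : ℕ) : ℤ))) := by
    rw [← Real.sqrt_sq (show 0 ≤ K * (3 : ℝ) ^ (n - ((Q + 1 : ℕ) : ℤ)) by positivity),
      ← Real.sqrt_mul (by positivity)]
    refine Real.sqrt_le_sqrt ?_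
    refine (Finset.sum_le_sum fun k _ => treeAvg_moment_sq_le hφ n hK0 hK k (Q + 1)).trans_eq ?_
    simp
  have h4 : (3 : ℝ) ^ (-n) * (3 : ℝ) ^ (n - ((Q + 1 : ℕ) : ℤ)) ≤
      (3 : ℝ) ^ (-s * ((Q + 1 : ℕ) : ℝ)) := by
    rw [← Real.rpow_intCast, ← Real.rpow_intCast, ← Real.rpow_add (by norm_num)]
    refine Real.rpow_le_rpow_of_exponent_le (by norm_num) ?_
    push_cast
    nlinarith
  refine (mul_le_mul_of_nonneg_left (h1.trans (add_le_add_left h2 _)) hn.le).trans ?_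
  rw [mul_add, mul_add, add_mul]
  have e1 : (3 : ℝ) ^ (-n) * ∑ q ∈ Finset.range (Q + 1), (((3 : ℝ) ^ d) ^ (q + 1)) ^ (1 / 2 - 1 / p) *
      (√(40 * d) * (3 : ℝ) ^ (n - ((q + 1 : ℕ) : ℤ)) * √(∑ k, treeAvg (q + 1)
        (fun l => (⨍ x in nodeCube n l, partialDeriv φ k x) ^ 2) [])) =
      √(40 * d) * ∑ q ∈ Finset.range (Q + 1),
        (3 : ℝ) ^ (-s * ((q + 1 : ℕ) : ℝ)) * √(gradientAvgSq n φ (q + 1)) := by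
    rw [Finset.mul_sum, Finset.mul_sum]
    refine Finset.sum_congr rfl fun q _ => ?_
    rw [hpow, ← hscale, gradientAvgSq]
    ring
  rw [e1, add_assoc]
  gcongr _ + (?_ + ?_)
  · rw [hpow, ← hscale]
    have : (0 : ℝ) ≤ (3 : ℝ) ^ (-n) * ((3 : ℝ) ^ ((1 - s) * ((Q + 1 : ℕ) : ℝ)) * √(40 * d)) := by
      positivity
    nlinarith [mul_le_mul_of_nonneg_left h3 this]
  · have : (0 : ℝ) ≤ K * √d := by positivity
    nlinarith [mul_le_mul_of_nonneg_left h4 this]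

/-- The multiscale Sobolev inequality. -/
theorem avgLpNorm_sub_average_le_tsum (hd : 2 ≤ d) {s : ℝ} (hs : 0 < s) (hs1 : s ≤ 1) {φ : 𝔾 → ℝ}
    (hφ : ContDiff ℝ ∞ φ) (n : ℤ) :
    ENNReal.ofReal ((3 : ℝ) ^ (-n)) * avgLpNorm (sobolevExponent d s) (cube (0 : 𝔾) n)
        (fun x => φ x - ⨍ y in cube (0 : 𝔾) n, φ y) ≤
      ENNReal.ofReal √(40 * d) *
        ∑' i : ℕ, ENNReal.ofReal ((3 : ℝ) ^ (-s * (i : ℝ))) * ENNReal.ofReal √(gradientAvgSq n φ i) := by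
  obtain ⟨K, hK0, hK⟩ := exists_norm_fderiv_le_cube hφ (0 : 𝔾) n
  have hp2 : 2 ≤ sobolevExponent d s := two_le_sobolevExponent hd hs hs1
  rw [avgLpNorm_cube_eq (f := fun x => φ x - ⨍ y in cube (0 : 𝔾) n, φ y)
    (hφ.continuous.sub continuous_const) _ _ (by linarith),
    ← ENNReal.ofReal_mul (by positivity)]
  set S := ∑' i : ℕ, ENNReal.ofReal ((3 : ℝ) ^ (-s * (i : ℝ))) * ENNReal.ofReal √(gradientAvgSq n φ i)
    with hS
  set M := √(40 * d) * √d * K + K * √d with hM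
  have hbound : ∀ Q : ℕ, ENNReal.ofReal ((3 : ℝ) ^ (-n) * (⨍ x in cube (0 : 𝔾) n,
      |φ x - ⨍ y in cube (0 : 𝔾) n, φ y| ^ sobolevExponent d s) ^ (1 / sobolevExponent d s)) ≤
      ENNReal.ofReal √(40 * d) * S + ENNReal.ofReal (M * (3 : ℝ) ^ (-s * ((Q + 1 : ℕ) : ℝ))) := by
    intro Q
    refine (ENNReal.ofReal_le_ofReal (setAverage_rpow_le_sum hd hs hs1 hφ n hK0 hK Q)).trans ?_
    rw [ENNReal.ofReal_add (by positivity) (by positivity), ENNReal.ofReal_mul (by positivity)]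
    gcongr
    rw [ENNReal.ofReal_sum_of_nonneg fun _ _ => by positivity]
    refine le_trans ?_ (ENNReal.sum_le_tsum (Finset.range (Q + 1 + 1)))
    -- The finite sum starts at depth `1`; the term of depth `0` of the series is discarded.
    rw [Finset.sum_range_succ' _ (Q + 1)]
    refine le_add_right (Finset.sum_le_sum fun q _ => ?_)
    rw [ENNReal.ofReal_mul (by positivity)]
  have hlim : Tendsto (fun Q : ℕ => ENNReal.ofReal √(40 * d) * S +
      ENNReal.ofReal (M * (3 : ℝ) ^ (-s * ((Q + 1 : ℕ) : ℝ)))) atTop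
      (𝓝 (ENNReal.ofReal √(40 * d) * S + 0)) := by
    refine Tendsto.const_add _ ?_
    rw [← ENNReal.ofReal_zero]
    refine ENNReal.tendsto_ofReal ?_
    rw [← mul_zero M]
    refine Tendsto.const_mul M ?_
    have h1 : Tendsto (fun Q : ℕ => ((3 : ℝ) ^ (-s)) ^ (Q + 1)) atTop (𝓝 0) :=
      (tendsto_pow_atTop_nhds_zero_of_lt_one (by positivity)
        (Real.rpow_lt_one_of_one_lt_of_neg (by norm_num) (by linarith))).comp (tendsto_add_atTop_nat 1)
    refine h1.congr fun Q => ?_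
    rw [← Real.rpow_natCast, ← Real.rpow_mul (by norm_num)]
  rw [add_zero] at hlim
  exact ge_of_tendsto' hlim hbound

end Smooth

/-! ### The energy -/

section Energy

variable {d : ℕ}

local notation "𝔾" => EuclideanSpace ℝ (Fin d)

lemma form_eq_sum (A : Matrix (Fin d) (Fin d) ℝ) (p q : 𝔾) :
    form A p q = ∑ i, ∑ j, p i * (A i j * q j) := by
  simp only [form, dotProduct, Matrix.mulVec, Finset.mul_sum]

lemma form_add_left (A : Matrix (Fin d) (Fin d) ℝ) (p p' q : 𝔾) :
    form A (p + p') q = form A p q + form A p' q := by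
  simp [form, add_dotProduct]

lemma form_add_right (A : Matrix (Fin d) (Fin d) ℝ) (p q q' : 𝔾) :
    form A p (q + q') = form A p q + form A p q' := by
  simp [form, Matrix.mulVec_add, dotProduct_add]

lemma form_smul_left (A : Matrix (Fin d) (Fin d) ℝ) (t : ℝ) (p q : 𝔾) :
    form A (t • p) q = t * form A p q := by
  simp [form]

lemma form_smul_right (A : Matrix (Fin d) (Fin d) ℝ) (t : ℝ) (p q : 𝔾) :
    form A p (t • q) = t * form A p q := by
  simp [form, Matrix.mulVec_smul]

lemma form_symm {A : Matrix (Fin d) (Fin d) ℝ} (hA : A.PosSemidef) (p q : 𝔾) :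
    form A p q = form A q p := by
  have hs : ∀ i j, A i j = A j i := fun i j => by
    simpa using hA.isHermitian.apply j i
  rw [form_eq_sum, form_eq_sum, Finset.sum_comm]
  refine Finset.sum_congr rfl fun i _ => Finset.sum_congr rfl fun j _ => ?_
  rw [hs j i]; ring

lemma form_self_nonneg {A : Matrix (Fin d) (Fin d) ℝ} (hA : A.PosSemidef) (p : 𝔾) :
    0 ≤ form A p p := by
  simpa [form] using hA.dotProduct_mulVec_nonneg p.ofLp

lemma form_add_smul_self {A : Matrix (Fin d) (Fin d) ℝ} (hA : A.PosSemidef) (t : ℝ) (p q : 𝔾) :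
    form A (p + t • q) (p + t • q) = form A p p + 2 * t * form A q p + t ^ 2 * form A q q := by
  simp only [form_add_left, form_add_right, form_smul_left, form_smul_right]
  rw [form_symm hA p q]; ring

lemma form_sq_le {A : Matrix (Fin d) (Fin d) ℝ} (hA : A.PosSemidef) (p q : 𝔾) :
    form A p q ^ 2 ≤ form A p p * form A q q := by
  have h : ∀ t : ℝ, 0 ≤ form A p p * (t * t) + 2 * form A p q * t + form A q q := by
    intro t
    have h1 := form_self_nonneg hA (q + t • p)
    rw [form_add_smul_self hA] at h1
    linarith
  have := discrim_le_zero h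
  rw [discrim] at this
  linarith

lemma abs_form_le {A : Matrix (Fin d) (Fin d) ℝ} (hA : A.PosSemidef) (p q : 𝔾) :
    |form A p q| ≤ √(form A p p) * √(form A q q) := by
  rw [← Real.sqrt_mul (form_self_nonneg hA p), ← Real.sqrt_sq_eq_abs]
  exact Real.sqrt_le_sqrt (form_sq_le hA p q)

lemma sqrt_form_add_le {A : Matrix (Fin d) (Fin d) ℝ} (hA : A.PosSemidef) (p q : 𝔾) :
    √(form A (p + q) (p + q)) ≤ √(form A p p) + √(form A q q) := by
  refine Real.sqrt_le_iff.mpr ⟨by positivity, ?_⟩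
  have h1 := (abs_le.mp (abs_form_le hA p q)).2
  have h2 : form A (p + q) (p + q) = form A p p + 2 * form A p q + form A q q := by
    simp only [form_add_left, form_add_right]
    rw [form_symm hA q p]; ring
  rw [h2, add_sq, Real.sq_sqrt (form_self_nonneg hA p), Real.sq_sqrt (form_self_nonneg hA q)]
  linarith

/-- Cauchy–Schwarz for the form of `A` with `w = A⁻¹ e_i`, since `p · A w = p_i` and `w · A w` is
the diagonal entry of `A⁻¹`. -/
lemma apply_sq_le {A : Matrix (Fin d) (Fin d) ℝ} (hA : A.PosSemidef) (hu : IsUnit A) (p : 𝔾)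
    (i : Fin d) : 0 ≤ A⁻¹ i i ∧ p i ^ 2 ≤ A⁻¹ i i * form A p p := by
  set w : 𝔾 := WithLp.toLp 2 (A⁻¹.mulVec (Pi.single i 1)) with hw
  have hAw : A.mulVec w.ofLp = Pi.single i 1 := by
    rw [hw, Matrix.mulVec_mulVec, Matrix.mul_nonsing_inv _ ((Matrix.isUnit_iff_isUnit_det A).mp hu),
      Matrix.one_mulVec]
  have h1 : form A p w = p i := by rw [form, hAw]; simp
  have h2 : form A w w = A⁻¹ i i := by
    rw [form, hAw]; simp [hw]
  refine ⟨h2 ▸ form_self_nonneg hA w, ?_⟩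
  rw [← h1, ← h2, mul_comm]
  exact form_sq_le hA p w

lemma norm_sq_le_trace_mul_form {A : Matrix (Fin d) (Fin d) ℝ} (hA : A.PosSemidef) (hu : IsUnit A)
    (p : 𝔾) : 0 ≤ A⁻¹.trace ∧ ‖p‖ ^ 2 ≤ A⁻¹.trace * form A p p := by
  refine ⟨Finset.sum_nonneg fun i _ => (apply_sq_le hA hu p i).1, ?_⟩
  rw [EuclideanSpace.norm_sq_eq, Matrix.trace, Finset.sum_mul]
  refine Finset.sum_le_sum fun i _ => ?_
  rw [Real.norm_eq_abs, sq_abs]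
  exact (apply_sq_le hA hu p i).2

variable {a : EuclideanSpace ℝ (Fin d) → Matrix (Fin d) (Fin d) ℝ} {U : Set (EuclideanSpace ℝ (Fin d))}

lemma IsCoefficientField.mono {V : Set 𝔾} (ha : IsCoefficientField a U) (hV : V ⊆ U) :
    IsCoefficientField a V where
  posSemidef := ae_restrict_of_ae_restrict_of_subset hV ha.posSemidef
  invertible := ae_restrict_of_ae_restrict_of_subset hV ha.invertible
  integrable i j := (ha.integrable i j).mono_set hV
  integrable_inv i j := (ha.integrable_inv i j).mono_set hV

lemma aestronglyMeasurable_form (ha : IsCoefficientField a U) {g h : 𝔾 → 𝔾}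
    (hg : AEStronglyMeasurable g (volume.restrict U))
    (hh : AEStronglyMeasurable h (volume.restrict U)) :
    AEStronglyMeasurable (fun x => form (a x) (g x) (h x)) (volume.restrict U) := by
  have hcoord : ∀ {g : 𝔾 → 𝔾}, AEStronglyMeasurable g (volume.restrict U) → ∀ i,
      AEStronglyMeasurable (fun x => g x i) (volume.restrict U) := fun hg i =>
    (EuclideanSpace.proj i : 𝔾 →L[ℝ] ℝ).continuous.comp_aestronglyMeasurable hg
  simp only [form_eq_sum]
  refine Finset.aestronglyMeasurable_fun_sum _ fun i _ => Finset.aestronglyMeasurable_fun_sum _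
    fun j _ => ?_
  exact (hcoord hg i).mul ((ha.integrable i j).aestronglyMeasurable.mul (hcoord hh j))

lemma aemeasurable_ofReal_form (ha : IsCoefficientField a U) {g : 𝔾 → 𝔾}
    (hg : AEStronglyMeasurable g (volume.restrict U)) :
    AEMeasurable (fun x => ENNReal.ofReal (form (a x) (g x) (g x))) (volume.restrict U) :=
  (aestronglyMeasurable_form ha hg hg).aemeasurable.ennreal_ofReal

lemma energy_neg (g : 𝔾 → 𝔾) : energy a U (fun x => -g x) = energy a U g := by
  refine lintegral_congr fun x => ?_
  simp only [← neg_one_smul ℝ (g x), form_smul_left, form_smul_right]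
  simp

lemma energy_smul (t : ℝ) (g : 𝔾 → 𝔾) :
    energy a U (fun x => t • g x) = ENNReal.ofReal (t ^ 2) * energy a U g := by
  rw [energy, energy, ← lintegral_const_mul' _ _ ENNReal.ofReal_ne_top]
  refine lintegral_congr fun x => ?_
  rw [form_smul_left, form_smul_right, ← mul_assoc, ← sq, ENNReal.ofReal_mul (sq_nonneg _)]

lemma energy_eq_eLpNorm (ha : IsCoefficientField a U) (g : 𝔾 → 𝔾) :
    energy a U g ^ (1 / 2 : ℝ) =
      eLpNorm (fun x => √(form (a x) (g x) (g x))) 2 (volume.restrict U) := by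
  rw [eLpNorm_eq_lintegral_rpow_enorm_toReal (by norm_num) (by norm_num), energy]
  simp only [ENNReal.toReal_ofNat]
  congr 1
  refine lintegral_congr_ae ?_
  filter_upwards [ha.posSemidef] with x hx
  rw [← ofReal_norm, Real.norm_of_nonneg (Real.sqrt_nonneg _),
    ENNReal.ofReal_rpow_of_nonneg (Real.sqrt_nonneg _) (by norm_num)]
  congr 1
  norm_num [Real.sq_sqrt (form_self_nonneg hx _)]

/-- Minkowski's inequality for the energy norm. -/
lemma energy_add_le (ha : IsCoefficientField a U) {g h : 𝔾 → 𝔾}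
    (hg : AEStronglyMeasurable g (volume.restrict U))
    (hh : AEStronglyMeasurable h (volume.restrict U)) :
    energy a U (fun x => g x + h x) ^ (1 / 2 : ℝ) ≤
      energy a U g ^ (1 / 2 : ℝ) + energy a U h ^ (1 / 2 : ℝ) := by
  have hm : ∀ {g : 𝔾 → 𝔾}, AEStronglyMeasurable g (volume.restrict U) →
      AEStronglyMeasurable (fun x => √(form (a x) (g x) (g x))) (volume.restrict U) := fun hg =>
    Real.continuous_sqrt.comp_aestronglyMeasurable (aestronglyMeasurable_form ha hg hg)
  rw [energy_eq_eLpNorm ha g, energy_eq_eLpNorm ha h, energy_eq_eLpNorm ha fun x => g x + h x]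
  have h1 := eLpNorm_add_le (p := 2) (hm hg) (hm hh) (by norm_num)
  refine le_trans (eLpNorm_mono_ae ?_) h1
  filter_upwards [ha.posSemidef] with x hx
  have h2 := sqrt_form_add_le hx (g x) (h x)
  rw [Pi.add_apply, Real.norm_of_nonneg (Real.sqrt_nonneg _),
    Real.norm_of_nonneg (add_nonneg (Real.sqrt_nonneg _) (Real.sqrt_nonneg _))]
  exact h2

lemma tendsto_energy (ha : IsCoefficientField a U) {G : ℕ → 𝔾 → 𝔾} {g : 𝔾 → 𝔾}
    (hG : ∀ j, AEStronglyMeasurable (G j) (volume.restrict U))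
    (hg : AEStronglyMeasurable g (volume.restrict U))
    (h : Tendsto (fun j => energy a U fun x => G j x - g x) atTop (𝓝 0)) :
    Tendsto (fun j => energy a U (G j)) atTop (𝓝 (energy a U g)) := by
  have h0 : Tendsto (fun j => energy a U (fun x => G j x - g x) ^ (1 / 2 : ℝ)) atTop (𝓝 0) := by
    have := (ENNReal.continuous_rpow_const (y := (1 / 2 : ℝ))).tendsto 0
    rw [ENNReal.zero_rpow_of_pos (by norm_num)] at this
    exact this.comp h
  have hup : ∀ j, energy a U (G j) ^ (1 / 2 : ℝ) ≤
      energy a U g ^ (1 / 2 : ℝ) + energy a U (fun x => G j x - g x) ^ (1 / 2 : ℝ) := fun j => by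
    have h1 := energy_add_le (h := fun x => G j x - g x) ha hg ((hG j).sub hg)
    simpa only [add_sub_cancel] using h1
  have hlow : ∀ j, energy a U g ^ (1 / 2 : ℝ) - energy a U (fun x => G j x - g x) ^ (1 / 2 : ℝ) ≤
      energy a U (G j) ^ (1 / 2 : ℝ) := fun j => by
    rw [tsub_le_iff_right]
    have h1 := energy_add_le (h := fun x => -(G j x - g x)) ha (hG j) ((hG j).sub hg).neg
    rw [energy_neg fun x => G j x - g x] at h1
    simpa only [neg_sub, add_sub_cancel] using h1
  have hlim : Tendsto (fun j => energy a U (G j) ^ (1 / 2 : ℝ)) atTop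
      (𝓝 (energy a U g ^ (1 / 2 : ℝ))) := by
    refine tendsto_of_tendsto_of_tendsto_of_le_of_le ?_ ?_ hlow hup
    · have := ENNReal.Tendsto.sub (tendsto_const_nhds (x := energy a U g ^ (1 / 2 : ℝ))) h0
        (Or.inr ENNReal.zero_ne_top)
      simpa using this
    · simpa using h0.const_add (energy a U g ^ (1 / 2 : ℝ))
  have h2 := ((ENNReal.continuous_rpow_const (y := (2 : ℝ))).tendsto _).comp hlim
  simp only [Function.comp_def, ← ENNReal.rpow_mul] at h2
  norm_num at h2
  exact h2

lemma energy_parallelogram (ha : IsCoefficientField a U) {g h : 𝔾 → 𝔾}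
    (hg : AEStronglyMeasurable g (volume.restrict U))
    (hh : AEStronglyMeasurable h (volume.restrict U)) :
    energy a U (fun x => g x - h x) + energy a U (fun x => g x + h x) =
      2 * energy a U g + 2 * energy a U h := by
  have e1 := aemeasurable_ofReal_form (g := fun x => g x - h x) ha (hg.sub hh)
  have e2 := aemeasurable_ofReal_form ha hg
  simp only [energy]
  rw [← lintegral_const_mul' _ _ (by norm_num), ← lintegral_const_mul' _ _ (by norm_num),
    ← lintegral_add_left' e1, ← lintegral_add_left' (e2.const_mul _)]
  refine lintegral_congr_ae ?_
  filter_upwards [ha.posSemidef] with x hx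
  rw [two_mul, two_mul, ← ENNReal.ofReal_add (form_self_nonneg hx _) (form_self_nonneg hx _),
    ← ENNReal.ofReal_add (form_self_nonneg hx _) (form_self_nonneg hx _),
    ← ENNReal.ofReal_add (form_self_nonneg hx _) (form_self_nonneg hx _),
    ← ENNReal.ofReal_add (add_nonneg (form_self_nonneg hx _) (form_self_nonneg hx _))
      (add_nonneg (form_self_nonneg hx _) (form_self_nonneg hx _))]
  congr 1
  have h3 := form_add_smul_self hx (-1) (g x) (h x)
  have h4 := form_add_smul_self hx 1 (g x) (h x)
  rw [one_smul] at h4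
  rw [neg_one_smul, ← sub_eq_add_neg] at h3
  linarith

/-- The `L¹` norm of a vector field is controlled by its energy. -/
lemma exists_eLpNorm_one_le_energy (ha : IsCoefficientField a U) :
    ∃ Λ : ℝ≥0∞, Λ ≠ ⊤ ∧ ∀ g : 𝔾 → 𝔾, AEStronglyMeasurable g (volume.restrict U) →
      eLpNorm g 1 (volume.restrict U) ≤ Λ * energy a U g ^ (1 / 2 : ℝ) := by
  have htr : Integrable (fun x => (a x)⁻¹.trace) (volume.restrict U) :=
    integrable_finsetSum _ fun i _ => ha.integrable_inv i i
  refine ⟨(∫⁻ x in U, ENNReal.ofReal (a x)⁻¹.trace) ^ (1 / 2 : ℝ), ?_, fun g hg => ?_⟩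
  · refine ENNReal.rpow_ne_top_of_nonneg (by norm_num) (ne_of_lt ?_)
    refine (lintegral_mono fun x => ?_).trans_lt htr.hasFiniteIntegral
    exact Real.ofReal_le_enorm _
  rw [eLpNorm_one_eq_lintegral_enorm]
  set f1 : 𝔾 → ℝ≥0∞ := fun x => ENNReal.ofReal √((a x)⁻¹.trace)
  set f2 : 𝔾 → ℝ≥0∞ := fun x => ENNReal.ofReal √(form (a x) (g x) (g x))
  have hm1 : AEMeasurable f1 (volume.restrict U) :=
    (Real.continuous_sqrt.measurable.comp_aemeasurable htr.aemeasurable).ennreal_ofReal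
  have hm2 : AEMeasurable f2 (volume.restrict U) :=
    (Real.continuous_sqrt.measurable.comp_aemeasurable
      (aestronglyMeasurable_form ha hg hg).aemeasurable).ennreal_ofReal
  have hsq : ∀ y : ℝ, 0 ≤ y → ENNReal.ofReal √y ^ (2 : ℝ) = ENNReal.ofReal y := by
    intro y hy
    rw [ENNReal.ofReal_rpow_of_nonneg (Real.sqrt_nonneg _) (by norm_num)]
    norm_num [Real.sq_sqrt hy]
  calc ∫⁻ x in U, ‖g x‖ₑ ≤ ∫⁻ x in U, (f1 * f2) x := by
        refine lintegral_mono_ae ?_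
        filter_upwards [ha.posSemidef, ha.invertible] with x hx hx'
        obtain ⟨h1, h2⟩ := norm_sq_le_trace_mul_form hx hx' (g x)
        rw [Pi.mul_apply, ← ofReal_norm, ← ENNReal.ofReal_mul (Real.sqrt_nonneg _), ← Real.sqrt_mul h1]
        exact ENNReal.ofReal_le_ofReal (Real.le_sqrt_of_sq_le h2)
    _ ≤ (∫⁻ x in U, f1 x ^ (2 : ℝ)) ^ (1 / 2 : ℝ) * (∫⁻ x in U, f2 x ^ (2 : ℝ)) ^ (1 / 2 : ℝ) :=
        ENNReal.lintegral_mul_le_Lp_mul_Lq _ Real.HolderConjugate.two_two hm1 hm2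
    _ = _ := by
        congr 2
        · refine lintegral_congr_ae ?_
          filter_upwards [ha.posSemidef, ha.invertible] with x hx hx'
          exact hsq _ (norm_sq_le_trace_mul_form hx hx' (g x)).1
        · refine lintegral_congr_ae ?_
          filter_upwards [ha.posSemidef] with x hx
          exact hsq _ (form_self_nonneg hx _)

lemma continuous_gradient {φ : 𝔾 → ℝ} (hφ : ContDiff ℝ ∞ φ) : Continuous (gradient φ) := by
  unfold gradient
  exact (LinearIsometryEquiv.continuous _).comp (hφ.continuous_fderiv (by simp))

lemma norm_gradient (φ : 𝔾 → ℝ) (x : 𝔾) : ‖gradient φ x‖ = ‖fderiv ℝ φ x‖ := by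
  rw [gradient, LinearIsometryEquiv.norm_map]

lemma gradient_add {φ ψ : 𝔾 → ℝ} (hφ : ContDiff ℝ ∞ φ) (hψ : ContDiff ℝ ∞ ψ) (x : 𝔾) :
    gradient (fun x => φ x + ψ x) x = gradient φ x + gradient ψ x := by
  unfold gradient
  rw [fderiv_fun_add (hφ.differentiable (by simp) x) (hψ.differentiable (by simp) x), map_add]

lemma gradient_sub {φ ψ : 𝔾 → ℝ} (hφ : ContDiff ℝ ∞ φ) (hψ : ContDiff ℝ ∞ ψ) (x : 𝔾) :
    gradient (fun x => φ x - ψ x) x = gradient φ x - gradient ψ x := by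
  unfold gradient
  rw [fderiv_fun_sub (hφ.differentiable (by simp) x) (hψ.differentiable (by simp) x), map_sub]

lemma gradient_const_mul {φ : 𝔾 → ℝ} (hφ : ContDiff ℝ ∞ φ) (t : ℝ) (x : 𝔾) :
    gradient (fun x => t * φ x) x = t • gradient φ x := by
  unfold gradient
  rw [fderiv_const_mul (hφ.differentiable (by simp) x), map_smul]

lemma abs_apply_le_norm (p : 𝔾) (i : Fin d) : |p i| ≤ ‖p‖ := by
  simpa using PiLp.norm_apply_le p i

lemma energy_gradient_ne_top (ha : IsCoefficientField a U) (hU : Bornology.IsBounded U)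
    (hUm : MeasurableSet U) {φ : 𝔾 → ℝ} (hφ : ContDiff ℝ ∞ φ) : energy a U (gradient φ) ≠ ⊤ := by
  obtain ⟨K, hK⟩ := hU.isCompact_closure.exists_bound_of_continuousOn
    (continuous_gradient hφ).continuousOn
  have hint : Integrable (fun x => ∑ i, ∑ j, K ^ 2 * |a x i j|) (volume.restrict U) :=
    integrable_finsetSum _ fun i _ => integrable_finsetSum _ fun j _ =>
      (ha.integrable i j).abs.const_mul _
  refine ne_of_lt (lt_of_le_of_lt (lintegral_mono_ae ?_) hint.lintegral_lt_top)
  refine (ae_restrict_iff' hUm).mpr (ae_of_all _ fun x hx => ENNReal.ofReal_le_ofReal ?_)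
  rw [form_eq_sum]
  refine Finset.sum_le_sum fun i _ => Finset.sum_le_sum fun j _ => ?_
  have hb := hK x (subset_closure hx)
  have h1 := (abs_apply_le_norm (gradient φ x) i).trans hb
  have h2 := (abs_apply_le_norm (gradient φ x) j).trans hb
  have hK0 : 0 ≤ K := (norm_nonneg _).trans hb
  calc gradient φ x i * (a x i j * gradient φ x j)
      ≤ |gradient φ x i| * |gradient φ x j| * |a x i j| := by
        refine (le_abs_self _).trans_eq ?_
        rw [abs_mul, abs_mul]; ring
    _ ≤ K * K * |a x i j| := by gcongr
    _ = _ := by ring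

end Energy

/-! ### Harmonic replacement -/

section Replacement

variable {d : ℕ}

local notation "𝔾" => EuclideanSpace ℝ (Fin d)

/-- Completeness of `L^p`, for sequences of functions. -/
lemma exists_memLp_tendsto {α F : Type*} [MeasurableSpace α] {μ : Measure α} [NormedAddCommGroup F]
    [CompleteSpace F] {p : ℝ≥0∞} (hp : 1 ≤ p) {f : ℕ → α → F} (hf : ∀ j, MemLp (f j) p μ)
    (h : Tendsto (fun ij : ℕ × ℕ => eLpNorm (fun x => f ij.1 x - f ij.2 x) p μ) atTop (𝓝 0)) :
    ∃ u, MemLp u p μ ∧ Tendsto (fun j => eLpNorm (fun x => f j x - u x) p μ) atTop (𝓝 0) := by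
  have : Fact (1 ≤ p) := ⟨hp⟩
  have hc : CauchySeq fun j => (hf j).toLp := by
    rw [EMetric.cauchySeq_iff]
    intro ε hε
    have h1 := h.eventually_lt_const hε
    obtain ⟨⟨N, M⟩, hNM⟩ := eventually_atTop.mp h1
    refine ⟨max N M, fun m hm n hn => ?_⟩
    rw [Lp.edist_toLp_toLp]
    exact hNM (m, n) ⟨(le_max_left _ _).trans hm, (le_max_right _ _).trans hn⟩
  obtain ⟨u, hu⟩ := cauchySeq_tendsto_of_complete hc
  refine ⟨u, Lp.memLp u, ?_⟩
  have h2 := (Lp.tendsto_Lp_iff_tendsto_eLpNorm'' f hf u (Lp.memLp u)).mp (by simpa using hu)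
  exact h2

variable {a : EuclideanSpace ℝ (Fin d) → Matrix (Fin d) (Fin d) ℝ} {U : Set (EuclideanSpace ℝ (Fin d))}

lemma tendsto_eLpNorm_one_of_energy (ha : IsCoefficientField a U) {ι : Type*} {l : Filter ι}
    {G : ι → EuclideanSpace ℝ (Fin d) → EuclideanSpace ℝ (Fin d)}
    (hG : ∀ j, AEStronglyMeasurable (G j) (volume.restrict U))
    (h : Tendsto (fun j => energy a U (G j)) l (𝓝 0)) :
    Tendsto (fun j => eLpNorm (G j) 1 (volume.restrict U)) l (𝓝 0) := by
  obtain ⟨Λ, hΛ, hbound⟩ := exists_eLpNorm_one_le_energy ha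
  have h0 : Tendsto (fun j => Λ * energy a U (G j) ^ (1 / 2 : ℝ)) l (𝓝 0) := by
    have h1 := (ENNReal.continuous_rpow_const (y := (1 / 2 : ℝ))).tendsto 0
    rw [ENNReal.zero_rpow_of_pos (by norm_num)] at h1
    have h2 := ENNReal.Tendsto.const_mul (h1.comp h) (Or.inr hΛ)
    simpa using h2
  exact tendsto_of_tendsto_of_tendsto_of_le_of_le tendsto_const_nhds h0 (fun _ => zero_le)
    fun j => hbound _ (hG j)

/-- Completeness of the space of vector fields of finite energy. -/
lemma exists_energy_limit (ha : IsCoefficientField a U)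
    {G : ℕ → EuclideanSpace ℝ (Fin d) → EuclideanSpace ℝ (Fin d)}
    (hG : ∀ j, MemLp (G j) 1 (volume.restrict U))
    (h : Tendsto (fun ij : ℕ × ℕ => energy a U fun x => G ij.1 x - G ij.2 x) atTop (𝓝 0)) :
    ∃ g, AEStronglyMeasurable g (volume.restrict U) ∧
      Tendsto (fun j => energy a U fun x => G j x - g x) atTop (𝓝 0) := by
  have hGm := fun j => (hG j).aestronglyMeasurable
  obtain ⟨g, hg, hlim⟩ := exists_memLp_tendsto le_rfl hG (tendsto_eLpNorm_one_of_energy ha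
    (G := fun ij : ℕ × ℕ => fun x => G ij.1 x - G ij.2 x) (fun ij => (hGm ij.1).sub (hGm ij.2)) h)
  refine ⟨g, hg.aestronglyMeasurable, ?_⟩
  obtain ⟨ns, hns, hae⟩ := (tendstoInMeasure_of_tendsto_eLpNorm one_ne_zero hGm
    hg.aestronglyMeasurable hlim).exists_seq_tendsto_ae
  rw [ENNReal.tendsto_nhds_zero]
  intro ε hε
  obtain ⟨⟨N, M⟩, hNM⟩ := eventually_atTop.mp (ENNReal.tendsto_nhds_zero.mp h ε hε)
  refine eventually_atTop.mpr ⟨N, fun j hj => ?_⟩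
  -- The energy is lower semicontinuous along the subsequence converging almost everywhere, so the
  -- Cauchy bound passes to the `L¹` limit `g`.
  have hfatou : energy a U (fun x => G j x - g x) ≤
      liminf (fun i => energy a U fun x => G j x - G (ns i) x) atTop := by
    refine le_trans (lintegral_mono_ae ?_) (lintegral_liminf_le' fun i =>
      aemeasurable_ofReal_form (g := fun x => G j x - G (ns i) x) ha ((hGm j).sub (hGm (ns i))))
    filter_upwards [hae] with x hx
    refine le_of_eq (Tendsto.liminf_eq ?_).symm
    refine ENNReal.tendsto_ofReal ?_
    have hc : Continuous fun p : EuclideanSpace ℝ (Fin d) => form (a x) p p := by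
      simp only [form_eq_sum]
      fun_prop
    exact (hc.tendsto _).comp (tendsto_const_nhds.sub hx)
  refine hfatou.trans (liminf_le_of_frequently_le' ?_)
  refine Eventually.frequently ?_
  filter_upwards [hns.tendsto_atTop.eventually_ge_atTop M] with i hi
  exact hNM (j, ns i) ⟨hj, hi⟩

/-- The test functions in `U`. -/
def IsTest (U : Set (EuclideanSpace ℝ (Fin d))) (ψ : EuclideanSpace ℝ (Fin d) → ℝ) : Prop :=
  ContDiff ℝ ∞ ψ ∧ HasCompactSupport ψ ∧ tsupport ψ ⊆ U

lemma IsTest.add {ψ χ : EuclideanSpace ℝ (Fin d) → ℝ} (hψ : IsTest U ψ) (hχ : IsTest U χ) :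
    IsTest U fun x => ψ x + χ x :=
  ⟨hψ.1.add hχ.1, hψ.2.1.add hχ.2.1,
    (tsupport_add ψ χ).trans (Set.union_subset hψ.2.2 hχ.2.2)⟩

lemma IsTest.const_mul {ψ : EuclideanSpace ℝ (Fin d) → ℝ} (hψ : IsTest U ψ) (t : ℝ) :
    IsTest U fun x => t * ψ x :=
  ⟨contDiff_const.mul hψ.1, hψ.2.1.mul_left, (tsupport_mul_subset_right).trans hψ.2.2⟩

lemma IsTest.sub {ψ χ : EuclideanSpace ℝ (Fin d) → ℝ} (hψ : IsTest U ψ) (hχ : IsTest U χ) :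
    IsTest U fun x => ψ x - χ x := by
  have := hψ.add (hχ.const_mul (-1))
  simpa [sub_eq_add_neg] using this

lemma isTest_zero : IsTest U fun _ => 0 :=
  ⟨contDiff_const, HasCompactSupport.zero, by simp [tsupport, Function.support_fun_zero]⟩

lemma support_gradient_subset (ψ : EuclideanSpace ℝ (Fin d) → ℝ) :
    Function.support (gradient ψ) ⊆ tsupport ψ := by
  intro x hx
  refine support_fderiv_subset ℝ ?_
  rw [Function.mem_support] at hx ⊢
  contrapose! hx
  rw [← norm_eq_zero, norm_gradient, hx, norm_zero]

/-- The Poincaré inequality for test functions. -/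
lemma exists_eLpNorm_one_le_gradient (hd : 2 ≤ d) (hU : Bornology.IsBounded U) :
    ∃ C : ℝ≥0∞, C ≠ ⊤ ∧ ∀ ψ, IsTest U ψ →
      eLpNorm ψ 1 (volume.restrict U) ≤ C * eLpNorm (gradient ψ) 1 (volume.restrict U) := by
  refine ⟨eLpNormLESNormFDerivOfLeConst ℝ (volume : Measure (EuclideanSpace ℝ (Fin d))) U 1 1,
    ENNReal.coe_ne_top, fun ψ hψ => ?_⟩
  -- The Gagliardo–Nirenberg–Sobolev inequality with exponent `1`, which must be smaller than the
  -- dimension.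
  have h := eLpNorm_le_eLpNorm_fderiv_of_le (F := ℝ) (volume : Measure (EuclideanSpace ℝ (Fin d)))
    (u := ψ) (s := U) (hψ.1.of_le (by exact_mod_cast le_top))
    ((subset_tsupport ψ).trans hψ.2.2) (p := 1) (q := 1) le_rfl
    (by rw [finrank_euclideanSpace_fin]; exact_mod_cast hd) (by simp) hU
  rw [eLpNorm_restrict_eq_of_support_subset ((subset_tsupport ψ).trans hψ.2.2),
    eLpNorm_restrict_eq_of_support_subset ((support_gradient_subset ψ).trans hψ.2.2)]
  refine h.trans_eq ?_
  congr 1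
  exact eLpNorm_congr_norm_ae (ae_of_all _ fun x => (norm_gradient ψ x).symm)

/-- The gradient of a test function has zero mean. -/
lemma setIntegral_gradient_eq_zero {ψ : EuclideanSpace ℝ (Fin d) → ℝ} (hψ : IsTest U ψ) :
    ∫ x in U, gradient ψ x = 0 := by
  have hcg : HasCompactSupport (gradient ψ) :=
    hψ.2.1.of_isClosed_subset (isClosed_tsupport _)
      (closure_minimal (support_gradient_subset ψ) (isClosed_tsupport ψ))
  have hint : Integrable (gradient ψ) := (continuous_gradient hψ.1).integrable_of_hasCompactSupport hcg
  rw [setIntegral_eq_integral_of_forall_compl_eq_zero fun x hx => by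
    by_contra h
    exact hx (hψ.2.2 (support_gradient_subset ψ h))]
  ext k
  have hψi : Integrable ψ := hψ.1.continuous.integrable_of_hasCompactSupport hψ.2.1
  have hpi : Integrable (fun x => fderiv ℝ ψ x (EuclideanSpace.single k 1)) := by
    have h1 := (EuclideanSpace.proj k : EuclideanSpace ℝ (Fin d) →L[ℝ] ℝ).integrable_comp hint
    refine h1.congr (ae_of_all _ fun x => ?_)
    exact gradient_apply ψ k x
  have h1 := integral_mul_fderiv_eq_neg_fderiv_mul_of_integrable (f := fun _ => (1 : ℝ)) (g := ψ)
    (μ := (volume : Measure (EuclideanSpace ℝ (Fin d)))) (v := EuclideanSpace.single k 1)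
    (by simp) (by simpa using hpi) (by simpa using hψi) (fun _ _ => by fun_prop)
    (fun x _ => hψ.1.differentiable (by simp) x)
  simp at h1
  have h2 := (EuclideanSpace.proj k : EuclideanSpace ℝ (Fin d) →L[ℝ] ℝ).integral_comp_comm hint
  rw [PiLp.zero_apply]
  refine Eq.trans h2.symm (Eq.trans ?_ h1)
  exact integral_congr_ae (ae_of_all _ fun x => gradient_apply ψ k x)

/-- A smooth truncation: the identity on `[-M, M]`, bounded, with derivative between `0` and `1`. -/
lemma exists_smooth_truncation (M : ℝ) (hM : 0 ≤ M) : ∃ (T : ℝ → ℝ) (B : ℝ), ContDiff ℝ ∞ T ∧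
    (∀ x, |x| ≤ M → T x = x ∧ deriv T x = 1) ∧ (∀ x, |T x| ≤ B) ∧ ∀ x, |deriv T x| ≤ 1 := by
  -- The truncation is the primitive of a bump function equal to `1` on `[-(M+1), M+1]`, and is
  -- bounded by its mass.
  let χ : ContDiffBump (0 : ℝ) := ⟨M + 1, M + 2, by linarith, by linarith⟩
  have hχc : Continuous χ := χ.continuous
  have hder : ∀ x, HasDerivAt (fun x => ∫ t in (0 : ℝ)..x, χ t) (χ x) x := fun x =>
    intervalIntegral.integral_hasDerivAt_right (hχc.intervalIntegrable _ _)
      (hχc.stronglyMeasurableAtFilter _ _) hχc.continuousAt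
  have hderiv : deriv (fun x => ∫ t in (0 : ℝ)..x, χ t) = χ := funext fun x => (hder x).deriv
  refine ⟨fun x => ∫ t in (0 : ℝ)..x, χ t, ∫ t, χ t, ?_, ?_, ?_, ?_⟩
  · rw [contDiff_infty_iff_deriv]
    refine ⟨fun x => (hder x).differentiableAt, ?_⟩
    rw [hderiv]
    exact χ.contDiff
  · intro x hx
    refine ⟨?_, ?_⟩
    swap
    · rw [hderiv]
      refine χ.one_of_mem_closedBall ?_
      rw [mem_closedBall_zero_iff, Real.norm_eq_abs]
      show |x| ≤ M + 1
      linarith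
    have : ∫ t in (0 : ℝ)..x, χ t = ∫ t in (0 : ℝ)..x, 1 := by
      refine intervalIntegral.integral_congr fun t ht => ?_
      refine χ.one_of_mem_closedBall ?_
      rw [mem_closedBall_zero_iff, Real.norm_eq_abs]
      have h1 : |t| ≤ |x| := by
        rcases le_total 0 x with h | h
        · rw [Set.uIcc_of_le h] at ht
          rw [abs_of_nonneg ht.1, abs_of_nonneg h]; exact ht.2
        · rw [Set.uIcc_of_ge h] at ht
          rw [abs_of_nonpos ht.2, abs_of_nonpos h]; linarith [ht.1]
      show |t| ≤ M + 1
      linarith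
    simp only [this]
    simp
  · intro x
    rw [← Real.norm_eq_abs]
    refine intervalIntegral.norm_integral_le_integral_norm_uIoc.trans ?_
    have hi : Integrable χ := hχc.integrable_of_hasCompactSupport χ.hasCompactSupport
    have : ∀ t, ‖χ t‖ = χ t := fun t => Real.norm_of_nonneg χ.nonneg
    simp only [this]
    exact setIntegral_le_integral hi (ae_of_all _ fun t => χ.nonneg)
  · intro x
    rw [hderiv, abs_of_nonneg χ.nonneg]
    exact χ.le_one

lemma gradient_comp {T : ℝ → ℝ} (hT : ContDiff ℝ ∞ T) {φ : EuclideanSpace ℝ (Fin d) → ℝ}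
    (hφ : ContDiff ℝ ∞ φ) (x : EuclideanSpace ℝ (Fin d)) :
    gradient (fun x => T (φ x)) x = deriv T (φ x) • gradient φ x := by
  have h1 : HasFDerivAt (fun x => T (φ x)) (deriv T (φ x) • fderiv ℝ φ x) x :=
    (hT.differentiable (by simp) (φ x)).hasDerivAt.comp_hasFDerivAt x
      (hφ.differentiable (by simp) x).hasFDerivAt
  unfold gradient
  rw [h1.fderiv, map_smul]

end Replacement

/-! ### Minimizers of the energy with prescribed boundary values -/

section Minimizer

variable {d : ℕ} {a : EuclideanSpace ℝ (Fin d) → Matrix (Fin d) (Fin d) ℝ}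
  {U : Set (EuclideanSpace ℝ (Fin d))}

local notation "𝔾" => EuclideanSpace ℝ (Fin d)

/-- The least energy of a smooth function with the boundary values of `φ`. -/
def minEnergy (a : 𝔾 → Matrix (Fin d) (Fin d) ℝ) (U : Set 𝔾) (φ : 𝔾 → ℝ) : ℝ≥0∞ :=
  ⨅ (ψ : 𝔾 → ℝ) (_ : IsTest U ψ), energy a U fun x => gradient φ x + gradient ψ x

lemma minEnergy_le (φ : 𝔾 → ℝ) {ψ : 𝔾 → ℝ} (hψ : IsTest U ψ) :
    minEnergy a U φ ≤ energy a U fun x => gradient φ x + gradient ψ x :=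
  iInf₂_le ψ hψ

lemma minEnergy_le_energy (φ : 𝔾 → ℝ) : minEnergy a U φ ≤ energy a U (gradient φ) := by
  refine (minEnergy_le φ (isTest_zero (U := U))).trans_eq ?_
  congr 1
  ext1 x
  have : gradient (fun _ : 𝔾 => (0 : ℝ)) x = 0 := by simp [gradient]
  rw [this, add_zero]

/-- There are nearly minimizing functions satisfying a uniform bound. -/
lemma exists_near_minimizer (ha : IsCoefficientField a U) (hU : Bornology.IsBounded U)
    (hUm : MeasurableSet U) {φ : 𝔾 → ℝ} (hφ : ContDiff ℝ ∞ φ) :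
    ∃ B : ℝ, ∀ δ : ℝ≥0∞, 0 < δ → ∃ ψ, IsTest U ψ ∧
      energy a U (fun x => gradient φ x + gradient ψ x) ≤ minEnergy a U φ + δ ∧
      ∀ x ∈ U, |φ x + ψ x| ≤ B := by
  obtain ⟨K, hK⟩ := hU.isCompact_closure.exists_bound_of_continuousOn hφ.continuous.continuousOn
  -- Truncating `φ + ψ` above the range of `φ` on `U` keeps the boundary values, and `|T'| ≤ 1`
  -- keeps the energy from growing. The bound `B` depends on `φ` but not on `δ`.
  obtain ⟨T, B, hT, hTid, hTB, hT1⟩ := exists_smooth_truncation (max K 0) (le_max_right _ _)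
  have hTφ : ∀ x ∈ U, T (φ x) = φ x ∧ deriv T (φ x) = 1 := fun x hx =>
    hTid _ ((hK x (subset_closure hx)).trans (le_max_left _ _))
  have hm : minEnergy a U φ ≠ ⊤ :=
    ne_top_of_le_ne_top (energy_gradient_ne_top ha hU hUm hφ) (minEnergy_le_energy φ)
  refine ⟨B, fun δ hδ => ?_⟩
  have hlt : minEnergy a U φ < minEnergy a U φ + δ := ENNReal.lt_add_right hm hδ.ne'
  obtain ⟨ψ, hψ, hE⟩ : ∃ ψ, ∃ _ : IsTest U ψ,
      energy a U (fun x => gradient φ x + gradient ψ x) < minEnergy a U φ + δ := by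
    conv at hlt => lhs; unfold minEnergy
    simpa only [iInf_lt_iff] using hlt
  have hs : Function.support (fun x => T (φ x + ψ x) - T (φ x)) ⊆ Function.support ψ := by
    intro x hx
    contrapose! hx
    rw [Function.mem_support, not_not] at hx ⊢
    rw [hx, add_zero, sub_self]
  have hsmooth1 : ContDiff ℝ ∞ fun x => T (φ x + ψ x) := hT.comp (hφ.add hψ.1)
  have hsmooth2 : ContDiff ℝ ∞ fun x => T (φ x) := hT.comp hφ
  have htest : IsTest U fun x => T (φ x + ψ x) - T (φ x) :=
    ⟨hsmooth1.sub hsmooth2, hψ.2.1.of_isClosed_subset (isClosed_tsupport _) (closure_mono hs),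
      (closure_mono hs).trans hψ.2.2⟩
  refine ⟨_, htest, ?_, fun x hx => ?_⟩
  · refine le_trans (lintegral_mono_ae ?_) hE.le
    filter_upwards [ha.posSemidef, ae_restrict_mem hUm] with x hx hxU
    refine ENNReal.ofReal_le_ofReal ?_
    have hgrad : gradient φ x + gradient (fun x => T (φ x + ψ x) - T (φ x)) x =
        deriv T (φ x + ψ x) • (gradient φ x + gradient ψ x) := by
      rw [gradient_sub hsmooth1 hsmooth2, gradient_comp hT hφ, (hTφ x hxU).2, one_smul,
        gradient_comp (φ := fun x => φ x + ψ x) hT (hφ.add hψ.1), gradient_add hφ hψ.1]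
      abel
    rw [hgrad, form_smul_left, form_smul_right, ← mul_assoc]
    refine mul_le_of_le_one_left (form_self_nonneg hx _) ?_
    rw [← sq]
    exact (sq_le_one_iff_abs_le_one _).mpr (hT1 _)
  · have : φ x + (T (φ x + ψ x) - T (φ x)) = T (φ x + ψ x) := by rw [(hTφ x hx).1]; ring
    rw [this]
    exact hTB _

/-- The midpoint of two competitors is a competitor, so its energy is at least the infimum; the
parallelogram law then bounds the energy of the difference. Finiteness of the infimum is needed to
cancel it. -/
lemma energy_sub_le_of_near_minimizer (ha : IsCoefficientField a U) {φ ψ χ : 𝔾 → ℝ}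
    (hφ : ContDiff ℝ ∞ φ) (hψ : IsTest U ψ) (hχ : IsTest U χ) (hm : minEnergy a U φ ≠ ⊤)
    {δ ε : ℝ≥0∞}
    (h1 : energy a U (fun x => gradient φ x + gradient ψ x) ≤ minEnergy a U φ + δ)
    (h2 : energy a U (fun x => gradient φ x + gradient χ x) ≤ minEnergy a U φ + ε) :
    energy a U (fun x => (gradient φ x + gradient ψ x) - (gradient φ x + gradient χ x)) ≤
      2 * δ + 2 * ε := by
  have hc : ∀ {ψ : 𝔾 → ℝ}, IsTest U ψ →
      AEStronglyMeasurable (fun x => gradient φ x + gradient ψ x) (volume.restrict U) := fun hψ =>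
    ((continuous_gradient hφ).add (continuous_gradient hψ.1)).aestronglyMeasurable
  have hpar := energy_parallelogram ha (hc hψ) (hc hχ)
  have hmid := minEnergy_le (a := a) φ ((hψ.const_mul (1 / 2)).add (hχ.const_mul (1 / 2)))
  have heq : energy a U (fun x => gradient φ x + gradient ψ x + (gradient φ x + gradient χ x)) =
      4 * energy a U (fun x => gradient φ x +
        gradient (fun x => 1 / 2 * ψ x + 1 / 2 * χ x) x) := by
    have h4 : (4 : ℝ≥0∞) = ENNReal.ofReal (2 ^ 2) := by norm_num
    rw [h4, ← energy_smul]
    congr 1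
    ext1 x
    rw [gradient_add (contDiff_const.mul hψ.1) (contDiff_const.mul hχ.1), gradient_const_mul hψ.1,
      gradient_const_mul hχ.1]
    module
  rw [heq] at hpar
  have h4m : 4 * minEnergy a U φ ≠ ⊤ := ENNReal.mul_ne_top (by norm_num) hm
  refine (ENNReal.add_le_add_iff_right h4m).mp ?_
  calc _ ≤ _ := add_le_add_right (mul_le_mul_right hmid 4) _
    _ = _ := hpar
    _ ≤ 2 * (minEnergy a U φ + δ) + 2 * (minEnergy a U φ + ε) := by gcongr
    _ = _ := by ring

lemma eLpNorm_two_le_of_bound {α : Type*} [MeasurableSpace α] {μ : Measure α} {f : α → ℝ} {B : ℝ}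
    (h : ∀ᵐ x ∂μ, |f x| ≤ B) :
    eLpNorm f 2 μ ≤ (ENNReal.ofReal B * eLpNorm f 1 μ) ^ (1 / 2 : ℝ) := by
  rw [eLpNorm_eq_lintegral_rpow_enorm_toReal (by norm_num) (by norm_num),
    eLpNorm_one_eq_lintegral_enorm]
  simp only [ENNReal.toReal_ofNat]
  refine ENNReal.rpow_le_rpow ?_ (by norm_num)
  rw [← lintegral_const_mul' _ _ ENNReal.ofReal_ne_top]
  refine lintegral_mono_ae ?_
  filter_upwards [h] with x hx
  rw [ENNReal.rpow_two, sq]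
  gcongr
  rw [← ofReal_norm]
  exact ENNReal.ofReal_le_ofReal hx

lemma integrable_form_self (ha : IsCoefficientField a U) {g : 𝔾 → 𝔾}
    (hg : AEStronglyMeasurable g (volume.restrict U)) (hE : energy a U g ≠ ⊤) :
    IntegrableOn (fun x => form (a x) (g x) (g x)) U := by
  refine ⟨aestronglyMeasurable_form ha hg hg, ?_⟩
  rw [hasFiniteIntegral_iff_ofReal (ha.posSemidef.mono fun x hx => form_self_nonneg hx _)]
  exact hE.lt_top

lemma energy_eq_ofReal (ha : IsCoefficientField a U) {g : 𝔾 → 𝔾}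
    (hg : AEStronglyMeasurable g (volume.restrict U)) (hE : energy a U g ≠ ⊤) :
    energy a U g = ENNReal.ofReal (∫ x in U, form (a x) (g x) (g x)) :=
  (ofReal_integral_eq_lintegral_ofReal (integrable_form_self ha hg hE)
    (ha.posSemidef.mono fun _ hx => form_self_nonneg hx _)).symm

lemma integrable_form (ha : IsCoefficientField a U) {g h : 𝔾 → 𝔾}
    (hg : AEStronglyMeasurable g (volume.restrict U)) (hE : energy a U g ≠ ⊤)
    (hh : AEStronglyMeasurable h (volume.restrict U)) (hF : energy a U h ≠ ⊤) :
    IntegrableOn (fun x => form (a x) (g x) (h x)) U := by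
  refine Integrable.mono' ((integrable_form_self ha hg hE).add (integrable_form_self ha hh hF))
    (aestronglyMeasurable_form ha hg hh) ?_
  filter_upwards [ha.posSemidef] with x hx
  have h1 := abs_form_le hx (g x) (h x)
  have h2 := Real.sq_sqrt (form_self_nonneg hx (g x))
  have h3 := Real.sq_sqrt (form_self_nonneg hx (h x))
  rw [Real.norm_eq_abs, Pi.add_apply]
  nlinarith [sq_nonneg (√(form (a x) (g x) (g x)) - √(form (a x) (h x) (h x))),
    form_self_nonneg hx (g x), form_self_nonneg hx (h x)]

/-- A vector field minimizing the energy along a line is orthogonal to its direction. -/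
lemma setIntegral_form_eq_zero_of_minimizer (ha : IsCoefficientField a U) {g h : 𝔾 → 𝔾}
    (hg : AEStronglyMeasurable g (volume.restrict U)) (hE : energy a U g ≠ ⊤)
    (hh : AEStronglyMeasurable h (volume.restrict U)) (hF : energy a U h ≠ ⊤)
    (hmin : ∀ t : ℝ, energy a U g ≤ energy a U fun x => g x + t • h x) :
    ∫ x in U, form (a x) (h x) (g x) = 0 := by
  have i1 := integrable_form_self ha hg hE
  have i2 := integrable_form ha hh hF hg hE
  have i3 := integrable_form_self ha hh hF
  set b := ∫ x in U, form (a x) (h x) (g x) with hb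
  set c := ∫ x in U, form (a x) (h x) (h x) with hc
  have hc0 : 0 ≤ c := integral_nonneg_of_ae (ha.posSemidef.mono fun x hx => form_self_nonneg hx _)
  have hquad : ∀ t : ℝ, 0 ≤ 2 * t * b + t ^ 2 * c := by
    intro t
    have hgt : AEStronglyMeasurable (fun x => g x + t • h x) (volume.restrict U) :=
      hg.add (hh.const_smul t)
    have hexp : (fun x => form (a x) (g x + t • h x) (g x + t • h x)) =ᵐ[volume.restrict U]
        fun x => form (a x) (g x) (g x) +
          (2 * t * form (a x) (h x) (g x) + t ^ 2 * form (a x) (h x) (h x)) := by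
      filter_upwards [ha.posSemidef] with x hx
      rw [form_add_smul_self hx]; ring
    have hi : IntegrableOn (fun x => form (a x) (g x + t • h x) (g x + t • h x)) U :=
      (i1.add ((i2.const_mul _).add (i3.const_mul _))).congr hexp.symm
    have hEt : energy a U (fun x => g x + t • h x) =
        ENNReal.ofReal (∫ x in U, form (a x) (g x + t • h x) (g x + t • h x)) :=
      (ofReal_integral_eq_lintegral_ofReal hi
        (ha.posSemidef.mono fun x hx => form_self_nonneg hx _)).symm
    have i23 : IntegrableOn (fun x => 2 * t * form (a x) (h x) (g x) +
        t ^ 2 * form (a x) (h x) (h x)) U := (i2.const_mul _).add (i3.const_mul _)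
    have h1 := hmin t
    rw [hEt, energy_eq_ofReal ha hg hE, ENNReal.ofReal_le_ofReal_iff
      (integral_nonneg_of_ae (ha.posSemidef.mono fun x hx => form_self_nonneg hx _)),
      integral_congr_ae hexp, integral_add i1 i23,
      integral_add (i2.const_mul _) (i3.const_mul _), integral_const_mul, integral_const_mul] at h1
    linarith
  -- The optimal choice would be `-b / c`; the denominator `c + 1` also covers `c = 0`.
  have h1 := hquad (-b / (c + 1))
  have hc1 : 0 < c + 1 := by linarith
  have h2 : 2 * (-b / (c + 1)) * b + (-b / (c + 1)) ^ 2 * c = -(b ^ 2 * (c + 2)) / (c + 1) ^ 2 := by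
    field_simp
    ring
  rw [h2, le_div_iff₀ (by positivity)] at h1
  have h3 : b ^ 2 = 0 := by nlinarith [sq_nonneg b]
  simpa using h3

/-- Harmonic replacement: a smooth function has the boundary values of a weak solution of smaller
energy. -/
theorem exists_isSolution (hd : 2 ≤ d) (ha : IsCoefficientField a U) (hU : Bornology.IsBounded U)
    (hUm : MeasurableSet U) {φ : 𝔾 → ℝ} (hφ : ContDiff ℝ ∞ φ) :
    ∃ v g, IsSolution a U v g ∧ energy a U g ≤ energy a U (gradient φ) ∧
      IntegrableOn g U ∧ ∫ x in U, g x = ∫ x in U, gradient φ x := by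
  have : IsFiniteMeasure (volume.restrict U) :=
    ⟨by rw [Measure.restrict_apply_univ]; exact hU.measure_lt_top⟩
  obtain ⟨B, hB⟩ := exists_near_minimizer ha hU hUm hφ
  have hm : minEnergy a U φ ≠ ⊤ :=
    ne_top_of_le_ne_top (energy_gradient_ne_top ha hU hUm hφ) (minEnergy_le_energy φ)
  set δ : ℕ → ℝ≥0∞ := fun j => ((j : ℝ≥0∞) + 1)⁻¹ with hδ
  have hδlim : Tendsto δ atTop (𝓝 0) := by
    have := ENNReal.tendsto_inv_nat_nhds_zero.comp (tendsto_add_atTop_nat 1)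
    simpa [Function.comp_def, hδ] using this
  have hδpos : ∀ j, 0 < δ j := fun j => ENNReal.inv_pos.mpr (by finiteness)
  choose ψ hψ hψE hψB using fun j => hB (δ j) (hδpos j)
  set w : ℕ → 𝔾 → ℝ := fun j x => φ x + ψ j x with hw
  have hws : ∀ j, ContDiff ℝ ∞ (w j) := fun j => hφ.add (hψ j).1
  set G : ℕ → 𝔾 → 𝔾 := fun j x => gradient φ x + gradient (ψ j) x with hG
  have hGc : ∀ j, Continuous (G j) := fun j =>
    (continuous_gradient hφ).add (continuous_gradient (hψ j).1)
  have hbdd : ∀ {F : Type} [NormedAddCommGroup F] {f : 𝔾 → F}, Continuous f →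
      IntegrableOn f U := fun hf =>
    (hf.continuousOn.integrableOn_compact hU.isCompact_closure).mono_set subset_closure
  have hGm : ∀ j, AEStronglyMeasurable (G j) (volume.restrict U) := fun j =>
    (hGc j).aestronglyMeasurable
  have hpair : Tendsto (fun ij : ℕ × ℕ => 2 * δ ij.1 + 2 * δ ij.2) atTop (𝓝 0) := by
    rw [← prod_atTop_atTop_eq]
    have h1 := ENNReal.Tendsto.const_mul (a := 2)
      (hδlim.comp (tendsto_fst (f := atTop) (g := (atTop : Filter ℕ)))) (Or.inr (by norm_num))
    have h2 := ENNReal.Tendsto.const_mul (a := 2)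
      (hδlim.comp (tendsto_snd (g := atTop) (f := (atTop : Filter ℕ)))) (Or.inr (by norm_num))
    simpa using h1.add h2
  have hcauchy : Tendsto (fun ij : ℕ × ℕ => energy a U fun x => G ij.1 x - G ij.2 x) atTop (𝓝 0) :=
    tendsto_of_tendsto_of_tendsto_of_le_of_le tendsto_const_nhds hpair (fun _ => zero_le) fun ij =>
      energy_sub_le_of_near_minimizer ha hφ (hψ ij.1) (hψ ij.2) hm (hψE ij.1) (hψE ij.2)
  obtain ⟨g, hg, hglim⟩ := exists_energy_limit ha
    (fun j => memLp_one_iff_integrable.mpr (hbdd (hGc j))) hcauchy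
  have hwmem : ∀ j, MemLp (w j) 2 (volume.restrict U) := fun j =>
    MemLp.of_bound (hws j).continuous.aestronglyMeasurable B
      ((ae_restrict_iff' hUm).mpr (ae_of_all _ (hψB j)))
  obtain ⟨C, hC, hpoin⟩ := exists_eLpNorm_one_le_gradient hd hU
  have hcauchy1 := tendsto_eLpNorm_one_of_energy ha
    (G := fun ij : ℕ × ℕ => fun x => G ij.1 x - G ij.2 x) (fun ij => (hGm ij.1).sub (hGm ij.2)) hcauchy
  -- The energy yields only `L¹` convergence of gradients, hence of the functions by the Poincaré
  -- inequality; the uniform bound `B` upgrades this to `L²`.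
  have hcauchy2 : Tendsto (fun ij : ℕ × ℕ =>
      eLpNorm (fun x => w ij.1 x - w ij.2 x) 2 (volume.restrict U)) atTop (𝓝 0) := by
    have hlim : Tendsto (fun ij : ℕ × ℕ => (ENNReal.ofReal (B + B) * (C *
        eLpNorm (fun x => G ij.1 x - G ij.2 x) 1 (volume.restrict U))) ^ (1 / 2 : ℝ)) atTop (𝓝 0) := by
      have h1 := (ENNReal.continuous_rpow_const (y := (1 / 2 : ℝ))).tendsto 0
      rw [ENNReal.zero_rpow_of_pos (by norm_num)] at h1
      have h2 := ENNReal.Tendsto.const_mul (ENNReal.Tendsto.const_mul hcauchy1 (Or.inr hC))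
        (Or.inr (ENNReal.ofReal_ne_top (r := B + B)))
      rw [mul_zero, mul_zero] at h2
      exact h1.comp h2
    refine tendsto_of_tendsto_of_tendsto_of_le_of_le tendsto_const_nhds hlim (fun _ => zero_le)
      fun ij => ?_
    refine (eLpNorm_two_le_of_bound (B := B + B) ((ae_restrict_iff' hUm).mpr
      (ae_of_all _ fun x hx => ?_))).trans ?_
    · exact (abs_sub _ _).trans (add_le_add (hψB _ x hx) (hψB _ x hx))
    · have h1 := hpoin _ ((hψ ij.1).sub (hψ ij.2))
      have e1 : (fun x => w ij.1 x - w ij.2 x) = fun x => ψ ij.1 x - ψ ij.2 x := by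
        ext x; simp [hw]
      have e2 : gradient (fun x => ψ ij.1 x - ψ ij.2 x) = fun x => G ij.1 x - G ij.2 x := by
        ext1 x
        rw [gradient_sub (hψ ij.1).1 (hψ ij.2).1]
        simp [hG]
      rw [e2] at h1
      rw [e1]
      exact ENNReal.rpow_le_rpow (mul_le_mul_right h1 _) (by norm_num)
  obtain ⟨v, hv, hvlim⟩ := exists_memLp_tendsto (by norm_num) hwmem hcauchy2
  have hgradw : ∀ j, gradient (w j) = G j := fun j => by
    ext1 x
    exact gradient_add hφ (hψ j).1 x
  have hElim := tendsto_energy ha hGm hg hglim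
  have hEg : energy a U g ≤ minEnergy a U φ := by
    have h1 : Tendsto (fun j => minEnergy a U φ + δ j) atTop (𝓝 (minEnergy a U φ)) := by
      simpa using hδlim.const_add (minEnergy a U φ)
    exact le_of_tendsto_of_tendsto' hElim h1 hψE
  have hEgtop : energy a U g ≠ ⊤ := ne_top_of_le_ne_top hm hEg
  have hL1 : Tendsto (fun j => eLpNorm (fun x => G j x - g x) 1 (volume.restrict U)) atTop (𝓝 0) :=
    tendsto_eLpNorm_one_of_energy ha (fun j => (hGm j).sub hg) hglim
  have hgint : IntegrableOn g U := by
    obtain ⟨Λ, hΛ, hbound⟩ := exists_eLpNorm_one_le_energy ha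
    refine memLp_one_iff_integrable.mp ⟨hg, (hbound g hg).trans_lt ?_⟩
    exact (ENNReal.mul_ne_top hΛ (ENNReal.rpow_ne_top_of_nonneg (by norm_num) hEgtop)).lt_top
  refine ⟨v, g, ⟨⟨hv, hg, w, hws, hvlim, by simpa only [hgradw] using hglim⟩, ?_⟩,
    hEg.trans (minEnergy_le_energy φ), hgint, ?_⟩
  · intro χ hχ1 hχ2 hχ3
    have hχ : IsTest U χ := ⟨hχ1, hχ2, hχ3⟩
    have hχm : AEStronglyMeasurable (gradient χ) (volume.restrict U) :=
      (continuous_gradient hχ1).aestronglyMeasurable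
    refine setIntegral_form_eq_zero_of_minimizer ha hg hEgtop hχm
      (energy_gradient_ne_top ha hU hUm hχ1) fun t => hEg.trans ?_
    have h1 : Tendsto (fun j => energy a U fun x => G j x + t • gradient χ x) atTop
        (𝓝 (energy a U fun x => g x + t • gradient χ x)) := by
      refine tendsto_energy ha (fun j => (hGm j).add (hχm.const_smul t)) (hg.add (hχm.const_smul t)) ?_
      simpa only [add_sub_add_right_eq_sub] using hglim
    refine ge_of_tendsto' h1 fun j => ?_
    refine (minEnergy_le φ ((hψ j).add (hχ.const_mul t))).trans_eq ?_
    congr 1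
    ext1 x
    rw [gradient_add (hψ j).1 (contDiff_const.mul hχ1), gradient_const_mul hχ1, ← add_assoc]
  -- Each `G j` has the same integral as `∇φ`, because gradients of test functions have zero mean,
  -- and `L¹` convergence preserves it.
  · have h1 := tendsto_integral_of_L1' g hg (Eventually.of_forall fun j => hbdd (hGc j)) hL1
    refine tendsto_nhds_unique h1 ?_
    refine tendsto_const_nhds.congr fun j => ?_
    rw [integral_add (hbdd (continuous_gradient hφ)) (hbdd (continuous_gradient (hψ j).1)),
      setIntegral_gradient_eq_zero (hψ j), add_zero]

end Minimizer

/-! ### Averages of gradients and the dual coarse-grained matrix -/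

section Dual

variable {d : ℕ} {a : EuclideanSpace ℝ (Fin d) → Matrix (Fin d) (Fin d) ℝ}

local notation "𝔾" => EuclideanSpace ℝ (Fin d)

lemma ofReal_setAverage_form (z : 𝔾) (m : ℤ) (ha : IsCoefficientField a (cube z m)) {g : 𝔾 → 𝔾}
    (hg : AEStronglyMeasurable g (volume.restrict (cube z m))) (hE : energy a (cube z m) g ≠ ⊤) :
    ENNReal.ofReal (⨍ x in cube z m, form (a x) (g x) (g x)) =
      (volume (cube z m))⁻¹ * energy a (cube z m) g := by
  rw [energy_eq_ofReal ha hg hE, setAverage_eq, smul_eq_mul, ENNReal.ofReal_mul (by positivity),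
    measureReal_cube, volume_cube, ENNReal.ofReal_inv_of_pos (by positivity)]

/-- The weak solution with the boundary values of `t φ` has mean gradient `t b` and mean energy at
most `t² e`. Testing it in the definition of `a_*⁻¹` with `q = b / |b|` gives at least `-t² e + 2 t
|b|`, whose maximum, at `t = |b| / e`, is `|b|² / e`. -/
lemma ofReal_norm_average_gradient_sq_le (hd : 2 ≤ d) (z : 𝔾) (m : ℤ)
    (ha : IsCoefficientField a (cube z m)) {φ : 𝔾 → ℝ} (hφ : ContDiff ℝ ∞ φ) :
    ENNReal.ofReal (‖⨍ x in cube z m, gradient φ x‖ ^ 2) ≤ dualNorm a (cube z m) *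
      ENNReal.ofReal (⨍ x in cube z m, form (a x) (gradient φ x) (gradient φ x)) := by
  set U := cube z m with hU
  set b := ⨍ x in U, gradient φ x with hb
  set e := ⨍ x in U, form (a x) (gradient φ x) (gradient φ x) with he
  have hUb := isBounded_cube z m
  have hUm := measurableSet_cube z m
  have hgm : AEStronglyMeasurable (gradient φ) (volume.restrict U) :=
    (continuous_gradient hφ).aestronglyMeasurable
  have hE := energy_gradient_ne_top ha hUb hUm hφ
  have hV : 0 < volume.real U := by rw [measureReal_cube]; positivity
  rcases eq_or_ne b 0 with hb0 | hb0
  · simp [hb0]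
  -- Zero energy would force `∇φ = 0` almost everywhere, through the `L¹` bound by the energy,
  -- contradicting `b ≠ 0`.
  have he0 : 0 < e := by
    by_contra hcon
    have hz : energy a U (gradient φ) = 0 := by
      have h1 := ofReal_setAverage_form z m ha hgm hE
      rw [ENNReal.ofReal_of_nonpos (not_lt.mp hcon)] at h1
      rcases mul_eq_zero.mp h1.symm with h | h
      · exact absurd (ENNReal.inv_eq_zero.mp h) (volume_cube_ne_top z m)
      · exact h
    obtain ⟨Λ, hΛ, hbound⟩ := exists_eLpNorm_one_le_energy ha
    have h2 := hbound _ hgm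
    rw [hz, ENNReal.zero_rpow_of_pos (by norm_num), mul_zero, nonpos_iff_eq_zero,
      eLpNorm_eq_zero_iff hgm one_ne_zero] at h2
    apply hb0
    rw [hb, setAverage_eq, integral_congr_ae h2]
    simp
  set β := ‖b‖ with hβ
  have hβ0 : 0 < β := norm_pos_iff.mpr hb0
  set t := β / e with ht
  obtain ⟨v, g, hsol, hEg, hgi, hgint⟩ := exists_isSolution hd ha hUb hUm
    (contDiff_const (c := t) |>.mul hφ)
  have hgrad : gradient (fun x => t * φ x) = fun x => t • gradient φ x := by
    ext1 x; exact gradient_const_mul hφ t x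
  rw [hgrad, energy_smul] at hEg
  rw [hgrad, integral_smul] at hgint
  have hgE : energy a U g ≠ ⊤ := ne_top_of_le_ne_top (ENNReal.mul_ne_top ENNReal.ofReal_ne_top hE) hEg
  have hgm' := hsol.1.aestronglyMeasurable_grad
  have hif := integrable_form_self ha hgm' hgE
  set q : 𝔾 := β⁻¹ • b with hq
  have hqn : ‖q‖ = 1 := by
    rw [hq, norm_smul, norm_inv, Real.norm_of_nonneg hβ0.le, ← hβ, inv_mul_cancel₀ hβ0.ne']
  have hqb : inner ℝ q b = β := by
    rw [hq, real_inner_smul_left, real_inner_self_eq_norm_sq, ← hβ]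
    field_simp
  have hb' : ∫ x in U, gradient φ x = volume.real U • b := by
    rw [hb, setAverage_eq, smul_smul, mul_inv_cancel₀ hV.ne', one_smul]
  have he' : ∫ x in U, form (a x) (gradient φ x) (gradient φ x) = volume.real U * e := by
    rw [he, setAverage_eq, smul_eq_mul, ← mul_assoc, mul_inv_cancel₀ hV.ne', one_mul]
  have hform : ∫ x in U, form (a x) (g x) (g x) ≤ t ^ 2 * (volume.real U * e) := by
    rw [energy_eq_ofReal ha hgm' hgE, energy_eq_ofReal ha hgm hE, he',
      ← ENNReal.ofReal_mul (sq_nonneg _), ENNReal.ofReal_le_ofReal_iff (by positivity)] at hEg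
    exact hEg
  have hval : β ^ 2 / e ≤ ⨍ x in U, (-form (a x) (g x) (g x) + 2 * inner ℝ q (g x)) := by
    have hiq : IntegrableOn (fun x => 2 * inner ℝ q (g x)) U := (hgi.const_inner q).const_mul 2
    have hifn : IntegrableOn (fun x => -form (a x) (g x) (g x)) U := hif.neg
    rw [setAverage_eq, integral_add hifn hiq, integral_neg, integral_const_mul,
      integral_inner hgi, hgint, hb', real_inner_smul_right, real_inner_smul_right, hqb, smul_eq_mul,
      inv_mul_eq_div, le_div_iff₀ hV]
    have e1 : β ^ 2 / e * volume.real U =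
        -(t ^ 2 * (volume.real U * e)) + 2 * (t * (volume.real U * β)) := by
      rw [ht]; field_simp; ring
    rw [e1]
    linarith
  have hdual : ENNReal.ofReal (β ^ 2 / e) ≤ dualNorm a U := by
    refine (ENNReal.ofReal_le_ofReal hval).trans ?_
    refine le_trans ?_ (le_iSup₂ (f := fun (q : 𝔾) (_ : ‖q‖ = 1) => dualQuadraticForm a U q) q hqn)
    refine le_trans ?_ (le_iSup (fun v => ⨆ (g : 𝔾 → 𝔾) (_ : IsSolution a U v g), ENNReal.ofReal
      (⨍ x in U, (-form (a x) (g x) (g x) + 2 * inner ℝ q (g x)))) v)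
    exact le_iSup₂ (f := fun (g : 𝔾 → 𝔾) (_ : IsSolution a U v g) => ENNReal.ofReal
      (⨍ x in U, (-form (a x) (g x) (g x) + 2 * inner ℝ q (g x)))) g hsol
  calc ENNReal.ofReal (β ^ 2) = ENNReal.ofReal (β ^ 2 / e) * ENNReal.ofReal e := by
        rw [← ENNReal.ofReal_mul (by positivity), div_mul_cancel₀ _ he0.ne']
    _ ≤ _ := mul_le_mul_left hdual _

/-- The maximum over the subcubes of scale `m - i` of the square root of the dual norm. -/
def maxDualNorm (a : 𝔾 → Matrix (Fin d) (Fin d) ℝ) (m : ℤ) (i : ℕ) : ℝ≥0∞ :=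
  ⨆ (j : Fin d → ℤ) (_ : latticePoint (m - (i : ℤ)) j ∈ cube (0 : 𝔾) m),
    dualNorm a (cube (latticePoint (m - (i : ℤ)) j) (m - (i : ℤ))) ^ (1 / 2 : ℝ)

lemma dualNorm_nodeCube_le (n : ℤ) (l : List (Fin d → Fin 3)) :
    dualNorm a (nodeCube n l) ≤ maxDualNorm a n l.length ^ 2 := by
  obtain ⟨j, hj⟩ := nodeCenter_eq_latticePoint n l
  have hmem : latticePoint (n - (l.length : ℤ)) j ∈ cube (0 : 𝔾) n := by
    rw [← hj]
    exact nodeCube_subset n l (mem_cube_self _ _)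
  have h := le_iSup₂ (f := fun (j : Fin d → ℤ)
    (_ : latticePoint (n - (l.length : ℤ)) j ∈ cube (0 : 𝔾) n) =>
      dualNorm a (cube (latticePoint (n - (l.length : ℤ)) j) (n - (l.length : ℤ))) ^ (1 / 2 : ℝ)) j hmem
  have h2 : (dualNorm a (nodeCube n l) ^ (1 / 2 : ℝ)) ^ 2 ≤ maxDualNorm a n l.length ^ 2 := by
    rw [nodeCube, hj]
    exact pow_le_pow_left₀ zero_le h 2
  rwa [← ENNReal.rpow_two, ← ENNReal.rpow_mul, one_div, inv_mul_cancel₀ two_ne_zero,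
    ENNReal.rpow_one] at h2

lemma gradientAvgSq_eq {φ : 𝔾 → ℝ} (hφ : ContDiff ℝ ∞ φ) (n : ℤ) (i : ℕ) :
    gradientAvgSq n φ i = treeAvg i (fun l => ‖⨍ x in nodeCube n l, gradient φ x‖ ^ 2) [] := by
  rw [gradientAvgSq, ← treeAvg_sum]
  refine treeAvg_congr fun l _ => ?_
  rw [EuclideanSpace.norm_sq_eq]
  refine Finset.sum_congr rfl fun k _ => ?_
  have hint : IntegrableOn (gradient φ) (nodeCube n l) :=
    integrableOn_cube (continuous_gradient hφ) _ _
  have h2 := (EuclideanSpace.proj k : 𝔾 →L[ℝ] ℝ).integral_comp_comm hint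
  rw [Real.norm_eq_abs, sq_abs, setAverage_eq, setAverage_eq, PiLp.smul_apply]
  congr 2
  refine Eq.trans ?_ h2
  exact integral_congr_ae (ae_of_all _ fun x => (gradient_apply φ k x).symm)

/-- The square average of the averages of a gradient over the subcubes of a given scale is controlled
by its energy. -/
lemma ofReal_sqrt_gradientAvgSq_le (hd : 2 ≤ d) (n : ℤ) (ha : IsCoefficientField a (cube 0 n))
    {φ : 𝔾 → ℝ} (hφ : ContDiff ℝ ∞ φ) (i : ℕ) :
    ENNReal.ofReal √(gradientAvgSq n φ i) ≤
      maxDualNorm a n i * avgEnergyNorm a (cube 0 n) (gradient φ) := by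
  have hgm : ∀ V : Set 𝔾, AEStronglyMeasurable (gradient φ) (volume.restrict V) := fun V =>
    (continuous_gradient hφ).aestronglyMeasurable
  have hE := energy_gradient_ne_top ha (isBounded_cube _ _) (measurableSet_cube _ _) hφ
  have hint := integrable_form_self ha (hgm _) hE
  set e := ⨍ x in cube (0 : 𝔾) n, form (a x) (gradient φ x) (gradient φ x) with he
  have he0 : 0 ≤ e := by
    rw [he, setAverage_eq, smul_eq_mul]
    exact mul_nonneg (by positivity)
      (integral_nonneg_of_ae (ha.posSemidef.mono fun x hx => form_self_nonneg hx _))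
  have hnorm : avgEnergyNorm a (cube 0 n) (gradient φ) = ENNReal.ofReal √e := by
    rw [avgEnergyNorm, ← ofReal_setAverage_form 0 n ha (hgm _) hE, Real.sqrt_eq_rpow,
      ENNReal.ofReal_rpow_of_nonneg he0 (by norm_num)]
  have hnode : ∀ l : List (Fin d → Fin 3), l.length = ([] : List (Fin d → Fin 3)).length + i →
      ENNReal.ofReal (‖⨍ x in nodeCube n l, gradient φ x‖ ^ 2) ≤ maxDualNorm a n i ^ 2 *
        ENNReal.ofReal (⨍ x in nodeCube n l, form (a x) (gradient φ x) (gradient φ x)) := by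
    intro l hl
    simp only [List.length_nil, zero_add] at hl
    refine (ofReal_norm_average_gradient_sq_le hd _ _ (ha.mono (nodeCube_subset n l)) hφ).trans ?_
    rw [← hl]
    exact mul_le_mul_left (dualNorm_nodeCube_le n l) _
  rw [hnorm, gradientAvgSq_eq hφ]
  -- With an infinite maximum the bound is trivial unless the energy vanishes; then `∞ · 0 = 0`, and
  -- the mean gradients have to be shown to vanish.
  by_cases hS : maxDualNorm a n i = ⊤
  · rcases he0.eq_or_lt with h0 | h0
    · have hz : energy a (cube 0 n) (gradient φ) = 0 := by
        rw [energy_eq_ofReal ha (hgm _) hE, ENNReal.ofReal_eq_zero]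
        rw [he, setAverage_eq, smul_eq_mul, eq_comm, mul_eq_zero, measureReal_cube] at h0
        rcases h0 with h0 | h0
        · exact absurd h0 (by positivity)
        · exact h0.le
      have hz' : treeAvg i (fun l => ‖⨍ x in nodeCube n l, gradient φ x‖ ^ 2) [] ≤ 0 := by
        rw [← treeAvg_const (E := Fin d → Fin 3) i 0 []]
        refine treeAvg_mono fun l hl => ?_
        have h1 := hnode l hl
        have hEl : energy a (nodeCube n l) (gradient φ) = 0 :=
          le_antisymm ((lintegral_mono_set (nodeCube_subset n l)).trans hz.le) zero_le
        have h2 := ofReal_setAverage_form (nodeCenter n l) (n - l.length)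
          (ha.mono (nodeCube_subset n l)) (hgm _) (by
            change energy a (nodeCube n l) (gradient φ) ≠ ⊤
            rw [hEl]; exact ENNReal.zero_ne_top)
        change _ = (volume (nodeCube n l))⁻¹ * energy a (nodeCube n l) (gradient φ) at h2
        rw [hEl, mul_zero] at h2
        unfold nodeCube at h1
        rw [h2, mul_zero, nonpos_iff_eq_zero, ENNReal.ofReal_eq_zero] at h1
        exact h1
      rw [Real.sqrt_eq_zero'.mpr hz']
      simp
    · rw [hS, ENNReal.top_mul (ENNReal.ofReal_pos.mpr (Real.sqrt_pos.mpr h0)).ne']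
      exact le_top
  · have h1 : treeAvg i (fun l => ‖⨍ x in nodeCube n l, gradient φ x‖ ^ 2) [] ≤
        (maxDualNorm a n i).toReal ^ 2 * e := by
      rw [he, ← treeAvg_setAverage n hint i, ← treeAvg_const_mul]
      refine treeAvg_mono fun l hl => ?_
      have h2 := hnode l hl
      rw [← ENNReal.ofReal_toReal hS, ← ENNReal.ofReal_pow ENNReal.toReal_nonneg,
        ← ENNReal.ofReal_mul (by positivity), ENNReal.ofReal_le_ofReal_iff] at h2
      · exact h2
      · refine mul_nonneg (by positivity) ?_
        rw [setAverage_eq, smul_eq_mul]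
        exact mul_nonneg (by positivity) (integral_nonneg_of_ae
          ((ha.mono (nodeCube_subset n l)).posSemidef.mono fun x hx => form_self_nonneg hx _))
    calc _ ≤ ENNReal.ofReal √((maxDualNorm a n i).toReal ^ 2 * e) :=
          ENNReal.ofReal_le_ofReal (Real.sqrt_le_sqrt h1)
      _ = _ := by
          rw [Real.sqrt_mul (by positivity), Real.sqrt_sq ENNReal.toReal_nonneg,
            ENNReal.ofReal_mul ENNReal.toReal_nonneg, ENNReal.ofReal_toReal hS]

/-- Bernoulli's inequality for `3^(-s) = (1 - 2/3)^s`. Removing the normalizing factor of `λ_s` is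
what produces `s⁻¹`. -/
lemma half_mul_le_one_sub_rpow {s : ℝ} (hs : 0 < s) (hs1 : s ≤ 1) :
    s / 2 ≤ 1 - (3 : ℝ) ^ (-s) := by
  have h := _root_.rpow_one_add_le_one_add_mul_self (s := -2 / 3) (by norm_num) hs.le hs1
  have h2 : (3 : ℝ) ^ (-s) = (1 + -2 / 3) ^ s := by
    rw [Real.rpow_neg (by norm_num), ← Real.inv_rpow (by norm_num)]
    norm_num
  rw [h2]
  linarith

lemma lowerEllipticity_rpow (a : 𝔾 → Matrix (Fin d) (Fin d) ℝ) (s : ℝ) (n : ℤ) :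
    lowerEllipticity a s n ^ (-(1 / 2) : ℝ) = ENNReal.ofReal (1 - (3 : ℝ) ^ (-s)) *
      ∑' i : ℕ, ENNReal.ofReal ((3 : ℝ) ^ (-s * (i : ℝ))) * maxDualNorm a n i := by
  rw [lowerEllipticity, ← ENNReal.rpow_mul]
  norm_num
  rfl

/-- The inequality for smooth functions. -/
theorem avgLpNorm_sub_average_le_of_contDiff (hd : 2 ≤ d) {s : ℝ} (hs : 0 < s) (hs1 : s ≤ 1) (n : ℤ)
    (ha : IsCoefficientField a (cube 0 n)) {φ : 𝔾 → ℝ} (hφ : ContDiff ℝ ∞ φ) :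
    ENNReal.ofReal ((3 : ℝ) ^ (-n)) * avgLpNorm (sobolevExponent d s) (cube (0 : 𝔾) n)
        (fun x => φ x - ⨍ y in cube (0 : 𝔾) n, φ y) ≤
      ENNReal.ofReal (2 * √(40 * d) * s⁻¹) * lowerEllipticity a s n ^ (-(1 / 2) : ℝ) *
        avgEnergyNorm a (cube 0 n) (gradient φ) := by
  refine (avgLpNorm_sub_average_le_tsum hd hs hs1 hφ n).trans ?_
  rw [lowerEllipticity_rpow, ← mul_assoc, mul_assoc (_ * _), ← ENNReal.tsum_mul_right]
  have hc : √(40 * d) ≤ 2 * √(40 * d) * s⁻¹ * (1 - (3 : ℝ) ^ (-s)) := by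
    have h1 := half_mul_le_one_sub_rpow hs hs1
    calc √(40 * d) = 2 * √(40 * d) * s⁻¹ * (s / 2) := by field_simp
      _ ≤ _ := mul_le_mul_of_nonneg_left h1 (by positivity)
  refine mul_le_mul' ?_ (ENNReal.tsum_le_tsum fun i => ?_)
  · rw [← ENNReal.ofReal_mul (by positivity)]
    exact ENNReal.ofReal_le_ofReal hc
  · rw [mul_assoc]
    exact mul_le_mul_right (ofReal_sqrt_gradientAvgSq_le hd n ha hφ i) _

end Dual

/-! ### The `L¹` Poincaré inequality and passage to the limit -/

section Limit

variable {d : ℕ} {a : EuclideanSpace ℝ (Fin d) → Matrix (Fin d) (Fin d) ℝ}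

local notation "𝔾" => EuclideanSpace ℝ (Fin d)

lemma enorm_sub_le_lintegral_segment {φ : 𝔾 → ℝ} (hφ : ContDiff ℝ ∞ φ) (x h : 𝔾) :
    ‖φ (x + h) - φ x‖ₑ ≤ ∫⁻ t in Set.Ioc (0 : ℝ) 1, ‖h‖ₑ * ‖gradient φ (x + t • h)‖ₑ := by
  have hder : ∀ t ∈ Set.uIcc (0 : ℝ) 1, HasDerivAt (fun t : ℝ => φ (x + t • h))
      (fderiv ℝ φ (x + t • h) h) t := by
    intro t _
    have h1 : HasDerivAt (fun t : ℝ => x + t • h) h t := by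
      simpa using ((hasDerivAt_id t).smul_const h).const_add x
    exact (hφ.differentiable (by simp) (x + t • h)).hasFDerivAt.comp_hasDerivAt t h1
  have hcont : Continuous fun t : ℝ => fderiv ℝ φ (x + t • h) h :=
    ((hφ.continuous_fderiv (by simp)).comp (by fun_prop)).clm_apply continuous_const
  have h2 := intervalIntegral.integral_eq_sub_of_hasDerivAt hder (hcont.intervalIntegrable _ _)
  rw [one_smul, zero_smul, add_zero, intervalIntegral.integral_of_le zero_le_one] at h2
  rw [← h2]
  refine (enorm_integral_le_lintegral_enorm _).trans (lintegral_mono fun t => ?_)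
  rw [← ofReal_norm, ← ofReal_norm, ← ofReal_norm, ← ENNReal.ofReal_mul (norm_nonneg _), norm_gradient,
    mul_comm]
  exact ENNReal.ofReal_le_ofReal (ContinuousLinearMap.le_opNorm _ _)

/-- Put `y = x + h` and integrate `∇φ` along the segment, which stays in the convex cube. With `∇φ`
extended by zero, the integral in `x` over the whole space is unaffected by the shift `t h`, and the
integral in `h` contributes the volume of a ball. -/
lemma lintegral_lintegral_enorm_sub_le {φ : 𝔾 → ℝ} (hφ : ContDiff ℝ ∞ φ) (z : 𝔾) (m : ℤ) :
    ∫⁻ x in cube z m, ∫⁻ y in cube z m, ‖φ y - φ x‖ₑ ≤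
      volume (Metric.closedBall (0 : 𝔾) (√d * 3 ^ m)) * ENNReal.ofReal (√d * 3 ^ m) *
        ∫⁻ x in cube z m, ‖gradient φ x‖ₑ := by
  set U := cube z m with hU
  set D : ℝ := √d * 3 ^ m with hD
  set B := Metric.closedBall (0 : 𝔾) D with hB
  have hUm : MeasurableSet U := measurableSet_cube z m
  have hBm : MeasurableSet B := measurableSet_closedBall
  set F : 𝔾 → ℝ≥0∞ := U.indicator fun x => ‖gradient φ x‖ₑ with hF
  have hFm : Measurable F := (continuous_gradient hφ).enorm.measurable.indicator hUm
  set H : 𝔾 → 𝔾 → ℝ≥0∞ := fun x h =>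
    ∫⁻ t in Set.Ioc (0 : ℝ) 1, ENNReal.ofReal D * F (x + t • h) with hH
  have hHm : Measurable (Function.uncurry H) := by
    have : Measurable fun p : (𝔾 × 𝔾) × ℝ => ENNReal.ofReal D * F (p.1.1 + p.2 • p.1.2) :=
      (hFm.comp (by fun_prop)).const_mul _
    exact this.lintegral_prod_right'
  have hpt : ∀ x ∈ U, ∀ y ∈ U, ‖φ y - φ x‖ₑ ≤ B.indicator (H x) (y - x) := by
    intro x hx y hy
    have hxy := norm_sub_le_of_mem_cube hy hx
    have hmem : y - x ∈ B := by rwa [hB, mem_closedBall_zero_iff]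
    rw [Set.indicator_of_mem hmem]
    have h1 := enorm_sub_le_lintegral_segment hφ x (y - x)
    rw [add_sub_cancel] at h1
    refine h1.trans (setLIntegral_mono' measurableSet_Ioc fun t ht => ?_)
    have hseg : x + t • (y - x) ∈ U :=
      (convex_cube z m).add_smul_sub_mem hx hy ⟨ht.1.le, ht.2⟩
    rw [hF, Set.indicator_of_mem hseg]
    refine mul_le_mul_left ?_ _
    rw [← ofReal_norm]
    exact ENNReal.ofReal_le_ofReal hxy
  calc ∫⁻ x in U, ∫⁻ y in U, ‖φ y - φ x‖ₑ
      ≤ ∫⁻ x in U, ∫⁻ h in B, H x h := by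
        refine setLIntegral_mono' hUm fun x hx => ?_
        calc ∫⁻ y in U, ‖φ y - φ x‖ₑ ≤ ∫⁻ y in U, B.indicator (H x) (y - x) :=
              setLIntegral_mono' hUm fun y hy => hpt x hx y hy
          _ ≤ ∫⁻ y, B.indicator (H x) (y - x) := setLIntegral_le_lintegral _ _
          _ = ∫⁻ h in B, H x h := by
              rw [lintegral_sub_right_eq_self (B.indicator (H x)) x, lintegral_indicator hBm]
    _ ≤ ∫⁻ x, ∫⁻ h in B, H x h := setLIntegral_le_lintegral _ _
    _ = ∫⁻ h in B, ∫⁻ x, H x h := lintegral_lintegral_swap hHm.aemeasurable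
    _ = ∫⁻ _ in B, ENNReal.ofReal D * ∫⁻ x in U, ‖gradient φ x‖ₑ := by
        refine lintegral_congr fun h => ?_
        have hm : Measurable fun p : 𝔾 × ℝ => ENNReal.ofReal D * F (p.1 + p.2 • h) :=
          (hFm.comp (by fun_prop)).const_mul _
        rw [hH, lintegral_lintegral_swap hm.aemeasurable]
        have : ∀ t : ℝ, ∫⁻ x, ENNReal.ofReal D * F (x + t • h) =
            ENNReal.ofReal D * ∫⁻ x in U, ‖gradient φ x‖ₑ := fun t => by
          rw [lintegral_const_mul' _ _ ENNReal.ofReal_ne_top, lintegral_add_right_eq_self F,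
            hF, lintegral_indicator hUm]
        simp only [this]
        simp
    _ = _ := by
        rw [setLIntegral_const]
        ring

/-- The `L¹` Poincaré inequality on a cube. -/
lemma exists_lintegral_sub_average_le (z : 𝔾) (m : ℤ) : ∃ K : ℝ≥0∞, K ≠ ⊤ ∧
    ∀ φ : 𝔾 → ℝ, ContDiff ℝ ∞ φ → ∫⁻ x in cube z m, ‖φ x - ⨍ y in cube z m, φ y‖ₑ ≤
      K * eLpNorm (gradient φ) 1 (volume.restrict (cube z m)) := by
  refine ⟨(volume (cube z m))⁻¹ * (volume (Metric.closedBall (0 : 𝔾) (√d * 3 ^ m)) *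
    ENNReal.ofReal (√d * 3 ^ m)), ?_, fun φ hφ => ?_⟩
  · exact ENNReal.mul_ne_top (ENNReal.inv_ne_top.mpr (volume_cube_ne_zero z m))
      (ENNReal.mul_ne_top measure_closedBall_lt_top.ne ENNReal.ofReal_ne_top)
  have hV : 0 < volume.real (cube z m) := by rw [measureReal_cube]; positivity
  have hint := integrableOn_cube hφ.continuous z m
  have hav : ∀ x, φ x - ⨍ y in cube z m, φ y =
      -((volume.real (cube z m))⁻¹ * ∫ y in cube z m, (φ y - φ x)) := by
    intro x
    rw [integral_sub hint (integrableOn_cube continuous_const z m), setIntegral_const, setAverage_eq,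
      smul_eq_mul, smul_eq_mul]
    field_simp
    ring
  rw [mul_assoc, eLpNorm_one_eq_lintegral_enorm]
  refine le_trans ?_ (mul_le_mul_right (lintegral_lintegral_enorm_sub_le hφ z m) _)
  rw [← lintegral_const_mul' _ _ (ENNReal.inv_ne_top.mpr (volume_cube_ne_zero z m))]
  refine lintegral_mono fun x => ?_
  rw [hav, enorm_neg, enorm_mul]
  refine mul_le_mul' (le_of_eq ?_) (enorm_integral_le_lintegral_enorm _)
  rw [← ofReal_norm, Real.norm_of_nonneg (by positivity), measureReal_cube, volume_cube,
    ENNReal.ofReal_inv_of_pos (by positivity)]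

/-- An inequality between an averaged norm and the energy extends from smooth functions to `H¹_a`. -/
theorem avgLpNorm_sub_average_le_of_memH1 {n : ℤ} (ha : IsCoefficientField a (cube 0 n)) {p : ℝ}
    (hp : 0 < p) {K : ℝ≥0∞} (hK : K ≠ ⊤)
    (h : ∀ φ : 𝔾 → ℝ, ContDiff ℝ ∞ φ → avgLpNorm p (cube (0 : 𝔾) n)
      (fun x => φ x - ⨍ y in cube (0 : 𝔾) n, φ y) ≤ K * energy a (cube 0 n) (gradient φ) ^ (1 / 2 : ℝ))
    {u : 𝔾 → ℝ} {g : 𝔾 → 𝔾} (hu : MemH1 a (cube 0 n) u g) :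
    avgLpNorm p (cube (0 : 𝔾) n) (fun x => u x - ⨍ y in cube (0 : 𝔾) n, u y) ≤
      K * energy a (cube 0 n) g ^ (1 / 2 : ℝ) := by
  obtain ⟨φ, hφ, hφu, hφg⟩ := hu.exists_approx
  set U := cube (0 : 𝔾) n with hU
  set μ := volume.restrict U with hμ
  have : IsFiniteMeasure μ := ⟨by
    rw [hμ, Measure.restrict_apply_univ]; exact (volume_cube_ne_top _ _).lt_top⟩
  have hφm : ∀ j, AEStronglyMeasurable (φ j) μ := fun j => (hφ j).continuous.aestronglyMeasurable
  have hum := hu.memLp.aestronglyMeasurable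
  have hL1 : Tendsto (fun j => eLpNorm (φ j - u) 1 μ) atTop (𝓝 0) := by
    have h1 : ∀ j, eLpNorm (φ j - u) 1 μ ≤ eLpNorm (φ j - u) 2 μ * μ Set.univ ^ (1 / 2 : ℝ) := by
      intro j
      refine (eLpNorm_le_eLpNorm_mul_rpow_measure_univ (by norm_num : (1 : ℝ≥0∞) ≤ 2)
        ((hφm j).sub hum)).trans_eq ?_
      norm_num
    have h2 := ENNReal.Tendsto.mul_const (b := μ Set.univ ^ (1 / 2 : ℝ)) hφu
      (Or.inr (ENNReal.rpow_ne_top_of_nonneg (by norm_num) (measure_ne_top _ _)))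
    rw [zero_mul] at h2
    exact tendsto_of_tendsto_of_tendsto_of_le_of_le tendsto_const_nhds h2 (fun _ => zero_le) h1
  have hmean : Tendsto (fun j => ⨍ y in U, φ j y) atTop (𝓝 (⨍ y in U, u y)) := by
    simp only [setAverage_eq]
    exact (tendsto_integral_of_L1' u hum
      (Eventually.of_forall fun j => integrableOn_cube (hφ j).continuous _ _) hL1).const_smul _
  obtain ⟨ns, hns, hae⟩ := (tendstoInMeasure_of_tendsto_eLpNorm one_ne_zero hφm hum
    hL1).exists_seq_tendsto_ae
  have hen : Tendsto (fun j => energy a U (gradient (φ j))) atTop (𝓝 (energy a U g)) :=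
    tendsto_energy ha (fun j => (continuous_gradient (hφ j)).aestronglyMeasurable)
      hu.aestronglyMeasurable_grad hφg
  have hrhs : Tendsto (fun i => K * energy a U (gradient (φ (ns i))) ^ (1 / 2 : ℝ)) atTop
      (𝓝 (K * energy a U g ^ (1 / 2 : ℝ))) :=
    ENNReal.Tendsto.const_mul (((ENNReal.continuous_rpow_const (y := (1 / 2 : ℝ))).tendsto _).comp
      (hen.comp hns.tendsto_atTop)) (Or.inr hK)
  have hV := volume_cube_ne_zero (0 : 𝔾) n
  have hV' := volume_cube_ne_top (0 : 𝔾) n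
  -- Along an almost everywhere convergent subsequence the means converge too, so Fatou's lemma
  -- applies to the centred functions.
  have hfatou : ∫⁻ x in U, ‖u x - ⨍ y in U, u y‖ₑ ^ p ≤
      liminf (fun i => ∫⁻ x in U, ‖φ (ns i) x - ⨍ y in U, φ (ns i) y‖ₑ ^ p) atTop := by
    refine le_trans (lintegral_mono_ae ?_) (lintegral_liminf_le' fun i =>
      (((hφm (ns i)).sub aestronglyMeasurable_const).enorm.pow_const p))
    filter_upwards [hae] with x hx
    refine le_of_eq (Tendsto.liminf_eq ?_).symm
    exact ((ENNReal.continuous_rpow_const (y := p)).tendsto _).comp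
      ((hx.sub (hmean.comp hns.tendsto_atTop)).enorm)
  have hbd : ∀ i, ∫⁻ x in U, ‖φ (ns i) x - ⨍ y in U, φ (ns i) y‖ₑ ^ p ≤
      volume U * (K * energy a U (gradient (φ (ns i))) ^ (1 / 2 : ℝ)) ^ p := by
    intro i
    have h1 := ENNReal.rpow_le_rpow (h (φ (ns i)) (hφ _)) hp.le
    rw [avgLpNorm, ← ENNReal.rpow_mul, one_div, inv_mul_cancel₀ hp.ne', ENNReal.rpow_one] at h1
    have h2 := mul_le_mul_right h1 (volume U)
    rwa [← mul_assoc, ENNReal.mul_inv_cancel hV hV', one_mul] at h2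
  have hlim : Tendsto (fun i => volume U *
      (K * energy a U (gradient (φ (ns i))) ^ (1 / 2 : ℝ)) ^ p) atTop
      (𝓝 (volume U * (K * energy a U g ^ (1 / 2 : ℝ)) ^ p)) :=
    ENNReal.Tendsto.const_mul (((ENNReal.continuous_rpow_const (y := p)).tendsto _).comp hrhs)
      (Or.inr hV')
  have hfin : ∫⁻ x in U, ‖u x - ⨍ y in U, u y‖ₑ ^ p ≤
      volume U * (K * energy a U g ^ (1 / 2 : ℝ)) ^ p :=
    hfatou.trans ((liminf_le_liminf (Eventually.of_forall hbd)).trans_eq hlim.liminf_eq)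
  calc avgLpNorm p U (fun x => u x - ⨍ y in U, u y)
      ≤ ((volume U)⁻¹ * (volume U * (K * energy a U g ^ (1 / 2 : ℝ)) ^ p)) ^ (1 / p) :=
        ENNReal.rpow_le_rpow (mul_le_mul_right hfin _) (by positivity)
    _ = _ := by
        rw [← mul_assoc, ENNReal.inv_mul_cancel hV hV', one_mul, ← ENNReal.rpow_mul,
          mul_one_div_cancel hp.ne', ENNReal.rpow_one]

/-- A function in `H¹_a` of zero energy is constant. -/
lemma ae_eq_average_of_energy_eq_zero {n : ℤ} (ha : IsCoefficientField a (cube 0 n)) {u : 𝔾 → ℝ}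
    {g : 𝔾 → 𝔾} (hu : MemH1 a (cube 0 n) u g) (hg : energy a (cube 0 n) g = 0) :
    ∀ᵐ x ∂(volume.restrict (cube (0 : 𝔾) n)), u x - ⨍ y in cube (0 : 𝔾) n, u y = 0 := by
  obtain ⟨K, hK, hpoinc⟩ := exists_lintegral_sub_average_le (0 : 𝔾) n
  obtain ⟨Λ, hΛ, hbound⟩ := exists_eLpNorm_one_le_energy ha
  have hV := ENNReal.inv_ne_top.mpr (volume_cube_ne_zero (0 : 𝔾) n)
  have hm : AEMeasurable (fun x => ‖u x - ⨍ y in cube (0 : 𝔾) n, u y‖ₑ)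
      (volume.restrict (cube (0 : 𝔾) n)) :=
    (hu.memLp.aestronglyMeasurable.sub aestronglyMeasurable_const).enorm
  -- For `p = 1` the Poincaré inequality and the `L¹` bound by the energy give a finite constant
  -- whatever the value of `λ_s`.
  have h := avgLpNorm_sub_average_le_of_memH1 ha one_pos
    (K := (volume (cube (0 : 𝔾) n))⁻¹ * (K * Λ)) (ENNReal.mul_ne_top hV (ENNReal.mul_ne_top hK hΛ))
    (fun φ hφ => by
      simp only [avgLpNorm, ENNReal.rpow_one, div_one]
      rw [mul_assoc, mul_assoc]
      exact mul_le_mul_right ((hpoinc φ hφ).trans (mul_le_mul_right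
        (hbound _ (continuous_gradient hφ).aestronglyMeasurable) _)) _) hu
  simp only [avgLpNorm, ENNReal.rpow_one, div_one] at h
  rw [hg, ENNReal.zero_rpow_of_pos (by norm_num), mul_zero, nonpos_iff_eq_zero, mul_eq_zero,
    lintegral_eq_zero_iff' hm] at h
  rcases h with h | h
  · exact absurd (ENNReal.inv_eq_zero.mp h) (volume_cube_ne_top _ _)
  · filter_upwards [h] with x hx
    simpa using hx

lemma avgLpNorm_eq_zero {p : ℝ} (hp : 0 < p) {U : Set 𝔾} {f : 𝔾 → ℝ}
    (hf : ∀ᵐ x ∂(volume.restrict U), f x = 0) : avgLpNorm p U f = 0 := by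
  have : ∫⁻ x in U, ‖f x‖ₑ ^ p = 0 := by
    refine lintegral_eq_zero_of_ae_eq_zero ?_
    filter_upwards [hf] with x hx
    simp [hx, hp]
  rw [avgLpNorm, this, mul_zero, ENNReal.zero_rpow_of_pos (by positivity)]

end Limit

end CoarseGrained

end

theorem propositionp (d : ℕ) (hd : 2 ≤ d) :
    ∃ C : ℝ, 0 < C ∧ ∀ s : ℝ, 0 < s → s ≤ 1 → ∀ n : ℤ,
      ∀ a : EuclideanSpace ℝ (Fin d) → Matrix (Fin d) (Fin d) ℝ,
        CoarseGrained.IsCoefficientField a (CoarseGrained.cube 0 n) →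
      ∀ (u : EuclideanSpace ℝ (Fin d) → ℝ)
        (g : EuclideanSpace ℝ (Fin d) → EuclideanSpace ℝ (Fin d)),
        CoarseGrained.MemH1 a (CoarseGrained.cube 0 n) u g →
        ENNReal.ofReal ((3 : ℝ) ^ (-n)) *
            CoarseGrained.avgLpNorm (CoarseGrained.sobolevExponent d s) (CoarseGrained.cube 0 n)
              (fun x => u x - ⨍ y in CoarseGrained.cube 0 n, u y) ≤
          ENNReal.ofReal (C * s⁻¹) * CoarseGrained.lowerEllipticity a s n ^ (-(1 / 2) : ℝ) *
            CoarseGrained.avgEnergyNorm a (CoarseGrained.cube 0 n) g := by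
  have hd0 : (0 : ℝ) < d := by exact_mod_cast (by omega : 0 < d)
  -- `√(40 d)` comes from the multiscale inequality and `2` from `s / 2 ≤ 1 - 3^(-s)`.
  refine ⟨2 * √(40 * d), by positivity, fun s hs hs1 n a ha u g hu => ?_⟩
  have hp : 0 < CoarseGrained.sobolevExponent d s :=
    two_pos.trans_le (CoarseGrained.two_le_sobolevExponent hd hs hs1)
  set U := CoarseGrained.cube (0 : EuclideanSpace ℝ (Fin d)) n with hU
  set L := ENNReal.ofReal (2 * √(40 * d) * s⁻¹) *
    CoarseGrained.lowerEllipticity a s n ^ (-(1 / 2) : ℝ) with hL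
  have hV : volume U ≠ 0 := CoarseGrained.volume_cube_ne_zero _ _
  have hV' : volume U ≠ ⊤ := CoarseGrained.volume_cube_ne_top _ _
  have hnorm : ∀ G, CoarseGrained.avgEnergyNorm a U G =
      (volume U)⁻¹ ^ (1 / 2 : ℝ) * CoarseGrained.energy a U G ^ (1 / 2 : ℝ) := fun G =>
    ENNReal.mul_rpow_of_nonneg _ _ (by norm_num)
  -- The passage to `H¹_a` needs a finite constant. If `L` is infinite, the claim has content only
  -- for zero energy, where `u` is constant.
  by_cases hLt : L = ⊤
  · by_cases hg : CoarseGrained.energy a U g = 0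
    · rw [CoarseGrained.avgLpNorm_eq_zero hp (CoarseGrained.ae_eq_average_of_energy_eq_zero ha hu hg),
        mul_zero]
      exact zero_le
    · have : CoarseGrained.avgEnergyNorm a U g ≠ 0 := by
        rw [CoarseGrained.avgEnergyNorm, ne_eq, ENNReal.rpow_eq_zero_iff_of_pos (by norm_num)]
        exact mul_ne_zero (ENNReal.inv_ne_zero.mpr hV') hg
      rw [hLt, ENNReal.top_mul this]
      exact le_top
  · have hr0 : ENNReal.ofReal ((3 : ℝ) ^ (-n)) ≠ 0 := by
      rw [ne_eq, ENNReal.ofReal_eq_zero, not_le]; positivity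
    have hr1 : ENNReal.ofReal ((3 : ℝ) ^ (-n)) ≠ ⊤ := ENNReal.ofReal_ne_top
    have hVh : (volume U)⁻¹ ^ (1 / 2 : ℝ) ≠ ⊤ :=
      ENNReal.rpow_ne_top_of_nonneg (by norm_num) (ENNReal.inv_ne_top.mpr hV)
    have h := CoarseGrained.avgLpNorm_sub_average_le_of_memH1 ha hp
      (K := (ENNReal.ofReal ((3 : ℝ) ^ (-n)))⁻¹ * (L * (volume U)⁻¹ ^ (1 / 2 : ℝ)))
      (ENNReal.mul_ne_top (ENNReal.inv_ne_top.mpr hr0) (ENNReal.mul_ne_top hLt hVh))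
      (fun φ hφ => by
        have h1 := CoarseGrained.avgLpNorm_sub_average_le_of_contDiff hd hs hs1 n ha hφ
        rw [hnorm, ← mul_assoc] at h1
        rw [mul_assoc, ← ENNReal.mul_le_iff_le_inv hr0 hr1]
        exact h1) hu
    rw [mul_assoc, ← ENNReal.mul_le_iff_le_inv hr0 hr1] at h
    rw [hnorm, ← mul_assoc]
    exact h
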